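/- **Setting.** Let $J\in\mathbb R^{3\times3}$ be symmetric positive definite, let $b_1,b_2\in\mathbb R^3$ be orthonormal, and let $R_d:[0,\infty)\to SO(3)$ be smooth with $\dot R_d=\hat\omega_dR_d$ and $\omega_d:[0,\infty)\to\mathbb R^3$ bounded, where $\hat xy=x\times y$. Put $r_{d_i}=R_db_i$ for $i=1,2$. Consider the rigid body $$J\dot\Omega+\Omega\times J\Omega=u,\qquad \dot R=R\hat\Omega,\qquad (R,\Omega)\in SO(3)\times\mathbb R^3,\qquad \omega=R\Omega .$$ **Controller.** For $i=1,2$ let $\Psi_{N_i}=1-Rb_i\cdot r_{d_i}$ and $\Psi_{E_i}=\alpha+\beta\,Rb_i\cdot(r_{d_1}\times r_{d_2})$. For the modes $\mathbf m\in\{I,II,III\}$ let $$\Psi_I=k_1\Psi_{N_1}+k_2\Psi_{N_2},\quad \Psi_{II}=k_1\Psi_{N_1}+k_2\Psi_{E_2},\quad \Psi_{III}=k_1\Psi_{E_1}+k_2\Psi_{N_2},\qquad \rho=\min_{\mathbf m}\Psi_{\mathbf m}.$$ The state $(R,\Omega,\mathbf m)$ may flow with constant $\mathbf m$ while $\Psi_{\mathbf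 m}-\rho\le\delta$, and may jump when $\Psi_{\mathbf m}-\rho\ge\delta$; at a jump $(R,\Omega)$ is unchanged and the new mode is any element of $\{\mathbf m:\Psi_{\mathbf m}=\rho\}$. During flow $$u=-e_H-k_\Omega e_\Omega+(R^T\omega_d)^\wedge JR^T\omega_d+JR^T\dot\omega_d,\qquad e_\Omega=\Omega-R^T\omega_d,\qquad e_H=k_1e_{H_1}+k_2e_{H_2},$$ where $e_{H_1}=R^Tr_{d_1}\times b_1$ in modes $I,II$ and $e_{H_1}=-\beta\,(R^T(r_{d_1}\times r_{d_2}))\times b_1$ in mode $III$, while $e_{H_2}=R^Tr_{d_2}\times b_2$ in modes $I,III$ and $e_{H_2}=-\beta\,(R^T(r_{d_1}\times r_{d_2}))\times b_2$ in mode $II$. Solutions are hybrid arcs parametrized by $(t,j)$, where $t$ is time and $j$ is the number of jumps so far. **Proposition 3.** Let $k_1,k_2,k_\Omega>0$, $k_1\ne k_2$, $1<\alpha<2$, $0<|\beta|<\alpha-1$ and $$0<\delta<\min\{k_1,k_2\}\,\min\{2-\alpha,\ \alpha-|\beta|-1\}.$$ Then the desired trajectory $(R_d,\omega_d)$ is globally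 exponentially stable for the hybrid closed loop. That is: from every initial time $t_0\ge0$ and every initial state $(R_0,\Omega_0,\mathbf m_0)\in SO(3)\times\mathbb R^3\times\{I,II,III\}$ there is a solution that exists for all $t\ge t_0$; every maximal solution exists for all $t\ge t_0$; and there are constants $M,\lambda>0$, independent of the initial time and the initial state, such that every solution satisfies, at all $(t,j)$ in its domain, $$\|R-R_d\|_F+\|\omega-\omega_d\|\ \Big|_{(t,j)}\ \le\ M e^{-\lambda(t-t_0)}\Big(\|R-R_d\|_F+\|\omega-\omega_d\|\Big)\Big|_{(t_0,0)} .$$ -/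

import Mathlib

open scoped Matrix ContDiff

noncomputable section

namespace AttitudeTracking

/-- Column vectors of `ℝ³`; the Euclidean norm is `eucNorm` below. -/
abbrev Vec3 := Fin 3 → ℝ

abbrev Mat3 := Matrix (Fin 3) (Fin 3) ℝ

/-- The rotation group `{R | RᵀR = I, det R = 1}`. -/
abbrev SO3 : Submonoid Mat3 := Matrix.specialOrthogonalGroup (Fin 3) ℝ

/-- The Euclidean norm on `ℝ³`. -/
def eucNorm (x : Vec3) : ℝ := Real.sqrt (x ⬝ᵥ x)

/-- The Frobenius norm on `3 × 3` matrices. -/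
def frobNorm (A : Mat3) : ℝ := Real.sqrt (Aᵀ * A).trace

/-- The hat map: `hat x *ᵥ y = x ⨯₃ y`. -/
def hat (x : Vec3) : Mat3 :=
  !![0, -x 2, x 1; x 2, 0, -x 0; -x 1, x 0, 0]

theorem hat_mulVec (x y : Vec3) : hat x *ᵥ y = x ⨯₃ y := by
  ext i
  fin_cases i <;> simp [hat, Matrix.mulVec, dotProduct, Fin.sum_univ_three, crossProduct] <;> ring

/-- The discrete modes: `I` nominal, `II` and `III` expelling. -/
inductive Mode
  | I
  | II
  | III

/-- State of the hybrid closed loop: attitude, body angular velocity, discrete mode. -/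
structure State where
  R : Mat3
  Ω : Vec3
  m : Mode

/-- A desired trajectory: attitude and angular velocity in the inertial frame. -/
structure Reference where
  Rd : ℝ → Mat3
  ωd : ℝ → Vec3

/-- `ref` is a smooth curve `[0, ∞) → SO(3)` with `dRd/dt = hat ωd * Rd` and bounded `ωd`.
Smoothness and derivatives of matrix-valued curves are taken entrywise. -/
structure Reference.IsAdmissible (ref : Reference) : Prop where
  mem_SO3 : ∀ t, 0 ≤ t → ref.Rd t ∈ SO3
  smooth : ∀ i j, ContDiffOn ℝ ∞ (fun t => ref.Rd t i j) (Set.Ici 0)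
  kinematics : ∀ t, 0 ≤ t → ∀ i j,
    HasDerivWithinAt (fun s => ref.Rd s i j) ((hat (ref.ωd t) * ref.Rd t) i j) (Set.Ici 0) t
  bounded : ∃ B, ∀ t, 0 ≤ t → eucNorm (ref.ωd t) ≤ B

/-- Inertia matrix, body-fixed directions, gains and switching parameters. -/
structure Params where
  J : Mat3
  b₁ : Vec3
  b₂ : Vec3
  k₁ : ℝ
  k₂ : ℝ
  kΩ : ℝ
  α : ℝ
  β : ℝ
  δ : ℝ

section Controller

variable (p : Params) (ref : Reference)

/-- Desired directions. -/
def rd₁ (t : ℝ) : Vec3 := ref.Rd t *ᵥ p.b₁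

def rd₂ (t : ℝ) : Vec3 := ref.Rd t *ᵥ p.b₂

/-- Nominal configuration error functions. -/
def ΨN₁ (t : ℝ) (R : Mat3) : ℝ := 1 - (R *ᵥ p.b₁) ⬝ᵥ rd₁ p ref t

def ΨN₂ (t : ℝ) (R : Mat3) : ℝ := 1 - (R *ᵥ p.b₂) ⬝ᵥ rd₂ p ref t

/-- Expelling configuration error functions. -/
def ΨE₁ (t : ℝ) (R : Mat3) : ℝ :=
  p.α + p.β * ((R *ᵥ p.b₁) ⬝ᵥ (rd₁ p ref t ⨯₃ rd₂ p ref t))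

def ΨE₂ (t : ℝ) (R : Mat3) : ℝ :=
  p.α + p.β * ((R *ᵥ p.b₂) ⬝ᵥ (rd₁ p ref t ⨯₃ rd₂ p ref t))

/-- Configuration error function of each mode. -/
def Ψ (t : ℝ) (R : Mat3) : Mode → ℝ
  | .I => p.k₁ * ΨN₁ p ref t R + p.k₂ * ΨN₂ p ref t R
  | .II => p.k₁ * ΨN₁ p ref t R + p.k₂ * ΨE₂ p ref t R
  | .III => p.k₁ * ΨE₁ p ref t R + p.k₂ * ΨN₂ p ref t R

/-- The minimum of the configuration error functions over the three modes. -/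
def ρ (t : ℝ) (R : Mat3) : ℝ :=
  min (Ψ p ref t R .I) (min (Ψ p ref t R .II) (Ψ p ref t R .III))

/-- The set-valued jump map: the modes of minimal configuration error. -/
def jumpMap (t : ℝ) (R : Mat3) : Set Mode := {m | Ψ p ref t R m = ρ p ref t R}

/-- The jump set at time `t`. -/
def jumpSet (t : ℝ) : Set State := {x | p.δ ≤ Ψ p ref t x.R x.m - ρ p ref t x.R}

/-- The flow set at time `t`. -/
def flowSet (t : ℝ) : Set State := {x | Ψ p ref t x.R x.m - ρ p ref t x.R ≤ p.δ}

/-- Angular velocity error. -/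
def eΩ (t : ℝ) (x : State) : Vec3 := x.Ω - x.Rᵀ *ᵥ ref.ωd t

/-- Hybrid configuration error vectors. -/
def eH₁ (t : ℝ) (x : State) : Vec3 :=
  match x.m with
  | .I | .II => (x.Rᵀ *ᵥ rd₁ p ref t) ⨯₃ p.b₁
  | .III => -(p.β • ((x.Rᵀ *ᵥ (rd₁ p ref t ⨯₃ rd₂ p ref t)) ⨯₃ p.b₁))

def eH₂ (t : ℝ) (x : State) : Vec3 :=
  match x.m with
  | .I | .III => (x.Rᵀ *ᵥ rd₂ p ref t) ⨯₃ p.b₂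
  | .II => -(p.β • ((x.Rᵀ *ᵥ (rd₁ p ref t ⨯₃ rd₂ p ref t)) ⨯₃ p.b₂))

def eH (t : ℝ) (x : State) : Vec3 := p.k₁ • eH₁ p ref t x + p.k₂ • eH₂ p ref t x

/-- The control moment. -/
def control (t : ℝ) (x : State) : Vec3 :=
  -eH p ref t x - p.kΩ • eΩ ref t x
    + hat (x.Rᵀ *ᵥ ref.ωd t) *ᵥ (p.J *ᵥ (x.Rᵀ *ᵥ ref.ωd t))
    + p.J *ᵥ (x.Rᵀ *ᵥ derivWithin ref.ωd (Set.Ici 0) t)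

end Controller

/-- Hybrid time domains with initial time `t₀`: subsets `E` of `ℝ × ℕ` whose truncation at each
`(T, N) ∈ E` is `⋃_{j ≤ N} [τ j, τ (j+1)] × {j}` with `t₀ = τ 0 ≤ τ 1 ≤ … ≤ τ (N+1)`; equivalently
`E` is a finite or infinite union of such consecutive intervals, where a last interval may also be
`[τ j, T)` with `T ≤ ∞`. The field `ordered` excludes branching domains. -/
structure IsHybridTimeDomain (t₀ : ℝ) (E : Set (ℝ × ℕ)) : Prop where
  nonempty : E.Nonempty
  ordered : ∀ s i t j, (s, i) ∈ E → (t, j) ∈ E → i < j → s ≤ t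
  truncation : ∀ T N, (T, N) ∈ E → ∃ τ : ℕ → ℝ, τ 0 = t₀ ∧ (∀ j ≤ N, τ j ≤ τ (j + 1)) ∧
    ∀ t j, ((t, j) ∈ E ∧ t ≤ T ∧ j ≤ N) ↔ (j ≤ N ∧ t ∈ Set.Icc (τ j) (τ (j + 1)))

/-- The times at which exactly `j` jumps have occurred. -/
def timeSlice (E : Set (ℝ × ℕ)) (j : ℕ) : Set ℝ := {t | (t, j) ∈ E}

/-- `x`, restricted to `E`, is a solution with initial time `t₀` of the hybrid closed loop: the
disturbance-free rigid body under the hybrid controller. -/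
structure IsSolution (p : Params) (ref : Reference) (t₀ : ℝ) (E : Set (ℝ × ℕ))
    (x : ℝ → ℕ → State) : Prop where
  domain : IsHybridTimeDomain t₀ E
  mem_SO3 : ∀ t j, (t, j) ∈ E → (x t j).R ∈ SO3
  mode_const : ∀ s t j, (s, j) ∈ E → (t, j) ∈ E → (x s j).m = (x t j).m
  mem_flowSet : ∀ t j, t ∈ interior (timeSlice E j) → x t j ∈ flowSet p ref t
  kinematics : ∀ t j, (t, j) ∈ E → ∀ a b,
    HasDerivWithinAt (fun s => (x s j).R a b) (((x t j).R * hat (x t j).Ω) a b)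
      (timeSlice E j) t
  dynamics : ∀ t j, (t, j) ∈ E → ∃ Ω' : Vec3,
    HasDerivWithinAt (fun s => (x s j).Ω) Ω' (timeSlice E j) t ∧
      p.J *ᵥ Ω' + (x t j).Ω ⨯₃ (p.J *ᵥ (x t j).Ω) = control p ref t (x t j)
  jump : ∀ t j, (t, j) ∈ E → (t, j + 1) ∈ E →
    x t j ∈ jumpSet p ref t ∧ (x t (j + 1)).R = (x t j).R ∧ (x t (j + 1)).Ω = (x t j).Ω ∧
      (x t (j + 1)).m ∈ jumpMap p ref t (x t j).R

/-- A solution that has no proper extension. -/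
def IsMaximalSolution (p : Params) (ref : Reference) (t₀ : ℝ) (E : Set (ℝ × ℕ))
    (x : ℝ → ℕ → State) : Prop :=
  IsSolution p ref t₀ E x ∧
    ∀ E' x', IsSolution p ref t₀ E' x' → E ⊆ E' → (∀ t j, (t, j) ∈ E → x' t j = x t j) → E' = E

/-- The domain contains arbitrarily large times. -/
def TimeUnbounded (E : Set (ℝ × ℕ)) : Prop := ∀ T : ℝ, ∃ t j, (t, j) ∈ E ∧ T ≤ t

/-- The tracking error `‖R - Rd‖ + ‖ω - ωd‖`, with `ω = RΩ` the inertial angular velocity. -/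
def trackingError (ref : Reference) (t : ℝ) (x : State) : ℝ :=
  frobNorm (x.R - ref.Rd t) + eucNorm (x.R *ᵥ x.Ω - ref.ωd t)

/-- Global exponential stability of `(R, ω) = (Rd, ωd)` for the time-varying hybrid closed loop:
from every initial time, attitude, angular velocity and mode there is a solution for all future
times; no maximal solution ends in finite time (by escape, by getting stuck, or by accumulating
jumps); and the tracking error decays exponentially along every solution, uniformly in the initial
time and the initial state. -/
def GloballyExponentiallyStable (p : Params) (ref : Reference) : Prop :=
  (∀ t₀, 0 ≤ t₀ → ∀ x₀ : State, x₀.R ∈ SO3 →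
    ∃ E x, IsSolution p ref t₀ E x ∧ x t₀ 0 = x₀ ∧ TimeUnbounded E) ∧
  (∀ t₀, 0 ≤ t₀ → ∀ E x, IsMaximalSolution p ref t₀ E x → TimeUnbounded E) ∧
  ∃ M > 0, ∃ lam > 0, ∀ t₀, 0 ≤ t₀ → ∀ E x, IsSolution p ref t₀ E x → ∀ t j, (t, j) ∈ E →
    trackingError ref t (x t j) ≤
      M * Real.exp (-lam * (t - t₀)) * trackingError ref t₀ (x t₀ 0)

end AttitudeTracking

end

/-!
Expressed in the frame of `b₁`, `b₂`, `b₁ ⨯₃ b₂`, the error dynamics depend on time only through the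
bounded reference angular velocity. The hysteresis keeps the flow set away from every critical point
of the active potential except the desired attitude, so there the potential is bounded by a multiple
of the squared norm of its gradient. Hence the error energy plus a small multiple of a cross term
between the gradient and the velocity error decays exponentially along flows. The cross term is
saturated in the velocity error: it is then bounded, while every jump lowers the energy by at least
`δ`, so the sum does not increase at jumps either. The energy itself never increases, so there are
finitely many jumps, and since the energy bounds the velocity error, solutions exist for all times.
In the flow set the energy is comparable with the square of the tracking error. Only the initial
point of a solution can lie outside the flow set, and then the solution jumps at once.
-/

noncomputable section

namespace AttitudeTracking

/-! ### Special orthogonal matrices -/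

section SpecialOrthogonal

variable {n : Type*} [Fintype n] [DecidableEq n] {P : Matrix n n ℝ}

theorem mem_specialOrthogonalGroup_iff_mul_transpose :
    P ∈ Matrix.specialOrthogonalGroup n ℝ ↔ P * Pᵀ = 1 ∧ P.det = 1 := by
  rw [Matrix.mem_specialOrthogonalGroup_iff, Matrix.mem_orthogonalGroup_iff]

theorem mul_transpose_of_mem (hP : P ∈ Matrix.specialOrthogonalGroup n ℝ) : P * Pᵀ = 1 :=
  (mem_specialOrthogonalGroup_iff_mul_transpose.1 hP).1

theorem transpose_mul_of_mem (hP : P ∈ Matrix.specialOrthogonalGroup n ℝ) : Pᵀ * P = 1 :=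
  mul_eq_one_comm.1 (mul_transpose_of_mem hP)

theorem det_eq_one_of_mem (hP : P ∈ Matrix.specialOrthogonalGroup n ℝ) : P.det = 1 :=
  (mem_specialOrthogonalGroup_iff_mul_transpose.1 hP).2

theorem transpose_mem_specialOrthogonalGroup (hP : P ∈ Matrix.specialOrthogonalGroup n ℝ) :
    Pᵀ ∈ Matrix.specialOrthogonalGroup n ℝ := by
  rw [mem_specialOrthogonalGroup_iff_mul_transpose, Matrix.transpose_transpose,
    Matrix.det_transpose]
  exact ⟨transpose_mul_of_mem hP, det_eq_one_of_mem hP⟩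

theorem abs_apply_le_one_of_mem (hP : P ∈ Matrix.specialOrthogonalGroup n ℝ) (i j : n) :
    |P i j| ≤ 1 :=
  entry_norm_bound_of_unitary (𝕜 := ℝ) hP.1 i j

theorem trace_le_card_of_mem (hP : P ∈ Matrix.specialOrthogonalGroup n ℝ) :
    P.trace ≤ Fintype.card n := by
  simpa [Matrix.trace] using
    Finset.sum_le_card_nsmul Finset.univ _ 1 fun i _ =>
      (le_abs_self _).trans (abs_apply_le_one_of_mem hP i i)

theorem adjugate_eq_transpose_of_mem (hP : P ∈ Matrix.specialOrthogonalGroup n ℝ) :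
    P.adjugate = Pᵀ :=
  calc P.adjugate = Pᵀ * P * P.adjugate := by rw [transpose_mul_of_mem hP, Matrix.one_mul]
    _ = Pᵀ := by rw [Matrix.mul_assoc, Matrix.mul_adjugate, det_eq_one_of_mem hP, one_smul,
      Matrix.mul_one]

theorem mulVec_dotProduct_mulVec_of_mem (hP : P ∈ Matrix.specialOrthogonalGroup n ℝ)
    (x y : n → ℝ) : (P *ᵥ x) ⬝ᵥ (P *ᵥ y) = x ⬝ᵥ y := by
  rw [Matrix.dotProduct_mulVec, ← Matrix.mulVec_transpose, Matrix.mulVec_mulVec,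
    transpose_mul_of_mem hP, Matrix.one_mulVec]

end SpecialOrthogonal

section Rotation

variable {P : Mat3}

theorem row_sq_sum_of_mem (hP : P ∈ SO3) (i : Fin 3) :
    P i 0 ^ 2 + P i 1 ^ 2 + P i 2 ^ 2 = 1 := by
  simpa [Matrix.mul_apply, Fin.sum_univ_three, ← pow_two] using
    congrFun₂ (mul_transpose_of_mem hP) i i

theorem col_sq_sum_of_mem (hP : P ∈ SO3) (j : Fin 3) :
    P 0 j ^ 2 + P 1 j ^ 2 + P 2 j ^ 2 = 1 :=
  row_sq_sum_of_mem (transpose_mem_specialOrthogonalGroup hP) j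

theorem apply_two_two_of_mem (hP : P ∈ SO3) : P 2 2 = P 0 0 * P 1 1 - P 0 1 * P 1 0 := by
  have h := congrFun₂ (adjugate_eq_transpose_of_mem hP) 2 2
  rw [Matrix.transpose_apply, Matrix.adjugate_fin_three] at h
  simpa using h.symm

theorem mulVec_cross_of_mem (hP : P ∈ SO3) (x y : Vec3) :
    P *ᵥ (x ⨯₃ y) = (P *ᵥ x) ⨯₃ (P *ᵥ y) := by
  have hcof : P *ᵥ (x ⨯₃ y) = P.adjugateᵀ *ᵥ (x ⨯₃ y) := by
    rw [adjugate_eq_transpose_of_mem hP, Matrix.transpose_transpose]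
  rw [hcof, Matrix.adjugate_fin_three]
  ext i
  fin_cases i <;> simp [Matrix.mulVec, dotProduct, Fin.sum_univ_three, cross_apply] <;> ring

theorem hat_add (u v : Vec3) : hat (u + v) = hat u + hat v := by
  ext i j
  fin_cases i <;> fin_cases j <;> simp [hat] <;> ring

theorem hat_smul (s : ℝ) (v : Vec3) : hat (s • v) = s • hat v := by
  ext i j
  fin_cases i <;> fin_cases j <;> simp [hat]

theorem hat_transpose (v : Vec3) : (hat v)ᵀ = -hat v := by
  ext i j
  fin_cases i <;> fin_cases j <;> simp [hat]

theorem mul_hat_apply (P : Mat3) (v : Vec3) (i j : Fin 3) :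
    (P * hat v) i j = (Pi.single j 1 ⨯₃ P i) ⬝ᵥ v := by
  fin_cases j <;>
    simp [Matrix.mul_apply, hat, dotProduct, Fin.sum_univ_three, cross_apply] <;> ring

theorem hat_mulVec_mul_of_mem (hP : P ∈ SO3) (v : Vec3) : hat (P *ᵥ v) * P = P * hat v := by
  refine Matrix.ext_of_mulVec_single fun j => ?_
  rw [← Matrix.mulVec_mulVec, ← Matrix.mulVec_mulVec, hat_mulVec, hat_mulVec,
    mulVec_cross_of_mem hP]

end Rotation

/-! ### The Euclidean norm and positive definite matrices -/

section EuclideanNorm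

theorem eucNorm_eq_norm (x : Vec3) : eucNorm x = ‖WithLp.toLp 2 x‖ := by
  rw [eucNorm, EuclideanSpace.norm_eq]
  simp [dotProduct, ← pow_two]

theorem eucNorm_nonneg (x : Vec3) : 0 ≤ eucNorm x := Real.sqrt_nonneg _

theorem eucNorm_sq (x : Vec3) : eucNorm x ^ 2 = x ⬝ᵥ x :=
  Real.sq_sqrt (dotProduct_self_star_nonneg x)

theorem abs_dotProduct_le (x y : Vec3) : |x ⬝ᵥ y| ≤ eucNorm x * eucNorm y := by
  simpa only [eucNorm_eq_norm, EuclideanSpace.inner_toLp_toLp, star_trivial, dotProduct_comm y]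
    using abs_real_inner_le_norm (WithLp.toLp 2 x) (WithLp.toLp 2 y)

theorem eucNorm_add_le (x y : Vec3) : eucNorm (x + y) ≤ eucNorm x + eucNorm y := by
  simpa only [eucNorm_eq_norm, WithLp.toLp_add] using
    norm_add_le (WithLp.toLp 2 x) (WithLp.toLp 2 y)

theorem eucNorm_smul (s : ℝ) (x : Vec3) : eucNorm (s • x) = |s| * eucNorm x := by
  simpa only [eucNorm_eq_norm, WithLp.toLp_smul, Real.norm_eq_abs] using
    norm_smul s (WithLp.toLp 2 x)

theorem eucNorm_cross_le (x y : Vec3) : eucNorm (x ⨯₃ y) ≤ eucNorm x * eucNorm y := by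
  refine le_of_sq_le_sq ?_ (mul_nonneg (eucNorm_nonneg x) (eucNorm_nonneg y))
  rw [mul_pow, eucNorm_sq, eucNorm_sq, eucNorm_sq, cross_dot_cross, dotProduct_comm y x]
  exact sub_le_self _ (mul_self_nonneg _)

theorem abs_apply_le_eucNorm (x : Vec3) (i : Fin 3) : |x i| ≤ eucNorm x := by
  simpa only [eucNorm_eq_norm, Real.norm_eq_abs] using PiLp.norm_apply_le (WithLp.toLp 2 x) i

theorem eucNorm_single (i : Fin 3) : eucNorm (Pi.single i 1) = 1 := by
  simp [eucNorm]

theorem eucNorm_mulVec_of_mem {P : Mat3} (hP : P ∈ SO3) (x : Vec3) :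
    eucNorm (P *ᵥ x) = eucNorm x := by
  rw [eucNorm, mulVec_dotProduct_mulVec_of_mem hP, eucNorm]

theorem exists_eucNorm_mulVec_le (K : Mat3) : ∃ L > 0, ∀ x, eucNorm (K *ᵥ x) ≤ L * eucNorm x := by
  refine ⟨‖Matrix.toEuclideanCLM (n := Fin 3) (𝕜 := ℝ) K‖ + 1, by positivity, fun x => ?_⟩
  simp only [eucNorm_eq_norm, ← Matrix.toEuclideanCLM_toLp]
  refine (ContinuousLinearMap.le_opNorm _ _).trans ?_
  gcongr
  exact le_add_of_nonneg_right zero_le_one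

end EuclideanNorm

section Symmetric

variable {n : Type*} {K : Matrix n n ℝ}

theorem transpose_eq_of_posDef (hK : K.PosDef) : Kᵀ = K :=
  (Matrix.conjTranspose_eq_transpose_of_trivial K).symm.trans hK.isHermitian.eq

variable [Fintype n]

theorem dotProduct_mulVec_comm_of_transpose_eq (hK : Kᵀ = K) (x y : n → ℝ) :
    x ⬝ᵥ (K *ᵥ y) = y ⬝ᵥ (K *ᵥ x) := by
  rw [Matrix.dotProduct_mulVec, ← Matrix.mulVec_transpose, hK, dotProduct_comm]

theorem mulVec_inv_mulVec_of_posDef [DecidableEq n] (hK : K.PosDef) (x : n → ℝ) :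
    K *ᵥ (K⁻¹ *ᵥ x) = x := by
  rw [Matrix.mulVec_mulVec, Matrix.mul_nonsing_inv K hK.det_pos.ne'.isUnit, Matrix.one_mulVec]

theorem eq_inv_mulVec_iff_of_posDef [DecidableEq n] (hK : K.PosDef) {x y : n → ℝ} :
    x = K⁻¹ *ᵥ y ↔ K *ᵥ x = y := by
  refine ⟨fun h => h ▸ mulVec_inv_mulVec_of_posDef hK y, fun h => ?_⟩
  rw [← h, Matrix.mulVec_mulVec, Matrix.nonsing_inv_mul K hK.det_pos.ne'.isUnit, Matrix.one_mulVec]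

end Symmetric

open scoped MatrixOrder in
theorem exists_mul_dotProduct_self_le_of_posDef {K : Mat3} (hK : K.PosDef) :
    ∃ l > 0, ∀ x : Vec3, l * (x ⬝ᵥ x) ≤ x ⬝ᵥ (K *ᵥ x) := by
  obtain ⟨B, hB⟩ := CStarAlgebra.nonneg_iff_eq_star_mul_self.mp hK.posSemidef.nonneg
  replace hB : K = Bᵀ * B := hB
  have hdet : IsUnit B.det := by
    refine isUnit_iff_ne_zero.2 fun h => hK.det_pos.ne' ?_
    rw [hB, Matrix.det_mul, h, mul_zero]
  obtain ⟨L, hL, hBL⟩ := exists_eucNorm_mulVec_le B⁻¹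
  refine ⟨(L ^ 2)⁻¹, by positivity, fun x => ?_⟩
  have hx : x ⬝ᵥ (K *ᵥ x) = eucNorm (B *ᵥ x) ^ 2 := by
    rw [eucNorm_sq, hB, ← Matrix.mulVec_mulVec, Matrix.dotProduct_mulVec, Matrix.vecMul_transpose]
  have hinv : B⁻¹ *ᵥ (B *ᵥ x) = x := by
    rw [Matrix.mulVec_mulVec, Matrix.nonsing_inv_mul B hdet, Matrix.one_mulVec]
  rw [hx, ← eucNorm_sq, inv_mul_le_iff₀ (by positivity), ← mul_pow]
  exact pow_le_pow_left₀ (eucNorm_nonneg x) (by simpa only [hinv] using hBL (B *ᵥ x)) 2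

/-! ### Entrywise differentiation -/

section Calculus

variable {l m n : Type*} {S S' : Set ℝ} {t : ℝ}

/-- Entrywise derivative of a matrix-valued curve within a set; entrywise because `Matrix` carries
no global norm. -/
def MatHasDerivWithinAt (A : ℝ → Matrix m n ℝ) (A' : Matrix m n ℝ) (S : Set ℝ) (t : ℝ) : Prop :=
  ∀ i j, HasDerivWithinAt (fun s => A s i j) (A' i j) S t

namespace MatHasDerivWithinAt

variable {A : ℝ → Matrix m n ℝ} {A' : Matrix m n ℝ}

theorem mono (h : MatHasDerivWithinAt A A' S t) (hS : S' ⊆ S) : MatHasDerivWithinAt A A' S' t :=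
  fun i j => (h i j).mono hS

theorem const (A : Matrix m n ℝ) : MatHasDerivWithinAt (fun _ => A) 0 S t :=
  fun _ _ => hasDerivWithinAt_const _ _ _

theorem transpose (h : MatHasDerivWithinAt A A' S t) :
    MatHasDerivWithinAt (fun s => (A s)ᵀ) A'ᵀ S t :=
  fun i j => h j i

theorem row [Finite n] (h : MatHasDerivWithinAt A A' S t) (i : m) :
    HasDerivWithinAt (fun s => A s i) (A' i) S t :=
  have := Fintype.ofFinite n
  hasDerivWithinAt_pi.2 (h i)

variable [Fintype n]

theorem mul {B : ℝ → Matrix n l ℝ} {B' : Matrix n l ℝ} (hA : MatHasDerivWithinAt A A' S t)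
    (hB : MatHasDerivWithinAt B B' S t) :
    MatHasDerivWithinAt (fun s => A s * B s) (A' * B t + A t * B') S t := by
  intro i j
  simp only [Matrix.mul_apply, Matrix.add_apply, ← Finset.sum_add_distrib]
  exact HasDerivWithinAt.fun_sum fun k _ => (hA i k).fun_mul (hB k j)

theorem mulVec [Finite m] {v : ℝ → n → ℝ} {v' : n → ℝ} (hA : MatHasDerivWithinAt A A' S t)
    (hv : HasDerivWithinAt v v' S t) :
    HasDerivWithinAt (fun s => A s *ᵥ v s) (A' *ᵥ v t + A t *ᵥ v') S t := by
  have := Fintype.ofFinite m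
  rw [hasDerivWithinAt_pi] at hv ⊢
  intro i
  simp only [Matrix.mulVec, dotProduct, Pi.add_apply, ← Finset.sum_add_distrib]
  exact HasDerivWithinAt.fun_sum fun k _ => (hA i k).fun_mul (hv k)

end MatHasDerivWithinAt

variable [Fintype n]

theorem hasDerivWithinAt_const_mulVec [Finite m] (A : Matrix m n ℝ) {v : ℝ → n → ℝ} {v' : n → ℝ}
    (hv : HasDerivWithinAt v v' S t) : HasDerivWithinAt (fun s => A *ᵥ v s) (A *ᵥ v') S t := by
  simpa using (MatHasDerivWithinAt.const A).mulVec hv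

theorem hasDerivWithinAt_dotProduct {u v : ℝ → n → ℝ} {u' v' : n → ℝ}
    (hu : HasDerivWithinAt u u' S t) (hv : HasDerivWithinAt v v' S t) :
    HasDerivWithinAt (fun s => u s ⬝ᵥ v s) (u' ⬝ᵥ v t + u t ⬝ᵥ v') S t := by
  rw [hasDerivWithinAt_pi] at hu hv
  simp only [dotProduct, ← Finset.sum_add_distrib]
  exact HasDerivWithinAt.fun_sum fun k _ => (hu k).fun_mul (hv k)

end Calculus

/-! ### Configuration errors as functions of the attitude error -/

/-- The hypotheses on the gains and on the switching parameters. -/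
structure Params.Tuned (p : Params) : Prop where
  k₁_pos : 0 < p.k₁
  k₂_pos : 0 < p.k₂
  k_ne : p.k₁ ≠ p.k₂
  kΩ_pos : 0 < p.kΩ
  α_lt_two : p.α < 2
  β_ne_zero : p.β ≠ 0
  abs_β_lt : |p.β| < p.α - 1
  δ_pos : 0 < p.δ
  δ_lt : p.δ < min p.k₁ p.k₂ * min (2 - p.α) (p.α - |p.β| - 1)

/-- The gradient of the entry `P i j` for the left trivialization: `P i j` has derivative
`entryGradient P i j ⬝ᵥ v` along a curve with `Ṗ = P * hat v`. -/
def entryGradient (P : Mat3) (i j : Fin 3) : Vec3 := Pi.single j 1 ⨯₃ P i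

/-- The configuration error function of a mode in terms of the attitude error matrix `P`, whose
entry `P i j` is `Rd fᵢ ⬝ᵥ R fⱼ` for the orthonormal frame `f = (b₁, b₂, b₁ ⨯₃ b₂)`. -/
def modePotential (p : Params) (m : Mode) (P : Mat3) : ℝ :=
  match m with
  | .I => p.k₁ * (1 - P 0 0) + p.k₂ * (1 - P 1 1)
  | .II => p.k₁ * (1 - P 0 0) + p.k₂ * (p.α + p.β * P 2 1)
  | .III => p.k₁ * (p.α + p.β * P 2 0) + p.k₂ * (1 - P 1 1)

/-- The left-trivialized gradient of `modePotential`. -/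
def modeGradient (p : Params) (m : Mode) (P : Mat3) : Vec3 :=
  match m with
  | .I => (-p.k₁) • entryGradient P 0 0 + (-p.k₂) • entryGradient P 1 1
  | .II => (-p.k₁) • entryGradient P 0 0 + (p.k₂ * p.β) • entryGradient P 2 1
  | .III => (p.k₁ * p.β) • entryGradient P 2 0 + (-p.k₂) • entryGradient P 1 1

/-- The minimum of `modePotential` over the modes. -/
def minPotential (p : Params) (P : Mat3) : ℝ :=
  min (modePotential p .I P) (min (modePotential p .II P) (modePotential p .III P))

theorem minPotential_le (p : Params) (P : Mat3) (m : Mode) :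
    minPotential p P ≤ modePotential p m P := by
  unfold minPotential
  cases m
  · exact min_le_left _ _
  · exact (min_le_right _ _).trans (min_le_left _ _)
  · exact (min_le_right _ _).trans (min_le_right _ _)

theorem exists_modePotential_eq_minPotential (p : Params) (P : Mat3) :
    ∃ m, modePotential p m P = minPotential p P := by
  unfold minPotential
  rcases min_choice (modePotential p .I P)
    (min (modePotential p .II P) (modePotential p .III P)) with h | h
  · exact ⟨.I, h.symm⟩
  · rw [h]
    rcases min_choice (modePotential p .II P) (modePotential p .III P) with h | h
    · exact ⟨.II, h.symm⟩
    · exact ⟨.III, h.symm⟩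

theorem modePotential_sub_le {p : Params} {m : Mode} {P : Mat3}
    (h : modePotential p m P - minPotential p P ≤ p.δ) (m' : Mode) :
    modePotential p m P - modePotential p m' P ≤ p.δ :=
  (sub_le_sub_left (minPotential_le p P m') _).trans h

section Gradient

theorem hasDerivWithinAt_apply_of_mul_hat {P : ℝ → Mat3} {v : Vec3} {S : Set ℝ} {t : ℝ}
    (hP : MatHasDerivWithinAt P (P t * hat v) S t) (i j : Fin 3) :
    HasDerivWithinAt (fun s => P s i j) (entryGradient (P t) i j ⬝ᵥ v) S t :=
  (hP i j).congr_deriv (mul_hat_apply (P t) v i j)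

theorem hasDerivWithinAt_modePotential (p : Params) (m : Mode) {P : ℝ → Mat3} {v : Vec3}
    {S : Set ℝ} {t : ℝ} (hP : MatHasDerivWithinAt P (P t * hat v) S t) :
    HasDerivWithinAt (fun s => modePotential p m (P s)) (modeGradient p m (P t) ⬝ᵥ v) S t := by
  have hentry := hasDerivWithinAt_apply_of_mul_hat hP
  cases m <;> simp only [modePotential, modeGradient, add_dotProduct, smul_dotProduct, smul_eq_mul]
  · exact ((((hentry 0 0).const_sub 1).const_mul p.k₁).add
      (((hentry 1 1).const_sub 1).const_mul p.k₂)).congr_deriv (by ring)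
  · exact ((((hentry 0 0).const_sub 1).const_mul p.k₁).add
      ((((hentry 2 1).const_mul p.β).const_add p.α).const_mul p.k₂)).congr_deriv (by ring)
  · exact (((((hentry 2 0).const_mul p.β).const_add p.α).const_mul p.k₁).add
      (((hentry 1 1).const_sub 1).const_mul p.k₂)).congr_deriv (by ring)

theorem hasDerivWithinAt_entryGradient {P : ℝ → Mat3} {A : Mat3} {S : Set ℝ} {t : ℝ}
    (hP : MatHasDerivWithinAt P A S t) (i j : Fin 3) :
    HasDerivWithinAt (fun s => entryGradient (P s) i j) (entryGradient A i j) S t := by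
  simp only [entryGradient, ← hat_mulVec]
  exact hasDerivWithinAt_const_mulVec _ (hP.row i)

theorem hasDerivWithinAt_modeGradient (p : Params) (m : Mode) {P : ℝ → Mat3} {A : Mat3}
    {S : Set ℝ} {t : ℝ} (hP : MatHasDerivWithinAt P A S t) :
    HasDerivWithinAt (fun s => modeGradient p m (P s)) (modeGradient p m A) S t := by
  have hentry := hasDerivWithinAt_entryGradient hP
  cases m
  · exact ((hentry 0 0).fun_const_smul (-p.k₁)).fun_add ((hentry 1 1).fun_const_smul (-p.k₂))
  · exact ((hentry 0 0).fun_const_smul (-p.k₁)).fun_add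
      ((hentry 2 1).fun_const_smul (p.k₂ * p.β))
  · exact ((hentry 2 0).fun_const_smul (p.k₁ * p.β)).fun_add
      ((hentry 1 1).fun_const_smul (-p.k₂))

theorem entryGradient_dotProduct_self {P : Mat3} (hP : P ∈ SO3) (i j : Fin 3) :
    entryGradient P i j ⬝ᵥ entryGradient P i j = 1 - P i j ^ 2 := by
  have hrow : P i ⬝ᵥ P i = 1 := by
    simpa only [dotProduct, Fin.sum_univ_three, ← pow_two] using row_sq_sum_of_mem hP i
  rw [entryGradient, cross_dot_cross, hrow, single_one_dotProduct, dotProduct_single_one,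
    single_one_dotProduct, Pi.single_eq_same, mul_one, pow_two]

theorem eucNorm_entryGradient_le (P : Mat3) (i j : Fin 3) :
    eucNorm (entryGradient P i j) ≤ eucNorm (P i) := by
  simpa only [entryGradient, eucNorm_single, one_mul] using
    eucNorm_cross_le (Pi.single j 1) (P i)

end Gradient

/-! ### Static estimates on the configuration errors -/

theorem neg_abs_le_mul_apply {P : Mat3} (hP : P ∈ SO3) (x : ℝ) (i j : Fin 3) :
    -|x| ≤ x * P i j := by
  refine (neg_le_neg ?_).trans (neg_abs_le _)
  rw [abs_mul]
  exact mul_le_of_le_one_right (abs_nonneg x) (abs_apply_le_one_of_mem hP i j)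

theorem apply_le_one {P : Mat3} (hP : P ∈ SO3) (i j : Fin 3) : P i j ≤ 1 :=
  (abs_le.1 (abs_apply_le_one_of_mem hP i j)).2

theorem neg_one_le_apply {P : Mat3} (hP : P ∈ SO3) (i j : Fin 3) : -1 ≤ P i j :=
  (abs_le.1 (abs_apply_le_one_of_mem hP i j)).1

namespace Params.Tuned

variable {p : Params} (hp : p.Tuned)
include hp

theorem abs_β_lt_one : |p.β| < 1 := by
  linarith [hp.abs_β_lt, hp.α_lt_two]

theorem k₁_add_k₂_pos : 0 < p.k₁ + p.k₂ := add_pos hp.k₁_pos hp.k₂_pos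

theorem exists_margin : ∃ g > 0, ∀ k, min p.k₁ p.k₂ ≤ k →
    p.δ ≤ k * (2 - p.α - g) ∧ p.δ ≤ k * (p.α - |p.β| - 1 - g) := by
  have hmin : 0 < min p.k₁ p.k₂ := lt_min hp.k₁_pos hp.k₂_pos
  have hδ : p.δ / min p.k₁ p.k₂ < min (2 - p.α) (p.α - |p.β| - 1) :=
    (div_lt_iff₀' hmin).2 hp.δ_lt
  refine ⟨min (2 - p.α) (p.α - |p.β| - 1) - p.δ / min p.k₁ p.k₂, sub_pos.2 hδ, fun k hk => ?_⟩
  have hmargin : ∀ x, p.δ / min p.k₁ p.k₂ ≤ x → p.δ ≤ k * x := fun x hx =>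
    ((div_le_iff₀' hmin).1 hx).trans
      (mul_le_mul_of_nonneg_right hk ((div_pos hp.δ_pos hmin).le.trans hx))
  exact ⟨hmargin _ (by linarith [min_le_left (2 - p.α) (p.α - |p.β| - 1)]),
    hmargin _ (by linarith [min_le_right (2 - p.α) (p.α - |p.β| - 1)])⟩

end Params.Tuned

section Bounds

variable {p : Params} (hp : p.Tuned) {P : Mat3} (hP : P ∈ SO3)
include hp hP

theorem one_le_expelling (i j : Fin 3) : 1 ≤ p.α + p.β * P i j := by
  linarith [neg_abs_le_mul_apply hP p.β i j, hp.abs_β_lt]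

theorem expelling_le_three (i j : Fin 3) : p.α + p.β * P i j ≤ 3 := by
  linarith [neg_abs_le_mul_apply hP (-p.β) i j, abs_neg p.β, hp.abs_β_lt_one, hp.α_lt_two]

theorem modePotential_le (m : Mode) : modePotential p m P ≤ 3 * (p.k₁ + p.k₂) := by
  have hk₁ := hp.k₁_pos
  have hk₂ := hp.k₂_pos
  have hnominal : ∀ i, 1 - P i i ≤ 3 := fun i => by linarith [neg_one_le_apply hP i i]
  rw [mul_add, mul_comm 3, mul_comm 3]
  have h₂₀ := expelling_le_three hp hP 2 0
  have h₂₁ := expelling_le_three hp hP 2 1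
  cases m <;> simp only [modePotential] <;> gcongr <;> exact hnominal _

theorem le_modePotential_II : p.k₁ * (1 - P 0 0) + p.k₂ ≤ modePotential p .II P :=
  add_le_add_right (le_mul_of_one_le_right hp.k₂_pos.le (one_le_expelling hp hP 2 1)) _

theorem le_modePotential_III : p.k₁ + p.k₂ * (1 - P 1 1) ≤ modePotential p .III P :=
  add_le_add_left (le_mul_of_one_le_right hp.k₁_pos.le (one_le_expelling hp hP 2 0)) _

end Bounds

theorem one_sub_apply_two_two_le {P : Mat3} (hP : P ∈ SO3) :
    1 - P 2 2 ≤ 2 * (1 - P 0 0) + 2 * (1 - P 1 1) := by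
  have hdet := apply_two_two_of_mem hP
  have h₀ := row_sq_sum_of_mem hP 0
  have h₁ := row_sq_sum_of_mem hP 1
  nlinarith [sq_nonneg (P 0 1 - P 1 0), sq_nonneg (P 0 0 + P 1 1 - 2), sq_nonneg (P 0 2),
    sq_nonneg (P 1 2)]

theorem min_mul_le_modePotential {p : Params} (hp : p.Tuned) {P : Mat3} (hP : P ∈ SO3)
    (m : Mode) : min p.k₁ p.k₂ * (3 - P.trace) ≤ 6 * modePotential p m P := by
  have hk₁ := hp.k₁_pos
  have hk₂ := hp.k₂_pos
  have hmin : 0 < min p.k₁ p.k₂ := lt_min hk₁ hk₂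
  have hle₁ : min p.k₁ p.k₂ ≤ p.k₁ := min_le_left _ _
  have hle₂ : min p.k₁ p.k₂ ≤ p.k₂ := min_le_right _ _
  have h₀ := sub_nonneg.2 (apply_le_one hP 0 0)
  have h₁ := sub_nonneg.2 (apply_le_one hP 1 1)
  rw [Matrix.trace_fin_three]
  have hsix : 3 - (P 0 0 + P 1 1 + P 2 2) ≤ 6 := by
    linarith [neg_one_le_apply hP 0 0, neg_one_le_apply hP 1 1, neg_one_le_apply hP 2 2]
  cases m
  · calc min p.k₁ p.k₂ * (3 - (P 0 0 + P 1 1 + P 2 2))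
        ≤ min p.k₁ p.k₂ * (3 * (1 - P 0 0) + 3 * (1 - P 1 1)) := by
          gcongr
          linarith [one_sub_apply_two_two_le hP]
      _ ≤ 6 * (min p.k₁ p.k₂ * (1 - P 0 0) + min p.k₁ p.k₂ * (1 - P 1 1)) := by
          nlinarith [mul_nonneg hmin.le h₀, mul_nonneg hmin.le h₁]
      _ ≤ 6 * modePotential p .I P := by
          simp only [modePotential]
          gcongr
  · nlinarith [le_modePotential_II hp hP, mul_nonneg hk₁.le h₀]
  · nlinarith [le_modePotential_III hp hP, mul_nonneg hk₂.le h₁]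

theorem modePotential_nonneg {p : Params} (hp : p.Tuned) {P : Mat3} (hP : P ∈ SO3) (m : Mode) :
    0 ≤ modePotential p m P := by
  have htrace : 0 ≤ 3 - P.trace := sub_nonneg.2 (by simpa using trace_le_card_of_mem hP)
  have hmin : 0 < min p.k₁ p.k₂ := lt_min hp.k₁_pos hp.k₂_pos
  linarith [min_mul_le_modePotential hp hP m, mul_nonneg hmin.le htrace]

theorem dotProduct_self_add_smul_le (a b : ℝ) (u v : Vec3) :
    (a • u + b • v) ⬝ᵥ (a • u + b • v) ≤ 2 * (a ^ 2 * (u ⬝ᵥ u)) + 2 * (b ^ 2 * (v ⬝ᵥ v)) := by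
  have h : 0 ≤ (a • u - b • v) ⬝ᵥ (a • u - b • v) := dotProduct_self_star_nonneg _
  simp only [sub_dotProduct, dotProduct_sub, add_dotProduct, dotProduct_add, smul_dotProduct,
    dotProduct_smul, smul_eq_mul, dotProduct_comm v u] at h ⊢
  linarith

theorem modeGradient_dotProduct_self_le {p : Params} (hp : p.Tuned) {P : Mat3} (hP : P ∈ SO3)
    (m : Mode) :
    modeGradient p m P ⬝ᵥ modeGradient p m P ≤ 4 * (p.k₁ + p.k₂) * modePotential p m P := by
  have hk₁ := hp.k₁_pos
  have hk₂ := hp.k₂_pos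
  have hβ : p.β ^ 2 ≤ 1 := (sq_le_one_iff_abs_le_one _).2 hp.abs_β_lt_one.le
  have hdiag : ∀ i, 1 - P i i ^ 2 ≤ 2 * (1 - P i i) := fun i => by
    linarith [sq_nonneg (1 - P i i)]
  have hone : ∀ i j, 1 - P i j ^ 2 ≤ 1 := fun i j => by linarith [sq_nonneg (P i j)]
  have hexp : ∀ k i j, (k * p.β) ^ 2 * (1 - P i j ^ 2) ≤ k ^ 2 := fun k i j => by
    rw [mul_pow, mul_assoc]
    refine mul_le_of_le_one_right (sq_nonneg k) (mul_le_one₀ hβ ?_ (hone i j))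
    exact sub_nonneg.2 ((sq_le_one_iff_abs_le_one _).2 (abs_apply_le_one_of_mem hP i j))
  have h₀ := sub_nonneg.2 (apply_le_one hP 0 0)
  have h₁ := sub_nonneg.2 (apply_le_one hP 1 1)
  have hk₁h₀ := mul_nonneg hk₁.le h₀
  have hk₂h₁ := mul_nonneg hk₂.le h₁
  cases m <;> refine (dotProduct_self_add_smul_le _ _ _ _).trans ?_ <;>
    simp only [entryGradient_dotProduct_self hP, neg_sq]
  · have hΨ : modePotential p .I P = p.k₁ * (1 - P 0 0) + p.k₂ * (1 - P 1 1) := rfl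
    nlinarith [mul_le_mul_of_nonneg_left (hdiag 0) (sq_nonneg p.k₁),
      mul_le_mul_of_nonneg_left (hdiag 1) (sq_nonneg p.k₂)]
  · have hΨ := mul_le_mul_of_nonneg_left (le_modePotential_II hp hP) hp.k₁_add_k₂_pos.le
    nlinarith [mul_le_mul_of_nonneg_left (hdiag 0) (sq_nonneg p.k₁), hexp p.k₂ 2 1]
  · have hΨ := mul_le_mul_of_nonneg_left (le_modePotential_III hp hP) hp.k₁_add_k₂_pos.le
    nlinarith [mul_le_mul_of_nonneg_left (hdiag 1) (sq_nonneg p.k₂), hexp p.k₁ 2 0]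

theorem eucNorm_modeGradient_le {p : Params} (hp : p.Tuned) (m : Mode) {A : Mat3} {s : ℝ}
    (hA : ∀ i, eucNorm (A i) ≤ s) : eucNorm (modeGradient p m A) ≤ (p.k₁ + p.k₂) * s := by
  have hentry : ∀ k, 0 < k → ∀ x, |x| ≤ k → ∀ i j, eucNorm (x • entryGradient A i j) ≤ k * s :=
    fun k hk x hx i j => by
      rw [eucNorm_smul]
      exact mul_le_mul hx ((eucNorm_entryGradient_le A i j).trans (hA i)) (eucNorm_nonneg _) hk.le
  have hneg : ∀ k : ℝ, 0 < k → |-k| ≤ k := fun k hk => by rw [abs_neg, abs_of_pos hk]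
  have hmul : ∀ k, 0 < k → |k * p.β| ≤ k := fun k hk => by
    rw [abs_mul, abs_of_pos hk]
    exact mul_le_of_le_one_right hk.le hp.abs_β_lt_one.le
  have hk₁ := hentry p.k₁ hp.k₁_pos
  have hk₂ := hentry p.k₂ hp.k₂_pos
  rw [add_mul]
  cases m <;> refine (eucNorm_add_le _ _).trans (add_le_add (hk₁ _ ?_ _ _) (hk₂ _ ?_ _ _))
  exacts [hneg _ hp.k₁_pos, hneg _ hp.k₂_pos, hneg _ hp.k₁_pos, hmul _ hp.k₂_pos,
    hmul _ hp.k₁_pos, hneg _ hp.k₂_pos]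

theorem apply_le_of_expelling_flow {p : Params} {P : Mat3} (hP : P ∈ SO3) {k g : ℝ} (hk : 0 < k)
    (hδ : p.δ ≤ k * (p.α - |p.β| - 1 - g)) {i j : Fin 3}
    (h : k * (p.α + p.β * P i j) - k * (1 - P j j) ≤ p.δ) : P j j ≤ -g := by
  have hle := le_of_mul_le_mul_left ((mul_sub k _ _).trans_le (h.trans hδ)) hk
  linarith [neg_abs_le_mul_apply hP p.β i j]

theorem modePotential_le_trace {p : Params} (hp : p.Tuned) {P : Mat3} (hP : P ∈ SO3) {m : Mode}
    (hflow : modePotential p m P - minPotential p P ≤ p.δ) :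
    modePotential p m P ≤ 3 * (p.k₁ + p.k₂) * (3 - P.trace) := by
  obtain ⟨g, hg, hmargin⟩ := hp.exists_margin
  have hk₁ := hp.k₁_pos
  have hk₂ := hp.k₂_pos
  have hdiag := fun i => sub_nonneg.2 (apply_le_one hP i i)
  have hΨI := modePotential_sub_le hflow .I
  have hfar : 1 ≤ 3 - P.trace → modePotential p m P ≤ 3 * (p.k₁ + p.k₂) * (3 - P.trace) :=
    fun h => (modePotential_le hp hP m).trans (le_mul_of_one_le_right (by positivity) h)
  rw [Matrix.trace_fin_three] at hfar ⊢
  cases m with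
  | I =>
    have htrace : ∀ i, 1 - P i i ≤ 3 - (P 0 0 + P 1 1 + P 2 2) := fun i => by
      fin_cases i <;> simp only [Fin.zero_eta, Fin.mk_one, Fin.reduceFinMk] <;>
        linarith [hdiag 0, hdiag 1, hdiag 2]
    unfold modePotential
    nlinarith [mul_le_mul_of_nonneg_left (htrace 0) hk₁.le,
      mul_le_mul_of_nonneg_left (htrace 1) hk₂.le,
      mul_nonneg hp.k₁_add_k₂_pos.le ((hdiag 0).trans (htrace 0))]
  | II =>
    have h := apply_le_of_expelling_flow hP hk₂ (hmargin _ (min_le_right _ _)).2 (i := 2) (j := 1)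
      (by simp only [modePotential] at hΨI; linarith)
    exact hfar (by linarith [hdiag 0, hdiag 2])
  | III =>
    have h := apply_le_of_expelling_flow hP hk₁ (hmargin _ (min_le_left _ _)).2 (i := 2) (j := 0)
      (by simp only [modePotential] at hΨI; linarith)
    exact hfar (by linarith [hdiag 1, hdiag 2])

/-! ### Coercivity of the gradient in the flow set -/

theorem exists_sq_le_mul_of_sq_ne {k l : ℝ} (hkl : k ^ 2 ≠ l ^ 2) :
    ∃ C > 0, ∀ u v : ℝ, u ^ 2 ≤ C * (|u ^ 2 - v ^ 2| + (l * v - k * u) ^ 2) := by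
  obtain ⟨D, hD⟩ : ∃ D, D = |k ^ 2 - l ^ 2| := ⟨_, rfl⟩
  have hD0 : 0 < D := hD ▸ abs_pos.2 (sub_ne_zero.2 hkl)
  refine ⟨2 / D * (l ^ 2 + 1 + 2 * k ^ 2 / D), by positivity, fun u v => ?_⟩
  obtain ⟨w, hw⟩ : ∃ w, w = |u ^ 2 - v ^ 2| := ⟨_, rfl⟩
  obtain ⟨z, hz⟩ : ∃ z, z = l * v - k * u := ⟨_, rfl⟩
  rw [← hw, ← hz]
  have hw0 : 0 ≤ w := hw ▸ abs_nonneg _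
  have hid : (k ^ 2 - l ^ 2) * u ^ 2 = l ^ 2 * (v ^ 2 - u ^ 2) + (-(2 * k * u * z) - z ^ 2) := by
    rw [hz]; ring
  have hsum : D * u ^ 2 ≤ l ^ 2 * w + |2 * k * u * z| + z ^ 2 :=
    calc D * u ^ 2 = |l ^ 2 * (v ^ 2 - u ^ 2) + (-(2 * k * u * z) - z ^ 2)| := by
          rw [hD, ← hid, abs_mul, abs_sq]
      _ ≤ |l ^ 2 * (v ^ 2 - u ^ 2)| + |(-(2 * k * u * z) - z ^ 2)| := abs_add_le _ _
      _ ≤ l ^ 2 * w + (|2 * k * u * z| + z ^ 2) := by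
          rw [abs_mul, abs_sq, abs_sub_comm, ← hw]
          gcongr
          exact (abs_sub _ _).trans_eq (by rw [abs_neg, abs_sq z])
      _ = _ := by ring
  have hyoung : |2 * k * u * z| ≤ D / 2 * u ^ 2 + 2 * k ^ 2 / D * z ^ 2 := by
    have hsq : D / 2 * u ^ 2 + 2 * k ^ 2 / D * z ^ 2 - 2 * (k * u * z) =
        (D * u - 2 * k * z) ^ 2 / (2 * D) := by field_simp; ring
    have hsq' : D / 2 * u ^ 2 + 2 * k ^ 2 / D * z ^ 2 + 2 * (k * u * z) =
        (D * u + 2 * k * z) ^ 2 / (2 * D) := by field_simp; ring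
    have hpos : 0 ≤ (D * u - 2 * k * z) ^ 2 / (2 * D) := by positivity
    have hpos' : 0 ≤ (D * u + 2 * k * z) ^ 2 / (2 * D) := by positivity
    exact abs_le.2 ⟨by linarith, by linarith⟩
  have hkD : 0 ≤ 2 * k ^ 2 / D := by positivity
  calc u ^ 2 = 2 / D * (D / 2 * u ^ 2) := by field_simp
    _ ≤ 2 / D * (l ^ 2 * w + (1 + 2 * k ^ 2 / D) * z ^ 2) := by gcongr; linarith
    _ ≤ 2 / D * ((l ^ 2 + 1 + 2 * k ^ 2 / D) * (w + z ^ 2)) := by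
        gcongr
        nlinarith [mul_nonneg hkD hw0, mul_nonneg (sq_nonneg l) (sq_nonneg z)]
    _ = _ := by ring

theorem one_sub_le_of_sq_le {a r g X : ℝ} (hg : 0 < g) (ha : |a| ≤ 1) (haX : 1 - a ^ 2 ≤ X)
    (hrX : r ^ 2 ≤ X) (hgr : g - |r| ≤ 1 + a) : 1 - a ≤ (2 / g + 8 / g ^ 2) * X := by
  obtain ⟨ha₁, ha₂⟩ := abs_le.1 ha
  have hX : 0 ≤ X := (sq_nonneg r).trans hrX
  rw [add_mul]
  rcases le_total |r| (g / 2) with hr | hr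
  · refine le_add_of_le_of_nonneg ?_ (by positivity)
    rw [div_mul_eq_mul_div, le_div_iff₀ hg]
    nlinarith
  · refine le_add_of_nonneg_of_le (by positivity) ?_
    rw [div_mul_eq_mul_div, le_div_iff₀ (by positivity)]
    have hrg : (g / 2) ^ 2 ≤ r ^ 2 := by
      rw [← sq_abs r]
      exact pow_le_pow_left₀ (by positivity) hr 2
    nlinarith [sq_nonneg g]

section ModeGradient

variable (p : Params) (P : Mat3)

theorem modeGradient_I_dotProduct_self :
    modeGradient p .I P ⬝ᵥ modeGradient p .I P =
      p.k₁ ^ 2 * P 0 2 ^ 2 + p.k₂ ^ 2 * P 1 2 ^ 2 + (p.k₂ * P 1 0 - p.k₁ * P 0 1) ^ 2 := by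
  simp [modeGradient, entryGradient, cross_apply, dotProduct, Fin.sum_univ_three]
  ring

theorem modeGradient_II_dotProduct_self :
    modeGradient p .II P ⬝ᵥ modeGradient p .II P =
      p.k₁ ^ 2 * P 0 2 ^ 2 + p.k₂ ^ 2 * p.β ^ 2 * P 2 2 ^ 2 +
        (p.k₁ * P 0 1 + p.k₂ * p.β * P 2 0) ^ 2 := by
  simp [modeGradient, entryGradient, cross_apply, dotProduct, Fin.sum_univ_three]
  ring

theorem modeGradient_III_dotProduct_self :
    modeGradient p .III P ⬝ᵥ modeGradient p .III P =
      p.k₂ ^ 2 * P 1 2 ^ 2 + p.k₁ ^ 2 * p.β ^ 2 * P 2 2 ^ 2 +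
        (p.k₁ * p.β * P 2 1 + p.k₂ * P 1 0) ^ 2 := by
  simp [modeGradient, entryGradient, cross_apply, dotProduct, Fin.sum_univ_three]
  ring

end ModeGradient

theorem add_le_mul_of_mul_le {a b x y h : ℝ} (ha : 0 < a) (hb : 0 < b) (hx : a * x ≤ h)
    (hy : b * y ≤ h) : x + y ≤ (1 / a + 1 / b) * h := by
  rw [add_mul, one_div_mul_eq_div, one_div_mul_eq_div]
  exact add_le_add ((le_div_iff₀' ha).2 hx) ((le_div_iff₀' hb).2 hy)

section Coercivity

variable {p : Params} (hp : p.Tuned)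
include hp

/- The rows and columns of a rotation have unit length, so the third row and column dominate the
difference `P₀₁² - P₁₀²`, while the gradient also controls `k₂ P₁₀ - k₁ P₀₁`; for `k₁ ≠ k₂` these
two quantities determine `P₀₁` and `P₁₀`. -/
theorem exists_offDiag_sq_le_modeGradient_I :
    ∃ C > 0, ∀ P ∈ SO3,
      1 - P 0 0 ^ 2 ≤ C * (modeGradient p .I P ⬝ᵥ modeGradient p .I P) ∧
      1 - P 1 1 ^ 2 ≤ C * (modeGradient p .I P ⬝ᵥ modeGradient p .I P) ∧
      P 2 0 ^ 2 ≤ C * (modeGradient p .I P ⬝ᵥ modeGradient p .I P) ∧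
      P 2 1 ^ 2 ≤ C * (modeGradient p .I P ⬝ᵥ modeGradient p .I P) := by
  have hk₁ := hp.k₁_pos
  have hk₂ := hp.k₂_pos
  obtain ⟨c, hc, hcle⟩ := exists_sq_le_mul_of_sq_ne
    (fun h => hp.k_ne ((sq_eq_sq₀ hk₁.le hk₂.le).1 h) : p.k₁ ^ 2 ≠ p.k₂ ^ 2)
  set N := 1 / p.k₁ ^ 2 + 1 / p.k₂ ^ 2
  have hN : 0 < N := by positivity
  refine ⟨c * (N + 1) + 2 * N, by linarith [mul_pos hc (add_pos hN one_pos)], fun P hP => ?_⟩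
  have hgrad := modeGradient_I_dotProduct_self p P
  set H := modeGradient p .I P ⬝ᵥ modeGradient p .I P
  have hthird : P 0 2 ^ 2 + P 1 2 ^ 2 ≤ N * H :=
    add_le_mul_of_mul_le (by positivity) (by positivity)
      (by rw [hgrad]; linarith [mul_nonneg (sq_nonneg p.k₂) (sq_nonneg (P 1 2)),
        sq_nonneg (p.k₂ * P 1 0 - p.k₁ * P 0 1)])
      (by rw [hgrad]; linarith [mul_nonneg (sq_nonneg p.k₁) (sq_nonneg (P 0 2)),
        sq_nonneg (p.k₂ * P 1 0 - p.k₁ * P 0 1)])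
  have hskew : (p.k₂ * P 1 0 - p.k₁ * P 0 1) ^ 2 ≤ H := by
    rw [hgrad]
    exact le_add_of_nonneg_left (by positivity)
  have hrow := row_sq_sum_of_mem hP
  have hcol := col_sq_sum_of_mem hP
  have hsq : ∀ i j, 0 ≤ P i j ^ 2 := fun i j => sq_nonneg _
  have hdiff : |P 0 1 ^ 2 - P 1 0 ^ 2| ≤ N * H := by
    refine abs_le.2 ⟨?_, ?_⟩ <;>
      linarith [hrow 0, hcol 0, hrow 2, hcol 2, hsq 0 2, hsq 1 2, hsq 2 0, hsq 2 1]
  have h₀₁ : P 0 1 ^ 2 ≤ c * (N + 1) * H :=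
    calc P 0 1 ^ 2 ≤ c * (|P 0 1 ^ 2 - P 1 0 ^ 2| + (p.k₂ * P 1 0 - p.k₁ * P 0 1) ^ 2) := hcle _ _
      _ ≤ c * (N * H + H) := by gcongr
      _ = c * (N + 1) * H := by ring
  have hfirst : 0 ≤ c * (N + 1) * H := (hsq 0 1).trans h₀₁
  rw [add_mul, mul_assoc 2]
  refine ⟨?_, ?_, ?_, ?_⟩ <;>
    linarith [hrow 0, hrow 1, hrow 2, hcol 0, hcol 2, hsq 0 2, hsq 1 2, hsq 2 0, hsq 2 1]

theorem exists_modePotential_I_le_gradient_sq :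
    ∃ C > 0, ∀ P ∈ SO3, modePotential p .I P - minPotential p P ≤ p.δ →
      modePotential p .I P ≤ C * (modeGradient p .I P ⬝ᵥ modeGradient p .I P) := by
  have hk₁ := hp.k₁_pos
  have hk₂ := hp.k₂_pos
  obtain ⟨g, hg, hmargin⟩ := hp.exists_margin
  obtain ⟨c, hc, hoff⟩ := exists_offDiag_sq_le_modeGradient_I hp
  refine ⟨(p.k₁ + p.k₂) * ((2 / g + 8 / g ^ 2) * c), by positivity, fun P hP hflow => ?_⟩
  obtain ⟨h₀₀, h₁₁, h₂₀, h₂₁⟩ := hoff P hP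
  have hII := modePotential_sub_le hflow .II
  have hIII := modePotential_sub_le hflow .III
  simp only [modePotential] at hII hIII
  have hclose : ∀ k i j, min p.k₁ p.k₂ ≤ k →
      k * (1 - P j j) - k * (p.α + p.β * P i j) ≤ p.δ → g - |P i j| ≤ 1 + P j j := by
    intro k i j hk h
    rw [← mul_sub] at h
    have hle := le_of_mul_le_mul_left (h.trans (hmargin k hk).1)
      ((lt_min hk₁ hk₂).trans_le hk)
    have hβ : p.β * P i j ≤ |P i j| := (le_abs_self _).trans <| by
      rw [abs_mul]
      exact mul_le_of_le_one_left (abs_nonneg _) hp.abs_β_lt_one.le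
    linarith
  have h₀ := one_sub_le_of_sq_le hg (abs_apply_le_one_of_mem hP 0 0) h₀₀ h₂₀
    (hclose p.k₁ 2 0 (min_le_left _ _) (by linarith))
  have h₁ := one_sub_le_of_sq_le hg (abs_apply_le_one_of_mem hP 1 1) h₁₁ h₂₁
    (hclose p.k₂ 2 1 (min_le_right _ _) (by linarith))
  rw [← mul_assoc] at h₀ h₁
  rw [mul_assoc, add_mul]
  exact add_le_add (mul_le_mul_of_nonneg_left h₀ hk₁.le) (mul_le_mul_of_nonneg_left h₁ hk₂.le)

theorem modePotential_le_of_apply_le {P : Mat3} (hP : P ∈ SO3) {m : Mode} {g d X : ℝ}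
    (hg : 0 < g) (hd : d ≤ -g) (hX : d ^ 2 ≤ X) :
    modePotential p m P ≤ 3 * (p.k₁ + p.k₂) / g ^ 2 * X := by
  have hk := hp.k₁_add_k₂_pos
  calc modePotential p m P ≤ 3 * (p.k₁ + p.k₂) := modePotential_le hp hP m
    _ = 3 * (p.k₁ + p.k₂) / g ^ 2 * g ^ 2 := by field_simp
    _ ≤ 3 * (p.k₁ + p.k₂) / g ^ 2 * X := by
      gcongr
      nlinarith

theorem exists_modePotential_II_le_gradient_sq :
    ∃ C > 0, ∀ P ∈ SO3, modePotential p .II P - minPotential p P ≤ p.δ →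
      modePotential p .II P ≤ C * (modeGradient p .II P ⬝ᵥ modeGradient p .II P) := by
  have hk₁ := hp.k₁_pos
  have hk₂ := hp.k₂_pos
  have hβ := sq_pos_of_ne_zero hp.β_ne_zero
  obtain ⟨g, hg, hmargin⟩ := hp.exists_margin
  refine ⟨3 * (p.k₁ + p.k₂) / g ^ 2 * (1 / p.k₁ ^ 2 + 1 / (p.k₂ ^ 2 * p.β ^ 2)), by positivity,
    fun P hP hflow => ?_⟩
  have hΨ := modePotential_sub_le hflow .I
  simp only [modePotential] at hΨ
  have hd := apply_le_of_expelling_flow hP hk₂ (hmargin _ (min_le_right _ _)).2 (i := 2) (j := 1)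
    (by linarith)
  have hcol : P 0 2 ^ 2 + P 2 2 ^ 2 ≤
      (1 / p.k₁ ^ 2 + 1 / (p.k₂ ^ 2 * p.β ^ 2)) *
        (modeGradient p .II P ⬝ᵥ modeGradient p .II P) := by
    rw [modeGradient_II_dotProduct_self]
    refine add_le_mul_of_mul_le (by positivity) (by positivity) ?_ ?_
    · exact le_add_of_le_of_nonneg (le_add_of_nonneg_right (by positivity)) (sq_nonneg _)
    · exact le_add_of_le_of_nonneg (le_add_of_nonneg_left (by positivity)) (sq_nonneg _)
  rw [mul_assoc]
  refine modePotential_le_of_apply_le hp hP hg hd (le_trans ?_ hcol)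
  linarith [row_sq_sum_of_mem hP 1, col_sq_sum_of_mem hP 2, sq_nonneg (P 1 0)]

theorem exists_modePotential_III_le_gradient_sq :
    ∃ C > 0, ∀ P ∈ SO3, modePotential p .III P - minPotential p P ≤ p.δ →
      modePotential p .III P ≤ C * (modeGradient p .III P ⬝ᵥ modeGradient p .III P) := by
  have hk₁ := hp.k₁_pos
  have hk₂ := hp.k₂_pos
  have hβ := sq_pos_of_ne_zero hp.β_ne_zero
  obtain ⟨g, hg, hmargin⟩ := hp.exists_margin
  refine ⟨3 * (p.k₁ + p.k₂) / g ^ 2 * (1 / p.k₂ ^ 2 + 1 / (p.k₁ ^ 2 * p.β ^ 2)), by positivity,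
    fun P hP hflow => ?_⟩
  have hΨ := modePotential_sub_le hflow .I
  simp only [modePotential] at hΨ
  have hd := apply_le_of_expelling_flow hP hk₁ (hmargin _ (min_le_left _ _)).2 (i := 2) (j := 0)
    (by linarith)
  have hcol : P 1 2 ^ 2 + P 2 2 ^ 2 ≤
      (1 / p.k₂ ^ 2 + 1 / (p.k₁ ^ 2 * p.β ^ 2)) *
        (modeGradient p .III P ⬝ᵥ modeGradient p .III P) := by
    rw [modeGradient_III_dotProduct_self]
    refine add_le_mul_of_mul_le (by positivity) (by positivity) ?_ ?_
    · exact le_add_of_le_of_nonneg (le_add_of_nonneg_right (by positivity)) (sq_nonneg _)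
    · exact le_add_of_le_of_nonneg (le_add_of_nonneg_left (by positivity)) (sq_nonneg _)
  rw [mul_assoc]
  refine modePotential_le_of_apply_le hp hP hg hd (le_trans ?_ hcol)
  linarith [row_sq_sum_of_mem hP 0, col_sq_sum_of_mem hP 2, sq_nonneg (P 0 1)]

theorem exists_modePotential_le_gradient_sq :
    ∃ C > 0, ∀ m, ∀ P ∈ SO3, modePotential p m P - minPotential p P ≤ p.δ →
      modePotential p m P ≤ C * (modeGradient p m P ⬝ᵥ modeGradient p m P) := by
  obtain ⟨C₁, hC₁, hI⟩ := exists_modePotential_I_le_gradient_sq hp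
  obtain ⟨C₂, hC₂, hII⟩ := exists_modePotential_II_le_gradient_sq hp
  obtain ⟨C₃, hC₃, hIII⟩ := exists_modePotential_III_le_gradient_sq hp
  refine ⟨C₁ + C₂ + C₃, by positivity, fun m P hP hflow => ?_⟩
  have hH : 0 ≤ modeGradient p m P ⬝ᵥ modeGradient p m P := dotProduct_self_star_nonneg _
  cases m
  · exact (hI P hP hflow).trans (mul_le_mul_of_nonneg_right (by linarith) hH)
  · exact (hII P hP hflow).trans (mul_le_mul_of_nonneg_right (by linarith) hH)
  · exact (hIII P hP hflow).trans (mul_le_mul_of_nonneg_right (by linarith) hH)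

end Coercivity

/-! ### Error dynamics -/

/-- The torque that drives the angular velocity error `e`, with reference angular velocity `c` and
inertia `K` in the frame of the body-fixed directions. -/
def errorTorque (p : Params) (K : Mat3) (m : Mode) (c : Vec3) (P : Mat3) (e : Vec3) : Vec3 :=
  -(e ⨯₃ (K *ᵥ e)) - e ⨯₃ (K *ᵥ (Pᵀ *ᵥ c)) - (Pᵀ *ᵥ c) ⨯₃ (K *ᵥ e)
    + K *ᵥ (e ⨯₃ (Pᵀ *ᵥ c)) - modeGradient p m P - p.kΩ • e

/-- Kinetic energy of the angular velocity error. -/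
def kinetic (K : Mat3) (e : Vec3) : ℝ := (1 / 2) * (e ⬝ᵥ (K *ᵥ e))

/-- Total error energy in a mode. -/
def energy (p : Params) (K : Mat3) (m : Mode) (P : Mat3) (e : Vec3) : ℝ :=
  kinetic K e + modePotential p m P

theorem dotProduct_errorTorque (p : Params) {K : Mat3} (hK : Kᵀ = K) (m : Mode) (c : Vec3)
    (P : Mat3) (e : Vec3) :
    e ⬝ᵥ errorTorque p K m c P e = -(modeGradient p m P ⬝ᵥ e) - p.kΩ * (e ⬝ᵥ e) := by
  simp only [errorTorque, dotProduct_sub, dotProduct_add, dotProduct_neg, dotProduct_smul,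
    dot_self_cross, smul_eq_mul]
  rw [dotProduct_mulVec_comm_of_transpose_eq hK, triple_product_permutation e (Pᵀ *ᵥ c) (K *ᵥ e),
    dotProduct_comm e (modeGradient p m P), triple_product_permutation (Pᵀ *ᵥ c) (K *ᵥ e) e,
    dotProduct_comm (K *ᵥ e), dotProduct_comm (e ⨯₃ _)]
  ring

theorem hasDerivWithinAt_kinetic {K : Mat3} (hK : Kᵀ = K) {e : ℝ → Vec3} {e' : Vec3} {S : Set ℝ}
    {t : ℝ} (he : HasDerivWithinAt e e' S t) :
    HasDerivWithinAt (fun s => kinetic K (e s)) (e t ⬝ᵥ (K *ᵥ e')) S t := by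
  refine ((hasDerivWithinAt_dotProduct he
    (hasDerivWithinAt_const_mulVec K he)).const_mul (1 / 2)).congr_deriv ?_
  rw [dotProduct_mulVec_comm_of_transpose_eq hK e']
  ring

theorem hasDerivWithinAt_energy (p : Params) {K : Mat3} (hK : K.PosDef) (m : Mode) {c : Vec3}
    {P : ℝ → Mat3} {e : ℝ → Vec3} {χ : ℝ} {S : Set ℝ} {t : ℝ}
    (hP : MatHasDerivWithinAt P (P t * hat (χ • e t)) S t)
    (he : HasDerivWithinAt e (χ • K⁻¹ *ᵥ errorTorque p K m c (P t) (e t)) S t) :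
    HasDerivWithinAt (fun s => energy p K m (P s) (e s)) (-(χ * p.kΩ * (e t ⬝ᵥ e t))) S t := by
  have hKT := transpose_eq_of_posDef hK
  refine ((hasDerivWithinAt_kinetic hKT he).add
    (hasDerivWithinAt_modePotential p m hP)).congr_deriv ?_
  rw [Matrix.mulVec_smul, mulVec_inv_mulVec_of_posDef hK, dotProduct_smul,
    dotProduct_errorTorque p hKT, dotProduct_smul, smul_eq_mul, smul_eq_mul]
  ring

section Kinetic

variable {K : Mat3}

theorem kinetic_nonneg (hK : K.PosDef) (e : Vec3) : 0 ≤ kinetic K e :=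
  mul_nonneg one_half_pos.le (by simpa using hK.posSemidef.dotProduct_mulVec_nonneg e)

theorem energy_nonneg {p : Params} (hp : p.Tuned) (hK : K.PosDef) (m : Mode) {P : Mat3}
    (hP : P ∈ SO3) (e : Vec3) : 0 ≤ energy p K m P e :=
  add_nonneg (kinetic_nonneg hK e) (modePotential_nonneg hp hP m)

theorem eucNorm_sq_le_kinetic {l : ℝ} (hl : 0 < l) (hlK : ∀ x, l * (x ⬝ᵥ x) ≤ x ⬝ᵥ (K *ᵥ x))
    (e : Vec3) : eucNorm e ^ 2 ≤ 2 / l * kinetic K e := by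
  rw [div_mul_eq_mul_div, le_div_iff₀' hl, eucNorm_sq, kinetic]
  linarith [hlK e]

theorem eucNorm_le_one_add_kinetic (hK : K.PosDef) {l : ℝ} (hl : 0 < l)
    (hlK : ∀ x, l * (x ⬝ᵥ x) ≤ x ⬝ᵥ (K *ᵥ x)) (e : Vec3) :
    eucNorm e ≤ (1 + 2 / l) * (1 + kinetic K e) := by
  have hE := kinetic_nonneg hK e
  have hl' : 0 < 2 / l := by positivity
  nlinarith [eucNorm_sq_le_kinetic hl hlK e, sq_nonneg (eucNorm e - 1)]

theorem kinetic_le_eucNorm_sq {L : ℝ} (hLK : ∀ x, eucNorm (K *ᵥ x) ≤ L * eucNorm x) (e : Vec3) :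
    kinetic K e ≤ L / 2 * eucNorm e ^ 2 := by
  have h := ((le_abs_self _).trans (abs_dotProduct_le e (K *ᵥ e))).trans
    (mul_le_mul_of_nonneg_left (hLK e) (eucNorm_nonneg e))
  rw [kinetic]
  linarith

end Kinetic

/-! ### The strict Lyapunov function -/

/-- The cross term of the Lyapunov function. It is saturated in the angular velocity error, so that
it changes by a bounded amount at jumps. -/
def crossTerm (p : Params) (K : Mat3) (m : Mode) (P : Mat3) (e : Vec3) : ℝ :=
  (modeGradient p m P ⬝ᵥ (K *ᵥ e)) / (1 + kinetic K e)

/-- The derivative of `crossTerm` along the error dynamics. -/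
def crossTermRate (p : Params) (K : Mat3) (m : Mode) (c : Vec3) (P : Mat3) (e : Vec3) : ℝ :=
  ((modeGradient p m (P * hat e) ⬝ᵥ (K *ᵥ e) + modeGradient p m P ⬝ᵥ errorTorque p K m c P e)
      * (1 + kinetic K e)
    - (modeGradient p m P ⬝ᵥ (K *ᵥ e)) * (e ⬝ᵥ errorTorque p K m c P e)) / (1 + kinetic K e) ^ 2

/-- The error energy with a cross term of weight `κ`. -/
def lyapunov (p : Params) (K : Mat3) (κ : ℝ) (m : Mode) (P : Mat3) (e : Vec3) : ℝ :=
  energy p K m P e + κ * crossTerm p K m P e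

/-- The derivative of `lyapunov` along the error dynamics. -/
def lyapunovRate (p : Params) (K : Mat3) (κ : ℝ) (m : Mode) (c : Vec3) (P : Mat3) (e : Vec3) : ℝ :=
  -(p.kΩ * (e ⬝ᵥ e)) + κ * crossTermRate p K m c P e

theorem hasDerivWithinAt_crossTerm (p : Params) {K : Mat3} (hK : K.PosDef) (m : Mode)
    {c : Vec3} {P : ℝ → Mat3} {e : ℝ → Vec3} {S : Set ℝ} {t : ℝ}
    (hP : MatHasDerivWithinAt P (P t * hat (e t)) S t)
    (he : HasDerivWithinAt e (K⁻¹ *ᵥ errorTorque p K m c (P t) (e t)) S t) :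
    HasDerivWithinAt (fun s => crossTerm p K m (P s) (e s))
      (crossTermRate p K m c (P t) (e t)) S t := by
  have hnum := hasDerivWithinAt_dotProduct (hasDerivWithinAt_modeGradient p m hP)
    (hasDerivWithinAt_const_mulVec K he)
  have hden := (hasDerivWithinAt_kinetic (transpose_eq_of_posDef hK) he).const_add 1
  rw [mulVec_inv_mulVec_of_posDef hK] at hnum hden
  exact hnum.fun_div hden (by linarith [kinetic_nonneg hK (e t)])

theorem hasDerivWithinAt_lyapunov (p : Params) {K : Mat3} (hK : K.PosDef) (κ : ℝ) (m : Mode)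
    {c : Vec3} {P : ℝ → Mat3} {e : ℝ → Vec3} {S : Set ℝ} {t : ℝ}
    (hP : MatHasDerivWithinAt P (P t * hat (e t)) S t)
    (he : HasDerivWithinAt e (K⁻¹ *ᵥ errorTorque p K m c (P t) (e t)) S t) :
    HasDerivWithinAt (fun s => lyapunov p K κ m (P s) (e s))
      (lyapunovRate p K κ m c (P t) (e t)) S t := by
  have henergy := hasDerivWithinAt_energy p hK m (c := c) (χ := 1)
    (by simpa only [one_smul] using hP) (by simpa only [one_smul] using he)
  rw [one_mul] at henergy
  exact henergy.fun_add ((hasDerivWithinAt_crossTerm p hK m hP he).const_mul κ)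

section CrossTerm

variable {p : Params} (hp : p.Tuned) {K : Mat3} (hK : K.PosDef)

theorem abs_modeGradient_dotProduct_le {L : ℝ} (hLK : ∀ x, eucNorm (K *ᵥ x) ≤ L * eucNorm x)
    (m : Mode) (P : Mat3) (e : Vec3) :
    |modeGradient p m P ⬝ᵥ (K *ᵥ e)| ≤ L * (eucNorm e * eucNorm (modeGradient p m P)) := by
  refine (abs_dotProduct_le _ _).trans ?_
  linarith [mul_le_mul_of_nonneg_left (hLK e) (eucNorm_nonneg (modeGradient p m P))]

theorem eucNorm_row_of_mem {P : Mat3} (hP : P ∈ SO3) (i : Fin 3) : eucNorm (P i) = 1 := by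
  rw [eucNorm, Real.sqrt_eq_one]
  simpa only [dotProduct, Fin.sum_univ_three, ← pow_two] using row_sq_sum_of_mem hP i

theorem eucNorm_mul_hat_row_le {P : Mat3} (hP : P ∈ SO3) (v : Vec3) (i : Fin 3) :
    eucNorm ((P * hat v) i) ≤ eucNorm v := by
  have hrow : (P * hat v) i = P i ⨯₃ v := by
    ext j
    fin_cases j <;> simp [Matrix.mul_apply, hat, Fin.sum_univ_three, cross_apply] <;> ring
  simpa only [hrow, eucNorm_row_of_mem hP, one_mul] using eucNorm_cross_le (P i) v

include hp

theorem eucNorm_modeGradient_le_of_mem {P : Mat3} (hP : P ∈ SO3) (m : Mode) :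
    eucNorm (modeGradient p m P) ≤ p.k₁ + p.k₂ := by
  simpa only [mul_one] using
    eucNorm_modeGradient_le hp m fun i => (eucNorm_row_of_mem hP i).le

include hK

theorem exists_abs_crossTerm_le_energy :
    ∃ C > 0, ∀ m, ∀ P ∈ SO3, ∀ e, |crossTerm p K m P e| ≤ C * energy p K m P e := by
  obtain ⟨L, hL, hLK⟩ := exists_eucNorm_mulVec_le K
  obtain ⟨l, hl, hlK⟩ := exists_mul_dotProduct_self_le_of_posDef hK
  have hk := hp.k₁_add_k₂_pos
  refine ⟨L * (1 / l + 2 * (p.k₁ + p.k₂)), by positivity, fun m P hP e => ?_⟩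
  have hE := kinetic_nonneg hK e
  have hΨ := modePotential_nonneg hp hP m
  have he := eucNorm_sq_le_kinetic hl hlK e
  have hgrad := modeGradient_dotProduct_self_le hp hP m
  rw [← eucNorm_sq] at hgrad
  rw [crossTerm, abs_div, abs_of_pos (by linarith : 0 < 1 + kinetic K e), mul_assoc]
  refine (div_le_self (abs_nonneg _) (by linarith)).trans
    ((abs_modeGradient_dotProduct_le hLK m P e).trans (mul_le_mul_of_nonneg_left ?_ hL.le))
  calc eucNorm e * eucNorm (modeGradient p m P)
      ≤ (eucNorm e ^ 2 + eucNorm (modeGradient p m P) ^ 2) / 2 := by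
        linarith [two_mul_le_add_sq (eucNorm e) (eucNorm (modeGradient p m P))]
    _ ≤ 1 / l * kinetic K e + 2 * (p.k₁ + p.k₂) * modePotential p m P := by
        rw [show 2 / l = 2 * (1 / l) by ring] at he
        linarith
    _ ≤ (1 / l + 2 * (p.k₁ + p.k₂)) * energy p K m P e := by
        have hEk : 0 ≤ 2 * (p.k₁ + p.k₂) * kinetic K e := by positivity
        have hΨl : 0 ≤ 1 / l * modePotential p m P := by positivity
        rw [energy]
        linarith

theorem exists_abs_crossTerm_le :
    ∃ C > 0, ∀ m, ∀ P ∈ SO3, ∀ e, |crossTerm p K m P e| ≤ C := by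
  obtain ⟨L, hL, hLK⟩ := exists_eucNorm_mulVec_le K
  obtain ⟨l, hl, hlK⟩ := exists_mul_dotProduct_self_le_of_posDef hK
  have hk := hp.k₁_add_k₂_pos
  refine ⟨L * ((1 + 2 / l) * (p.k₁ + p.k₂)), by positivity, fun m P hP e => ?_⟩
  have hE := kinetic_nonneg hK e
  have hD : 0 < 1 + kinetic K e := by linarith
  rw [crossTerm, abs_div, abs_of_pos hD, div_le_iff₀ hD]
  calc |modeGradient p m P ⬝ᵥ (K *ᵥ e)|
      ≤ L * (eucNorm e * eucNorm (modeGradient p m P)) := abs_modeGradient_dotProduct_le hLK m P e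
    _ ≤ L * ((1 + 2 / l) * (1 + kinetic K e) * (p.k₁ + p.k₂)) := by
        gcongr
        · exact eucNorm_nonneg _
        · exact eucNorm_le_one_add_kinetic hK hl hlK e
        · exact eucNorm_modeGradient_le_of_mem hp hP m
    _ = L * ((1 + 2 / l) * (p.k₁ + p.k₂)) * (1 + kinetic K e) := by ring

end CrossTerm

theorem abs_dotProduct_cross_le (x y z : Vec3) {a b : ℝ} (ha : eucNorm y ≤ a)
    (hb : eucNorm z ≤ b) : |x ⬝ᵥ (y ⨯₃ z)| ≤ eucNorm x * (a * b) :=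
  (abs_dotProduct_le _ _).trans <| mul_le_mul_of_nonneg_left
    ((eucNorm_cross_le y z).trans
      (mul_le_mul ha hb (eucNorm_nonneg z) ((eucNorm_nonneg y).trans ha))) (eucNorm_nonneg x)

theorem modeGradient_dotProduct_errorTorque_le {p : Params} (hkΩ : 0 ≤ p.kΩ) {K : Mat3} {L B : ℝ}
    (hL : 0 ≤ L) (hLK : ∀ x, eucNorm (K *ᵥ x) ≤ L * eucNorm x) (m : Mode) {c : Vec3}
    (hc : eucNorm c ≤ B) {P : Mat3} (hP : P ∈ SO3) (e : Vec3) :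
    modeGradient p m P ⬝ᵥ errorTorque p K m c P e ≤
      L * eucNorm (modeGradient p m P) * eucNorm e ^ 2
        + (p.kΩ + 3 * L * B) * (eucNorm e * eucNorm (modeGradient p m P))
        - eucNorm (modeGradient p m P) ^ 2 := by
  set h := modeGradient p m P
  set w := Pᵀ *ᵥ c
  have hw : eucNorm w ≤ B :=
    (eucNorm_mulVec_of_mem (transpose_mem_specialOrthogonalGroup hP) c).trans_le hc
  have hKw : eucNorm (K *ᵥ w) ≤ L * B := (hLK w).trans (mul_le_mul_of_nonneg_left hw hL)
  have hself := abs_dotProduct_cross_le h e (K *ᵥ e) le_rfl (hLK e)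
  have hgyro := abs_dotProduct_cross_le h e (K *ᵥ w) le_rfl hKw
  have hgyro' := abs_dotProduct_cross_le h w (K *ᵥ e) hw (hLK e)
  have htransport : |h ⬝ᵥ K *ᵥ (e ⨯₃ w)| ≤ eucNorm h * (L * (eucNorm e * B)) := by
    refine (abs_dotProduct_le _ _).trans (mul_le_mul_of_nonneg_left ((hLK _).trans ?_)
      (eucNorm_nonneg h))
    exact mul_le_mul_of_nonneg_left ((eucNorm_cross_le _ _).trans
      (mul_le_mul_of_nonneg_left hw (eucNorm_nonneg e))) hL
  have hdamp : p.kΩ * -(h ⬝ᵥ e) ≤ p.kΩ * (eucNorm h * eucNorm e) :=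
    mul_le_mul_of_nonneg_left ((neg_le_abs _).trans (abs_dotProduct_le _ _)) hkΩ
  simp only [errorTorque, dotProduct_sub, dotProduct_add, dotProduct_neg, dotProduct_smul,
    smul_eq_mul]
  rw [← eucNorm_sq h]
  linarith [(abs_le.1 hself).1, (abs_le.1 hgyro).1, (abs_le.1 hgyro').1, (abs_le.1 htransport).2]

theorem quotient_rate_le {a η E X X' E' k C₁ C₂ L G c : ℝ} (ha : 0 ≤ a) (hη : 0 ≤ η) (hE : 0 ≤ E)
    (hk : 0 ≤ k) (hC₁ : 0 ≤ C₁) (hL : 0 ≤ L) (hc : 0 ≤ c) (hηG : η ≤ G) (haE : a ≤ c * (1 + E))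
    (hX : |X| ≤ L * (a * η)) (hE' : |E'| ≤ a * η + k * a ^ 2)
    (hX' : X' ≤ C₁ * a ^ 2 + C₂ * (a * η) - η ^ 2) :
    (X' * (1 + E) - X * E') / (1 + E) ^ 2 ≤
      (C₁ + C₂ ^ 2 / 2 + L * G * (G + k * c)) * a ^ 2 - 1 / 2 * (η ^ 2 / (1 + E)) := by
  have hD : 1 ≤ 1 + E := by linarith
  have hG : 0 ≤ G := hη.trans hηG
  have hnum : X' / (1 + E) ≤ (C₁ + C₂ ^ 2 / 2) * a ^ 2 - 1 / 2 * (η ^ 2 / (1 + E)) :=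
    calc X' / (1 + E) ≤ ((C₁ + C₂ ^ 2 / 2) * a ^ 2 - 1 / 2 * η ^ 2) / (1 + E) := by
          refine div_le_div_of_nonneg_right ?_ (zero_le_one.trans hD)
          nlinarith [sq_nonneg (C₂ * a - η)]
      _ = (C₁ + C₂ ^ 2 / 2) * a ^ 2 / (1 + E) - 1 / 2 * (η ^ 2 / (1 + E)) := by ring
      _ ≤ _ := sub_le_sub_right (div_le_self (by positivity) hD) _
  have hden : -(X * E') / (1 + E) ^ 2 ≤ L * G * (G + k * c) * a ^ 2 := by
    rw [div_le_iff₀ (by positivity)]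
    calc -(X * E') ≤ L * (a * η) * (a * η + k * a ^ 2) := by
          refine (neg_le_abs _).trans ((abs_mul X E').trans_le ?_)
          exact mul_le_mul hX hE' (abs_nonneg _) (by positivity)
      _ ≤ L * (a * G) * (a * G + k * a * (c * (1 + E))) := by
          rw [pow_two, ← mul_assoc k]
          gcongr
      _ = L * G * a ^ 2 * (G + k * c * (1 + E)) := by ring
      _ ≤ L * G * a ^ 2 * ((G + k * c) * (1 + E) ^ 2) := by
          gcongr
          nlinarith [mul_nonneg hk hc, mul_nonneg hG hE, mul_nonneg (mul_nonneg hk hc) hE,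
            sq_nonneg E, mul_nonneg hG (sq_nonneg E), mul_nonneg (mul_nonneg hk hc) (sq_nonneg E)]
      _ = L * G * (G + k * c) * a ^ 2 * (1 + E) ^ 2 := by ring
  calc (X' * (1 + E) - X * E') / (1 + E) ^ 2
      = X' / (1 + E) + -(X * E') / (1 + E) ^ 2 := by field_simp; ring
    _ ≤ _ := by linarith

section Lyapunov

variable {p : Params} (hp : p.Tuned) {K : Mat3} (hK : K.PosDef)
include hp hK

theorem exists_crossTermRate_le {B : ℝ} (hB : 0 ≤ B) :
    ∃ C > 0, ∀ m, ∀ P ∈ SO3, ∀ e c, eucNorm c ≤ B →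
      crossTermRate p K m c P e ≤
        C * eucNorm e ^ 2 - 1 / 2 * (eucNorm (modeGradient p m P) ^ 2 / (1 + kinetic K e)) := by
  obtain ⟨L, hL, hLK⟩ := exists_eucNorm_mulVec_le K
  obtain ⟨l, hl, hlK⟩ := exists_mul_dotProduct_self_le_of_posDef hK
  have hk := hp.k₁_add_k₂_pos
  have hkΩ := hp.kΩ_pos
  set G := p.k₁ + p.k₂
  refine ⟨2 * G * L + (p.kΩ + 3 * L * B) ^ 2 / 2 + L * G * (G + p.kΩ * (1 + 2 / l)),
    by positivity, fun m P hP e c hc => ?_⟩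
  have hgrad := eucNorm_modeGradient_le_of_mem hp hP m
  have he := eucNorm_nonneg e
  refine quotient_rate_le he (eucNorm_nonneg _) (kinetic_nonneg hK e) hkΩ.le
    (by positivity) hL.le (by positivity) hgrad (eucNorm_le_one_add_kinetic hK hl hlK e)
    (abs_modeGradient_dotProduct_le hLK m P e) ?_ ?_
  · rw [dotProduct_errorTorque p (transpose_eq_of_posDef hK)]
    refine (abs_sub _ _).trans ?_
    rw [abs_neg, ← eucNorm_sq, abs_of_nonneg (by positivity : 0 ≤ p.kΩ * eucNorm e ^ 2),
      mul_comm (eucNorm e)]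
    exact add_le_add_left (abs_dotProduct_le _ e) _
  · have hrate : modeGradient p m (P * hat e) ⬝ᵥ (K *ᵥ e) ≤ G * eucNorm e * (L * eucNorm e) :=
      ((le_abs_self _).trans (abs_dotProduct_le _ _)).trans <|
        mul_le_mul (eucNorm_modeGradient_le hp m (eucNorm_mul_hat_row_le hP e)) (hLK e)
          (eucNorm_nonneg _) (by positivity)
    have htorque := modeGradient_dotProduct_errorTorque_le hkΩ.le hL.le hLK m hc hP e
    have hquad : L * eucNorm (modeGradient p m P) * eucNorm e ^ 2 ≤ L * G * eucNorm e ^ 2 := by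
      gcongr
    linarith

theorem exists_energy_le_dissipation :
    ∃ A > 0, ∀ m, ∀ P ∈ SO3, ∀ e, modePotential p m P - minPotential p P ≤ p.δ →
      energy p K m P e ≤
        A * (eucNorm e ^ 2 + eucNorm (modeGradient p m P) ^ 2 / (1 + kinetic K e)) := by
  obtain ⟨L, hL, hLK⟩ := exists_eucNorm_mulVec_le K
  obtain ⟨C, hC, hcoercive⟩ := exists_modePotential_le_gradient_sq hp
  have hk := hp.k₁_add_k₂_pos
  set G := p.k₁ + p.k₂
  refine ⟨L / 2 + C * (1 + G ^ 2 * (L / 2)), by positivity, fun m P hP e hflow => ?_⟩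
  have hE := kinetic_nonneg hK e
  have hEup := kinetic_le_eucNorm_sq hLK e
  have hΨ := hcoercive m P hP hflow
  rw [← eucNorm_sq] at hΨ
  set y := eucNorm (modeGradient p m P) ^ 2 / (1 + kinetic K e) with hy
  have hy0 : 0 ≤ y := div_nonneg (sq_nonneg _) (by linarith)
  have hyG : y ≤ G ^ 2 := by
    refine (div_le_self (by positivity) (by linarith)).trans ?_
    exact pow_le_pow_left₀ (eucNorm_nonneg _) (eucNorm_modeGradient_le_of_mem hp hP m) 2
  have hgrad : eucNorm (modeGradient p m P) ^ 2 ≤ y + G ^ 2 * (L / 2 * eucNorm e ^ 2) :=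
    calc eucNorm (modeGradient p m P) ^ 2 = y + y * kinetic K e := by rw [hy]; field_simp
      _ ≤ _ := by gcongr
  calc energy p K m P e
      ≤ L / 2 * eucNorm e ^ 2 + C * (y + G ^ 2 * (L / 2 * eucNorm e ^ 2)) := by
        rw [energy]
        exact add_le_add hEup (hΨ.trans (mul_le_mul_of_nonneg_left hgrad hC.le))
    _ ≤ (L / 2 + C * (1 + G ^ 2 * (L / 2))) * (eucNorm e ^ 2 + y) := by
        have hrest : 0 ≤ (L / 2 + C * (G ^ 2 * (L / 2))) * y := mul_nonneg (by positivity) hy0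
        linarith [mul_nonneg hC.le (sq_nonneg (eucNorm e))]

end Lyapunov

/-- A weight `κ` of the cross term for which `lyapunov` is a strict Lyapunov function, with decay
rate `r`, of the hybrid error dynamics with reference angular velocity bounded by `B`. -/
structure IsLyapunovWeight (p : Params) (K : Mat3) (B κ r : ℝ) : Prop where
  lower : ∀ m, ∀ P ∈ SO3, ∀ e, energy p K m P e ≤ 2 * lyapunov p K κ m P e
  upper : ∀ m, ∀ P ∈ SO3, ∀ e, lyapunov p K κ m P e ≤ 2 * energy p K m P e
  jump : ∀ m m', ∀ P ∈ SO3, ∀ e, modePotential p m' P ≤ modePotential p m P - p.δ →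
    lyapunov p K κ m' P e ≤ lyapunov p K κ m P e
  decay : ∀ m, ∀ P ∈ SO3, ∀ e c, eucNorm c ≤ B → modePotential p m P - minPotential p P ≤ p.δ →
    lyapunovRate p K κ m c P e ≤ -(r * lyapunov p K κ m P e)

theorem neg_add_le_neg_min_div_mul {k κ A V a y : ℝ} (hk : 0 < k) (hκ : 0 < κ) (hA : 0 < A)
    (ha : 0 ≤ a) (hy : 0 ≤ y) (hV : V ≤ 2 * (A * (a + y))) :
    -(k / 2 * a + κ / 2 * y) ≤ -(min k κ / (4 * A) * V) := by
  have hr : 0 ≤ min k κ / (4 * A) := div_nonneg (lt_min hk hκ).le (by linarith)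
  refine neg_le_neg ?_
  calc min k κ / (4 * A) * V ≤ min k κ / (4 * A) * (2 * (A * (a + y))) :=
        mul_le_mul_of_nonneg_left hV hr
    _ = min k κ / 2 * a + min k κ / 2 * y := by field_simp; ring
    _ ≤ k / 2 * a + κ / 2 * y :=
        add_le_add (mul_le_mul_of_nonneg_right (by linarith [min_le_left k κ]) ha)
          (mul_le_mul_of_nonneg_right (by linarith [min_le_right k κ]) hy)

theorem exists_pos_mul_le_mul_le_mul_le {C₁ C₂ C₃ c₁ c₂ c₃ : ℝ} (hC₁ : 0 < C₁) (hC₂ : 0 < C₂)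
    (hC₃ : 0 < C₃) (hc₁ : 0 < c₁) (hc₂ : 0 < c₂) (hc₃ : 0 < c₃) :
    ∃ κ > 0, κ * C₁ ≤ c₁ ∧ κ * C₂ ≤ c₂ ∧ κ * C₃ ≤ c₃ := by
  refine ⟨min (c₁ / C₁) (min (c₂ / C₂) (c₃ / C₃)), by positivity, ?_, ?_, ?_⟩
  · exact (le_div_iff₀ hC₁).1 (min_le_left _ _)
  · exact (le_div_iff₀ hC₂).1 ((min_le_right _ _).trans (min_le_left _ _))
  · exact (le_div_iff₀ hC₃).1 ((min_le_right _ _).trans (min_le_right _ _))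

theorem exists_isLyapunovWeight {p : Params} (hp : p.Tuned) {K : Mat3} (hK : K.PosDef) {B : ℝ}
    (hB : 0 ≤ B) : ∃ κ > 0, ∃ r > 0, IsLyapunovWeight p K B κ r := by
  obtain ⟨C₁, hC₁, hcrossE⟩ := exists_abs_crossTerm_le_energy hp hK
  obtain ⟨C₂, hC₂, hcross⟩ := exists_abs_crossTerm_le hp hK
  obtain ⟨C₃, hC₃, hrate⟩ := exists_crossTermRate_le hp hK hB
  obtain ⟨A, hA, hdiss⟩ := exists_energy_le_dissipation hp hK
  obtain ⟨κ, hκ, hκ₁, hκ₂, hκ₃⟩ := exists_pos_mul_le_mul_le_mul_le hC₁ hC₂ hC₃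
    (half_pos one_pos) (half_pos hp.δ_pos) (half_pos hp.kΩ_pos)
  have hV : ∀ m, ∀ P ∈ SO3, ∀ e, |κ * crossTerm p K m P e| ≤ energy p K m P e / 2 :=
    fun m P hP e => by
      rw [abs_mul, abs_of_pos hκ]
      linarith [mul_le_mul_of_nonneg_left (hcrossE m P hP e) hκ.le,
        mul_le_mul_of_nonneg_right hκ₁ (energy_nonneg hp hK m hP e)]
  have hδ : ∀ m, ∀ P ∈ SO3, ∀ e, |κ * crossTerm p K m P e| ≤ p.δ / 2 := fun m P hP e => by
    rw [abs_mul, abs_of_pos hκ]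
    exact (mul_le_mul_of_nonneg_left (hcross m P hP e) hκ.le).trans hκ₂
  have hupper : ∀ m, ∀ P ∈ SO3, ∀ e, lyapunov p K κ m P e ≤ 2 * energy p K m P e :=
    fun m P hP e => by
      rw [lyapunov]
      linarith [(abs_le.1 (hV m P hP e)).2, energy_nonneg hp hK m hP e]
  refine ⟨κ, hκ, min p.kΩ κ / (4 * A), div_pos (lt_min hp.kΩ_pos hκ) (by linarith),
    fun m P hP e => ?_, hupper, fun m m' P hP e hlt => ?_, fun m P hP e c hc hflow => ?_⟩
  · rw [lyapunov]
    linarith [(abs_le.1 (hV m P hP e)).1]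
  · simp only [lyapunov, energy]
    linarith [(abs_le.1 (hδ m P hP e)).1, (abs_le.1 (hδ m' P hP e)).2]
  · have hdissipation : 0 ≤ eucNorm (modeGradient p m P) ^ 2 / (1 + kinetic K e) :=
      div_nonneg (sq_nonneg _) (by linarith [kinetic_nonneg hK e])
    refine le_trans ?_ (neg_add_le_neg_min_div_mul hp.kΩ_pos hκ hA (sq_nonneg (eucNorm e))
      hdissipation ((hupper m P hP e).trans
        (mul_le_mul_of_nonneg_left (hdiss m P hP e hflow) zero_le_two)))
    rw [lyapunovRate, ← eucNorm_sq]
    linarith [mul_le_mul_of_nonneg_left (hrate m P hP e c hc) hκ.le,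
      mul_le_mul_of_nonneg_right hκ₃ (sq_nonneg (eucNorm e))]

/-! ### Global solutions of bounded Lipschitz differential equations -/

section LipschitzODE

open Set

variable {Y : Type*} [NormedAddCommGroup Y] [NormedSpace ℝ Y] {f : ℝ → Y → Y} {C : NNReal}

theorem hasDerivWithinAt_Ici_of_Icc {g : ℝ → Y} {g' : Y} {a b t : ℝ} (ht : t ∈ Ico a b)
    (hg : HasDerivWithinAt g g' (Icc a b) t) : HasDerivWithinAt g g' (Ici t) t :=
  (hg.mono (Icc_subset_Icc_left ht.1)).mono_of_mem_nhdsWithin (Icc_mem_nhdsGE ht.2)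

theorem eqOn_Icc_of_lipschitzWith {a b : ℝ} (hLip : ∀ t ∈ Icc a b, LipschitzWith C (f t))
    {α γ : ℝ → Y} (hα : ∀ t ∈ Icc a b, HasDerivWithinAt α (f t (α t)) (Icc a b) t)
    (hγ : ∀ t ∈ Icc a b, HasDerivWithinAt γ (f t (γ t)) (Icc a b) t) (h : α a = γ a) :
    EqOn α γ (Icc a b) :=
  ODE_solution_unique_of_mem_Icc_right (s := fun _ => univ)
    (fun t ht => (hLip t (Ico_subset_Icc_self ht)).lipschitzOnWith)
    (fun t ht => (hα t ht).continuousWithinAt)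
    (fun t ht => hasDerivWithinAt_Ici_of_Icc ht (hα t (Ico_subset_Icc_self ht)))
    (fun _ _ => mem_univ _)
    (fun t ht => (hγ t ht).continuousWithinAt)
    (fun t ht => hasDerivWithinAt_Ici_of_Icc ht (hγ t (Ico_subset_Icc_self ht)))
    (fun _ _ => mem_univ _) h

variable [CompleteSpace Y]

theorem exists_hasDerivWithinAt_Icc_of_lipschitzWith {L : NNReal} {a b : ℝ} (hab : a ≤ b)
    (hLip : ∀ t ∈ Icc a b, LipschitzWith C (f t)) (hcont : ∀ y, ContinuousOn (f · y) (Icc a b))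
    (hbd : ∀ t ∈ Icc a b, ∀ y, ‖f t y‖ ≤ L) (y₀ : Y) :
    ∃ α : ℝ → Y, α a = y₀ ∧ ∀ t ∈ Icc a b, HasDerivWithinAt α (f t (α t)) (Icc a b) t := by
  have hPL : IsPicardLindelof f (⟨a, left_mem_Icc.2 hab⟩ : Icc a b) y₀
      (L * (b - a).toNNReal) 0 L C := by
    refine ⟨fun t ht => (hLip t ht).lipschitzOnWith, fun y _ => hcont y,
      fun t ht y _ => hbd t ht y, ?_⟩
    simp [hab]
  exact hPL.exists_eq_forall_mem_Icc_hasDerivWithinAt₀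

theorem exists_hasDerivWithinAt_Ici_of_lipschitzWith {L : NNReal} {t₁ : ℝ}
    (hLip : ∀ t, t₁ ≤ t → LipschitzWith C (f t)) (hcont : ∀ y, ContinuousOn (f · y) (Ici t₁))
    (hbd : ∀ t, t₁ ≤ t → ∀ y, ‖f t y‖ ≤ L) (y₀ : Y) :
    ∃ α : ℝ → Y, α t₁ = y₀ ∧ ∀ t, t₁ ≤ t → HasDerivWithinAt α (f t (α t)) (Ici t₁) t := by
  choose α hα₀ hα using fun n : ℕ => exists_hasDerivWithinAt_Icc_of_lipschitzWith
    (show t₁ ≤ t₁ + n + 1 by linarith [n.cast_nonneg (α := ℝ)]) (fun t ht => hLip t ht.1)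
    (fun y => (hcont y).mono Icc_subset_Ici_self) (fun t ht => hbd t ht.1) y₀
  have hrestrict : ∀ (n : ℕ) {b}, b ≤ t₁ + n + 1 → ∀ s ∈ Icc t₁ b,
      HasDerivWithinAt (α n) (f s (α n s)) (Icc t₁ b) s := fun n b hb s hs =>
    (hα n s ⟨hs.1, hs.2.trans hb⟩).mono (Icc_subset_Icc_right hb)
  have hagree : ∀ (n k : ℕ) t, t₁ ≤ t → t ≤ t₁ + n + 1 → t ≤ t₁ + k + 1 → α n t = α k t :=
    fun n k t ht hn hk => eqOn_Icc_of_lipschitzWith (fun s hs => hLip s hs.1)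
      (hrestrict n hn) (hrestrict k hk) ((hα₀ n).trans (hα₀ k).symm) ⟨ht, le_rfl⟩
  have hfloor : ∀ t, t < t₁ + ⌊t - t₁⌋₊ + 1 := fun t => by
    linarith [Nat.lt_floor_add_one (t - t₁)]
  refine ⟨fun t => α ⌊t - t₁⌋₊ t, hα₀ _, fun t ht => ?_⟩
  refine ((hα _ t ⟨ht, (hfloor t).le⟩).congr
    (fun s hs => hagree _ _ s hs.1 (hfloor s).le hs.2) rfl).mono_of_mem_nhdsWithin ?_
  rw [← Ici_inter_Iic]
  exact inter_mem_nhdsWithin _ (Iic_mem_nhds (hfloor t))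

end LipschitzODE

/-! ### Flows of the error dynamics -/

theorem eq_of_forall_hasDerivWithinAt_zero {F : Type*} [NormedAddCommGroup F] [NormedSpace ℝ F]
    {S : Set ℝ} (hS : Convex ℝ S) {f : ℝ → F} (hf : ∀ t ∈ S, HasDerivWithinAt f 0 S t) {a b : ℝ}
    (ha : a ∈ S) (hb : b ∈ S) : f a = f b := by
  have h := hS.norm_image_sub_le_of_norm_hasDerivWithin_le hf (fun _ _ => norm_zero.le) hb ha
  rwa [zero_mul, norm_le_zero_iff, sub_eq_zero] at h

theorem mem_specialOrthogonalGroup_of_mul_skew {n : Type*} [Fintype n] [DecidableEq n] {S : Set ℝ}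
    (hS : Convex ℝ S) {P A : ℝ → Matrix n n ℝ} (hA : ∀ t ∈ S, (A t)ᵀ = -A t)
    (hP : ∀ t ∈ S, MatHasDerivWithinAt P (P t * A t) S t) {a b : ℝ} (ha : a ∈ S) (hb : b ∈ S)
    (h : P a ∈ Matrix.specialOrthogonalGroup n ℝ) :
    P b ∈ Matrix.specialOrthogonalGroup n ℝ := by
  have hderiv : ∀ t ∈ S, MatHasDerivWithinAt (fun s => P s * (P s)ᵀ) 0 S t := fun t ht => by
    convert (hP t ht).mul (hP t ht).transpose using 1
    rw [Matrix.transpose_mul, hA t ht, Matrix.mul_assoc, Matrix.neg_mul, Matrix.mul_neg,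
      add_neg_cancel]
  have horth : ∀ t ∈ S, P t * (P t)ᵀ = 1 := fun t ht => by
    rw [← mul_transpose_of_mem h]
    ext i j
    exact eq_of_forall_hasDerivWithinAt_zero hS (fun s hs => hderiv s hs i j) ht ha
  have hcont : ContinuousOn (fun t => (P t).det) S :=
    continuous_id.matrix_det.comp_continuousOn <| continuousOn_pi.2 fun i =>
      continuousOn_pi.2 fun j t ht => (hP t ht i j).continuousWithinAt
  have hdet : Set.MapsTo (fun t => (P t).det) S {1, -1} := fun t ht => by
    have hsq := congrArg Matrix.det (horth t ht)
    rw [Matrix.det_mul, Matrix.det_transpose, Matrix.det_one] at hsq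
    exact mul_self_eq_one_iff.1 hsq
  rw [mem_specialOrthogonalGroup_iff_mul_transpose]
  refine ⟨horth b hb, ?_⟩
  rw [← det_eq_one_of_mem h]
  exact hS.isPreconnected.constant_of_mapsTo (Set.toFinite _).isDiscrete hcont hdet hb ha

/-- Attitude and angular velocity errors as a normed space. -/
abbrev ErrSpace := (Fin 3 → Fin 3 → ℝ) × Vec3

/-- The point of the error space with attitude error `P` and angular velocity error `e`. -/
def toErrSpace (P : Mat3) (e : Vec3) : ErrSpace := (Matrix.of.symm P, e)

/-- The error vector field, with the reference angular velocity as a parameter. -/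
def errorField (p : Params) (K : Mat3) (m : Mode) (z : Vec3 × ErrSpace) : ErrSpace :=
  toErrSpace (Matrix.of z.2.1 * hat z.2.2) (K⁻¹ *ᵥ errorTorque p K m z.1 (Matrix.of z.2.1) z.2.2)

section ContDiff

variable {E : Type*} [NormedAddCommGroup E] [NormedSpace ℝ E]

theorem contDiff_const_mulVec {m n : Type*} [Fintype m] [Fintype n] {k : WithTop ℕ∞}
    (A : Matrix m n ℝ) {v : E → n → ℝ} (hv : ContDiff ℝ k v) :
    ContDiff ℝ k (fun z => A *ᵥ v z) :=
  (Matrix.mulVecLin A).toContinuousLinearMap.contDiff.comp hv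

theorem contDiff_cross {k : WithTop ℕ∞} {u v : E → Vec3} (hu : ContDiff ℝ k u)
    (hv : ContDiff ℝ k v) : ContDiff ℝ k (fun z => u z ⨯₃ v z) := by
  rw [contDiff_pi] at hu hv ⊢
  have h := fun i j => (hu i).mul (hv j)
  intro i
  fin_cases i <;> simp only [cross_apply]
  exacts [(h 1 2).sub (h 2 1), (h 2 0).sub (h 0 2), (h 0 1).sub (h 1 0)]

theorem contDiff_entryGradient {k : WithTop ℕ∞} (i j : Fin 3) :
    ContDiff ℝ k (fun P : Fin 3 → Fin 3 → ℝ => entryGradient (Matrix.of P) i j) :=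
  contDiff_cross contDiff_const (contDiff_apply ℝ (Fin 3 → ℝ) i)

theorem contDiff_modeGradient (p : Params) (m : Mode) {k : WithTop ℕ∞} :
    ContDiff ℝ k (fun P : Fin 3 → Fin 3 → ℝ => modeGradient p m (Matrix.of P)) := by
  cases m <;> exact ((contDiff_entryGradient _ _).const_smul _).add
    ((contDiff_entryGradient _ _).const_smul _)

end ContDiff

theorem contDiff_errorField (p : Params) (K : Mat3) (m : Mode) :
    ContDiff ℝ ∞ (errorField p K m) := by
  have he : ContDiff ℝ ∞ (fun z : Vec3 × ErrSpace => z.2.2) := contDiff_snd.snd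
  have hKe := contDiff_const_mulVec K he
  have hw : ContDiff ℝ ∞ (fun z : Vec3 × ErrSpace => (Matrix.of z.2.1)ᵀ *ᵥ z.1) := by
    simp only [contDiff_pi, Matrix.mulVec, dotProduct, Matrix.transpose_apply, Matrix.of_apply]
    fun_prop
  have hgrad : ContDiff ℝ ∞ (fun z : Vec3 × ErrSpace => modeGradient p m (Matrix.of z.2.1)) :=
    (contDiff_modeGradient p m).comp contDiff_snd.fst
  refine ContDiff.prodMk ?_ (contDiff_const_mulVec _ ?_)
  · refine contDiff_pi.2 fun i => contDiff_pi.2 fun j => ?_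
    simp only [Matrix.of_symm_apply, mul_hat_apply, dotProduct]
    exact ContDiff.sum fun k _ => (contDiff_pi.1
      ((contDiff_entryGradient i j).comp contDiff_snd.fst) k).mul (contDiff_pi.1 he k)
  · exact ((((((contDiff_cross he hKe).neg.sub
      (contDiff_cross he (contDiff_const_mulVec K hw))).sub (contDiff_cross hw hKe)).add
      (contDiff_const_mulVec K (contDiff_cross he hw))).sub hgrad).sub (he.const_smul p.kΩ))

theorem exists_lipschitz_smul_errorField (p : Params) (K : Mat3) (m : Mode) (R : ℝ) :
    ∃ (χ : Vec3 × ErrSpace → ℝ) (C L : NNReal), (∀ z, 0 ≤ χ z) ∧ (∀ z, ‖z‖ ≤ R → χ z = 1) ∧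
      LipschitzWith C (fun z => χ z • errorField p K m z) ∧
      ∀ z, ‖χ z • errorField p K m z‖ ≤ L := by
  let f : ContDiffBump (0 : Vec3 × ErrSpace) :=
    { rIn := max R 1, rOut := max R 1 + 1, rIn_pos := by positivity, rIn_lt_rOut := by linarith }
  have hsupp : HasCompactSupport (fun z => f z • errorField p K m z) :=
    f.hasCompactSupport.smul_right
  have hsmooth : ContDiff ℝ ∞ (fun z => f z • errorField p K m z) :=
    f.contDiff.smul (contDiff_errorField p K m)
  obtain ⟨C, hC⟩ := hsmooth.lipschitzWith_of_hasCompactSupport hsupp (by simp)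
  obtain ⟨L, hL⟩ := hsupp.exists_bound_of_continuous hsmooth.continuous
  refine ⟨f, C, L.toNNReal, fun z => f.nonneg, fun z hz => f.one_of_mem_closedBall ?_, hC,
    fun z => (hL z).trans (Real.le_coe_toNNReal L)⟩
  rw [mem_closedBall_zero_iff]
  exact hz.trans (le_max_left _ _)

theorem norm_le_eucNorm (x : Vec3) : ‖x‖ ≤ eucNorm x :=
  (pi_norm_le_iff_of_nonneg (eucNorm_nonneg x)).2 (abs_apply_le_eucNorm x)

theorem exists_norm_le_of_energy_le {p : Params} (hp : p.Tuned) {K : Mat3} (hK : K.PosDef)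
    (m : Mode) (B V : ℝ) :
    ∃ R, ∀ c P e, eucNorm c ≤ B → P ∈ SO3 → energy p K m P e ≤ V →
      ‖(c, toErrSpace P e)‖ ≤ R := by
  obtain ⟨l, hl, hlK⟩ := exists_mul_dotProduct_self_le_of_posDef hK
  refine ⟨max B (max 1 (√(2 / l * V))), fun c P e hc hP hV => ?_⟩
  refine max_le_max ((norm_le_eucNorm c).trans hc) (max_le_max ?_ ((norm_le_eucNorm e).trans ?_))
  · refine (pi_norm_le_iff_of_nonneg zero_le_one).2 fun i => ?_
    exact (pi_norm_le_iff_of_nonneg zero_le_one).2 fun j => abs_apply_le_one_of_mem hP i j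
  · refine Real.le_sqrt_of_sq_le ((eucNorm_sq_le_kinetic hl hlK e).trans ?_)
    refine mul_le_mul_of_nonneg_left ?_ (by positivity)
    exact (le_add_of_nonneg_right (modePotential_nonneg hp hP m)).trans hV

/-- A flow of the error dynamics on the time set `S` in the mode `m`, for the reference angular
velocity `c`. -/
structure IsErrorFlow (p : Params) (K : Mat3) (c : ℝ → Vec3) (m : Mode) (S : Set ℝ) (P : ℝ → Mat3)
    (e : ℝ → Vec3) : Prop where
  mem_SO3 : ∀ t ∈ S, P t ∈ SO3
  kinematics : ∀ t ∈ S, MatHasDerivWithinAt P (P t * hat (e t)) S t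
  dynamics : ∀ t ∈ S, HasDerivWithinAt e (K⁻¹ *ᵥ errorTorque p K m (c t) (P t) (e t)) S t

section Energy

variable {p : Params} (hkΩ : 0 ≤ p.kΩ) {K : Mat3} (hK : K.PosDef) {c : ℝ → Vec3} {m : Mode}
  {S : Set ℝ} (hS : Convex ℝ S) {P : ℝ → Mat3} {e : ℝ → Vec3}
include hkΩ hK hS

theorem energy_antitoneOn {χ : ℝ → ℝ} (hχ : ∀ t ∈ S, 0 ≤ χ t)
    (hP : ∀ t ∈ S, MatHasDerivWithinAt P (P t * hat (χ t • e t)) S t)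
    (he : ∀ t ∈ S, HasDerivWithinAt e (χ t • K⁻¹ *ᵥ errorTorque p K m (c t) (P t) (e t)) S t) :
    AntitoneOn (fun t => energy p K m (P t) (e t)) S := by
  have hderiv := fun t (ht : t ∈ S) => hasDerivWithinAt_energy p hK m (hP t ht) (he t ht)
  refine antitoneOn_of_hasDerivWithinAt_nonpos hS (fun t ht => (hderiv t ht).continuousWithinAt)
    (fun t ht => (hderiv t (interior_subset ht)).mono interior_subset) fun t ht => ?_
  have hdissipation : 0 ≤ χ t * p.kΩ * (e t ⬝ᵥ e t) :=
    mul_nonneg (mul_nonneg (hχ t (interior_subset ht)) hkΩ)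
      (eucNorm_sq (e t) ▸ sq_nonneg (eucNorm (e t)))
  linarith

theorem IsErrorFlow.energy_antitoneOn (h : IsErrorFlow p K c m S P e) :
    AntitoneOn (fun t => energy p K m (P t) (e t)) S :=
  AttitudeTracking.energy_antitoneOn hkΩ hK hS (χ := fun _ => 1) (fun _ _ => zero_le_one)
    (by simpa using h.kinematics) (by simpa using h.dynamics)

end Energy

theorem hasDerivWithinAt_toErrSpace {P : ℝ → Mat3} {e : ℝ → Vec3} {P' : Mat3} {e' : Vec3}
    {S : Set ℝ} {t : ℝ} :
    HasDerivWithinAt (fun s => toErrSpace (P s) (e s)) (toErrSpace P' e') S t ↔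
      MatHasDerivWithinAt P P' S t ∧ HasDerivWithinAt e e' S t := by
  refine ⟨fun h => ⟨fun i j => ?_, h.snd⟩, fun h => .prodMk ?_ h.2⟩
  · exact hasDerivWithinAt_pi.1 (hasDerivWithinAt_pi.1 h.fst i) j
  · exact hasDerivWithinAt_pi.2 fun i => hasDerivWithinAt_pi.2 fun j => h.1 i j

section Flow

variable {p : Params} {K : Mat3} {c : ℝ → Vec3} {m : Mode}

theorem lipschitzWith_smul_errorField_right {χ : Vec3 × ErrSpace → ℝ} {C : NNReal}
    (hLip : LipschitzWith C (fun z => χ z • errorField p K m z)) (v : Vec3) :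
    LipschitzWith C (fun y => χ (v, y) • errorField p K m (v, y)) := by
  have h := hLip.comp (LipschitzWith.prodMk_left (β := ErrSpace) v)
  rwa [mul_one] at h

theorem exists_hasDerivWithinAt_smul_errorField {χ : Vec3 × ErrSpace → ℝ} {C L : NNReal}
    (hLip : LipschitzWith C (fun z => χ z • errorField p K m z))
    (hbd : ∀ z, ‖χ z • errorField p K m z‖ ≤ L) {t₁ : ℝ} (hc : ContinuousOn c (Set.Ici t₁))
    (P₁ : Mat3) (e₁ : Vec3) :
    ∃ (P : ℝ → Mat3) (e : ℝ → Vec3), P t₁ = P₁ ∧ e t₁ = e₁ ∧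
      (∀ t ∈ Set.Ici t₁, MatHasDerivWithinAt P
        (P t * hat (χ (c t, toErrSpace (P t) (e t)) • e t)) (Set.Ici t₁) t) ∧
      ∀ t ∈ Set.Ici t₁, HasDerivWithinAt e (χ (c t, toErrSpace (P t) (e t)) •
        K⁻¹ *ᵥ errorTorque p K m (c t) (P t) (e t)) (Set.Ici t₁) t := by
  obtain ⟨α, hα₀, hα⟩ := exists_hasDerivWithinAt_Ici_of_lipschitzWith
    (f := fun t y => χ (c t, y) • errorField p K m (c t, y)) (C := C) (L := L) (t₁ := t₁)
    (fun t _ => lipschitzWith_smul_errorField_right hLip (c t))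
    (fun y => hLip.continuous.comp_continuousOn (hc.prodMk continuousOn_const))
    (fun t _ y => hbd _) (toErrSpace P₁ e₁)
  have hderiv := fun t (ht : t₁ ≤ t) =>
    (hasDerivWithinAt_toErrSpace (P := fun t => Matrix.of (α t).1) (e := fun t => (α t).2)).1
      (hα t ht)
  refine ⟨fun t => Matrix.of (α t).1, fun t => (α t).2, congrArg (fun y => Matrix.of y.1) hα₀,
    congrArg Prod.snd hα₀, fun t ht => ?_, fun t ht => (hderiv t ht).2⟩
  rw [hat_smul, Matrix.mul_smul]
  exact (hderiv t ht).1

variable (hp : p.Tuned) (hK : K.PosDef) {B : ℝ}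
include hp hK

theorem exists_isErrorFlow {t₁ : ℝ} (hc : ContinuousOn c (Set.Ici t₁))
    (hB : ∀ t, t₁ ≤ t → eucNorm (c t) ≤ B) (m : Mode) {P₁ : Mat3} (hP₁ : P₁ ∈ SO3) (e₁ : Vec3) :
    ∃ P e, P t₁ = P₁ ∧ e t₁ = e₁ ∧ IsErrorFlow p K c m (Set.Ici t₁) P e := by
  obtain ⟨R, hR⟩ := exists_norm_le_of_energy_le hp hK m B (energy p K m P₁ e₁)
  obtain ⟨χ, C, L, hχ₀, hχ₁, hLip, hbd⟩ := exists_lipschitz_smul_errorField p K m R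
  obtain ⟨P, e, rfl, rfl, hP, he⟩ := exists_hasDerivWithinAt_smul_errorField hLip hbd hc P₁ e₁
  have hmem : ∀ t ∈ Set.Ici t₁, P t ∈ SO3 := fun t ht =>
    mem_specialOrthogonalGroup_of_mul_skew (convex_Ici t₁) (fun _ _ => hat_transpose _) hP
      Set.self_mem_Ici ht hP₁
  -- Slowing the field down preserves the decay of the energy, hence the flow stays where `χ = 1`.
  have hone : ∀ t ∈ Set.Ici t₁, χ (c t, toErrSpace (P t) (e t)) = 1 := fun t ht =>
    hχ₁ _ <| hR _ _ _ (hB t ht) (hmem t ht) <| energy_antitoneOn hp.kΩ_pos.le hK (convex_Ici t₁)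
      (fun _ _ => hχ₀ _) hP he Set.self_mem_Ici ht ht
  refine ⟨P, e, rfl, rfl, hmem, fun t ht => ?_, fun t ht => ?_⟩
  · simpa only [hone t ht, one_smul] using hP t ht
  · simpa only [hone t ht, one_smul] using he t ht

theorem IsErrorFlow.eq_right {a b : ℝ} (hab : a ≤ b) (hB : ∀ t ∈ Set.Icc a b, eucNorm (c t) ≤ B)
    {P Q : ℝ → Mat3} {e f : ℝ → Vec3} (h : IsErrorFlow p K c m (Set.Icc a b) P e)
    (h' : IsErrorFlow p K c m (Set.Icc a b) Q f) (hP : P a = Q a) (he : e a = f a) :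
    P b = Q b ∧ e b = f b := by
  obtain ⟨R, hR⟩ := exists_norm_le_of_energy_le hp hK m B (energy p K m (P a) (e a))
  obtain ⟨χ, C, -, -, hχ₁, hLip, -⟩ := exists_lipschitz_smul_errorField p K m R
  have hsolution : ∀ {P : ℝ → Mat3} {e : ℝ → Vec3}, IsErrorFlow p K c m (Set.Icc a b) P e →
      energy p K m (P a) (e a) ≤ energy p K m (Q a) (f a) → ∀ t ∈ Set.Icc a b,
      HasDerivWithinAt (fun s => toErrSpace (P s) (e s)) (χ (c t, toErrSpace (P t) (e t)) •
        errorField p K m (c t, toErrSpace (P t) (e t))) (Set.Icc a b) t := by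
    intro P e h hle t ht
    have hV := h.energy_antitoneOn hp.kΩ_pos.le hK (convex_Icc a b) (Set.left_mem_Icc.2 hab) ht ht.1
    rw [hχ₁ _ (hR _ _ _ (hB t ht) (h.mem_SO3 t ht) (hV.trans (by rwa [hP, he]))), one_smul]
    exact hasDerivWithinAt_toErrSpace.2 ⟨h.kinematics t ht, h.dynamics t ht⟩
  have heq : toErrSpace (P b) (e b) = toErrSpace (Q b) (f b) :=
    eqOn_Icc_of_lipschitzWith (f := fun t y => χ (c t, y) • errorField p K m (c t, y))
      (fun t _ => lipschitzWith_smul_errorField_right hLip (c t)) (hsolution h (by rw [hP, he]))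
      (hsolution h' le_rfl) (by rw [hP, he]) (Set.right_mem_Icc.2 hab)
  exact ⟨congrArg (fun y => Matrix.of y.1) heq, congrArg Prod.snd heq⟩

end Flow

/-! ### Error coordinates -/

/-- The rotation with columns `b₁`, `b₂`, `b₁ ⨯₃ b₂`. -/
def frame (p : Params) : Mat3 := (Matrix.of ![p.b₁, p.b₂, p.b₁ ⨯₃ p.b₂])ᵀ

/-- The attitude error matrix in the frame of the body-fixed directions. -/
def attErr (p : Params) (ref : Reference) (t : ℝ) (R : Mat3) : Mat3 :=
  (frame p)ᵀ * (ref.Rd t)ᵀ * R * frame p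

/-- The angular velocity error in the frame of the body-fixed directions. -/
def velErr (p : Params) (ref : Reference) (t : ℝ) (x : State) : Vec3 :=
  (frame p)ᵀ *ᵥ eΩ ref t x

/-- The inertia matrix in the frame of the body-fixed directions. -/
def frameInertia (p : Params) : Mat3 := (frame p)ᵀ * p.J * frame p

/-- The angular acceleration of the body under the hybrid controller. -/
def angularAcc (p : Params) (ref : Reference) (t : ℝ) (x : State) : Vec3 :=
  p.J⁻¹ *ᵥ (control p ref t x - x.Ω ⨯₃ (p.J *ᵥ x.Ω))

/-- The reference angular velocity in the frame of the desired directions. -/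
def refVel (p : Params) (ref : Reference) (t : ℝ) : Vec3 :=
  (frame p)ᵀ *ᵥ ((ref.Rd t)ᵀ *ᵥ ref.ωd t)

/-- The body-fixed directions `b₁` and `b₂` are orthonormal. -/
structure Params.Orthonormal (p : Params) : Prop where
  b₁_sq : p.b₁ ⬝ᵥ p.b₁ = 1
  b₂_sq : p.b₂ ⬝ᵥ p.b₂ = 1
  b₁_b₂ : p.b₁ ⬝ᵥ p.b₂ = 0

section Rotation

variable {R : Mat3} (hR : R ∈ SO3)
include hR

theorem mul_hat_transpose_mulVec_of_mem (w : Vec3) : R * hat (Rᵀ *ᵥ w) = hat w * R := by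
  rw [← hat_mulVec_mul_of_mem hR, Matrix.mulVec_mulVec, mul_transpose_of_mem hR, Matrix.one_mulVec]

theorem mulVec_transpose_mulVec_of_mem (v : Vec3) : R *ᵥ (Rᵀ *ᵥ v) = v := by
  rw [Matrix.mulVec_mulVec, mul_transpose_of_mem hR, Matrix.one_mulVec]

theorem transpose_mulVec_mulVec_of_mem (v : Vec3) : Rᵀ *ᵥ (R *ᵥ v) = v := by
  rw [Matrix.mulVec_mulVec, transpose_mul_of_mem hR, Matrix.one_mulVec]

end Rotation

theorem transpose_mul_hat_mulVec (R : Mat3) (v w : Vec3) :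
    (R * hat v)ᵀ *ᵥ w = -(v ⨯₃ (Rᵀ *ᵥ w)) := by
  rw [Matrix.transpose_mul, hat_transpose, Matrix.neg_mul, Matrix.neg_mulVec,
    ← Matrix.mulVec_mulVec, hat_mulVec]

theorem frame_mem_SO3 {p : Params} (hb : p.Orthonormal) : frame p ∈ SO3 := by
  have h₂₁ : p.b₂ ⬝ᵥ p.b₁ = 0 := by rw [dotProduct_comm, hb.b₁_b₂]
  have h₃ : (p.b₁ ⨯₃ p.b₂) ⬝ᵥ (p.b₁ ⨯₃ p.b₂) = 1 := by
    rw [cross_dot_cross, hb.b₁_sq, hb.b₂_sq, hb.b₁_b₂]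
    ring
  have h₃₁ : (p.b₁ ⨯₃ p.b₂) ⬝ᵥ p.b₁ = 0 := by rw [dotProduct_comm, dot_self_cross]
  have h₃₂ : (p.b₁ ⨯₃ p.b₂) ⬝ᵥ p.b₂ = 0 := by rw [dotProduct_comm, dot_cross_self]
  refine transpose_mem_specialOrthogonalGroup
    ((mem_specialOrthogonalGroup_iff_mul_transpose).2 ⟨?_, ?_⟩)
  · ext i j
    change ![p.b₁, p.b₂, p.b₁ ⨯₃ p.b₂] i ⬝ᵥ ![p.b₁, p.b₂, p.b₁ ⨯₃ p.b₂] j = _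
    fin_cases i <;> fin_cases j <;>
      simp [hb.b₁_sq, hb.b₂_sq, hb.b₁_b₂, h₂₁, h₃, h₃₁, h₃₂]
  · change Matrix.det ![p.b₁, p.b₂, p.b₁ ⨯₃ p.b₂] = 1
    rw [← triple_product_eq_det, triple_product_permutation, triple_product_permutation, h₃]

section Errors

variable {p : Params} {ref : Reference} {t : ℝ}

theorem attErr_eq_mul (R : Mat3) :
    attErr p ref t R = (ref.Rd t * frame p)ᵀ * (R * frame p) := by
  rw [attErr, Matrix.transpose_mul, Matrix.mul_assoc _ R]

theorem attErr_apply (R : Mat3) (i j : Fin 3) :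
    attErr p ref t R i j = (R *ᵥ (frame p)ᵀ j) ⬝ᵥ (ref.Rd t *ᵥ (frame p)ᵀ i) := by
  rw [attErr_eq_mul, dotProduct_comm]
  rfl

theorem attErr_row (R : Mat3) (i : Fin 3) :
    attErr p ref t R i = (frame p)ᵀ *ᵥ (Rᵀ *ᵥ (ref.Rd t *ᵥ (frame p)ᵀ i)) := by
  rw [Matrix.mulVec_mulVec, ← Matrix.transpose_mul]
  ext j
  rw [attErr_apply]
  rfl

variable (hRd : ref.Rd t ∈ SO3)

section
include hRd

theorem rd₁_cross_rd₂ : rd₁ p ref t ⨯₃ rd₂ p ref t = ref.Rd t *ᵥ (p.b₁ ⨯₃ p.b₂) :=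
  (mulVec_cross_of_mem hRd _ _).symm

theorem Ψ_eq_modePotential (R : Mat3) (m : Mode) :
    Ψ p ref t R m = modePotential p m (attErr p ref t R) := by
  cases m <;> simp only [Ψ, modePotential, ΨN₁, ΨN₂, ΨE₁, ΨE₂, rd₁_cross_rd₂ hRd, attErr_apply] <;>
    rfl

theorem ρ_eq_minPotential (R : Mat3) : ρ p ref t R = minPotential p (attErr p ref t R) := by
  simp only [ρ, minPotential, Ψ_eq_modePotential hRd]

end

variable (hb : p.Orthonormal)
include hb

theorem eucNorm_velErr {x : State} (hR : x.R ∈ SO3) :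
    eucNorm (velErr p ref t x) = eucNorm (x.R *ᵥ x.Ω - ref.ωd t) := by
  rw [velErr, eucNorm_mulVec_of_mem (transpose_mem_specialOrthogonalGroup (frame_mem_SO3 hb)),
    ← eucNorm_mulVec_of_mem hR (eΩ ref t x), eΩ, Matrix.mulVec_sub,
    mulVec_transpose_mulVec_of_mem hR]

theorem frameInertia_mulVec (v : Vec3) :
    frameInertia p *ᵥ ((frame p)ᵀ *ᵥ v) = (frame p)ᵀ *ᵥ (p.J *ᵥ v) := by
  rw [frameInertia, ← Matrix.mulVec_mulVec, ← Matrix.mulVec_mulVec,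
    mulVec_transpose_mulVec_of_mem (frame_mem_SO3 hb)]

theorem frameInertia_posDef (hJ : p.J.PosDef) : (frameInertia p).PosDef := by
  have hinj : Function.Injective (frame p).mulVec :=
    Function.LeftInverse.injective (transpose_mulVec_mulVec_of_mem (frame_mem_SO3 hb))
  have h := hJ.conjTranspose_mul_mul_same hinj
  rwa [Matrix.conjTranspose_eq_transpose_of_trivial] at h

include hRd

theorem attErr_mem_SO3 {R : Mat3} (hR : R ∈ SO3) : attErr p ref t R ∈ SO3 :=
  mul_mem (mul_mem (mul_mem (transpose_mem_specialOrthogonalGroup (frame_mem_SO3 hb))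
    (transpose_mem_specialOrthogonalGroup hRd)) hR) (frame_mem_SO3 hb)

theorem frobNorm_sq {R : Mat3} (hR : R ∈ SO3) :
    frobNorm (R - ref.Rd t) ^ 2 = 2 * (3 - (attErr p ref t R).trace) := by
  have hexpand : (R - ref.Rd t)ᵀ * (R - ref.Rd t) =
      1 + 1 - (((ref.Rd t)ᵀ * R)ᵀ + (ref.Rd t)ᵀ * R) := by
    rw [Matrix.transpose_sub, Matrix.sub_mul, Matrix.mul_sub, Matrix.mul_sub,
      transpose_mul_of_mem hR, transpose_mul_of_mem hRd, Matrix.transpose_mul,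
      Matrix.transpose_transpose]
    abel
  have htrace : (attErr p ref t R).trace = ((ref.Rd t)ᵀ * R).trace := by
    rw [attErr, Matrix.trace_mul_comm, ← Matrix.mul_assoc, ← Matrix.mul_assoc,
      mul_transpose_of_mem (frame_mem_SO3 hb), Matrix.one_mul]
  have hle := trace_le_card_of_mem (attErr_mem_SO3 hRd hb hR)
  have hsq : ((R - ref.Rd t)ᵀ * (R - ref.Rd t)).trace = 2 * (3 - (attErr p ref t R).trace) := by
    rw [hexpand, Matrix.trace_sub, Matrix.trace_add, Matrix.trace_add, Matrix.trace_transpose,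
      ← htrace, Matrix.trace_one, Fintype.card_fin]
    push_cast
    ring
  rw [Fintype.card_fin] at hle
  push_cast at hle
  rw [frobNorm, hsq, Real.sq_sqrt (by linarith)]

theorem eucNorm_refVel : eucNorm (refVel p ref t) = eucNorm (ref.ωd t) := by
  rw [refVel, eucNorm_mulVec_of_mem (transpose_mem_specialOrthogonalGroup (frame_mem_SO3 hb)),
    eucNorm_mulVec_of_mem (transpose_mem_specialOrthogonalGroup hRd)]

theorem transpose_attErr_mulVec_refVel (R : Mat3) :
    (attErr p ref t R)ᵀ *ᵥ refVel p ref t = (frame p)ᵀ *ᵥ (Rᵀ *ᵥ ref.ωd t) := by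
  simp only [attErr, refVel, Matrix.transpose_mul, Matrix.transpose_transpose,
    ← Matrix.mulVec_mulVec, mulVec_transpose_mulVec_of_mem (frame_mem_SO3 hb),
    mulVec_transpose_mulVec_of_mem hRd]

omit hRd in
theorem frame_transpose_mulVec_cross (R : Mat3) (i j : Fin 3) :
    (frame p)ᵀ *ᵥ ((Rᵀ *ᵥ (ref.Rd t *ᵥ (frame p)ᵀ i)) ⨯₃ (frame p)ᵀ j) =
      -entryGradient (attErr p ref t R) i j := by
  have hF := frame_mem_SO3 hb
  have hj : (frame p)ᵀ j = frame p *ᵥ Pi.single j 1 := by rw [Matrix.mulVec_single_one]; rfl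
  rw [mulVec_cross_of_mem (transpose_mem_specialOrthogonalGroup hF), ← attErr_row, hj,
    transpose_mulVec_mulVec_of_mem hF, entryGradient, cross_anticomm]

theorem frame_transpose_mulVec_eH (x : State) :
    (frame p)ᵀ *ᵥ eH p ref t x = modeGradient p x.m (attErr p ref t x.R) := by
  have hcross := frame_transpose_mulVec_cross (ref := ref) (t := t) hb x.R
  have h₁₁ : (frame p)ᵀ *ᵥ ((x.Rᵀ *ᵥ rd₁ p ref t) ⨯₃ p.b₁) = _ := hcross 0 0
  have h₂₂ : (frame p)ᵀ *ᵥ ((x.Rᵀ *ᵥ rd₂ p ref t) ⨯₃ p.b₂) = _ := hcross 1 1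
  have h₃₁ : (frame p)ᵀ *ᵥ ((x.Rᵀ *ᵥ (ref.Rd t *ᵥ (p.b₁ ⨯₃ p.b₂))) ⨯₃ p.b₁) = _ := hcross 2 0
  have h₃₂ : (frame p)ᵀ *ᵥ ((x.Rᵀ *ᵥ (ref.Rd t *ᵥ (p.b₁ ⨯₃ p.b₂))) ⨯₃ p.b₂) = _ := hcross 2 1
  rcases hm : x.m <;>
  · simp only [eH, eH₁, eH₂, hm, modeGradient, Matrix.mulVec_add, Matrix.mulVec_smul,
      Matrix.mulVec_neg, rd₁_cross_rd₂ hRd, h₁₁, h₂₂, h₃₁, h₃₂]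
    module

theorem frame_transpose_mulVec_torque (x : State) :
    errorTorque p (frameInertia p) x.m (refVel p ref t) (attErr p ref t x.R) (velErr p ref t x) =
      (frame p)ᵀ *ᵥ (control p ref t x - x.Ω ⨯₃ (p.J *ᵥ x.Ω)
        + p.J *ᵥ (x.Ω ⨯₃ (x.Rᵀ *ᵥ ref.ωd t))
        - p.J *ᵥ (x.Rᵀ *ᵥ derivWithin ref.ωd (Set.Ici 0) t)) := by
  have hFT := transpose_mem_specialOrthogonalGroup (frame_mem_SO3 hb)
  have hΩ : x.Ω = eΩ ref t x + x.Rᵀ *ᵥ ref.ωd t := by rw [eΩ, sub_add_cancel]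
  rw [errorTorque, transpose_attErr_mulVec_refVel hRd hb, ← frame_transpose_mulVec_eH hRd hb,
    velErr]
  simp only [frameInertia_mulVec hb, ← mulVec_cross_of_mem hFT, ← Matrix.mulVec_smul,
    ← Matrix.mulVec_neg, ← Matrix.mulVec_sub, ← Matrix.mulVec_add]
  congr 1
  simp only [control, hat_mulVec]
  rw [hΩ]
  simp only [map_add, LinearMap.add_apply, Matrix.mulVec_add, cross_self, Matrix.mulVec_zero]
  abel

theorem frame_transpose_mulVec_angularAcc (hJ : p.J.PosDef) (x : State) :
    (frame p)ᵀ *ᵥ (angularAcc p ref t x - ((x.R * hat x.Ω)ᵀ *ᵥ ref.ωd t +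
        x.Rᵀ *ᵥ derivWithin ref.ωd (Set.Ici 0) t)) =
      (frameInertia p)⁻¹ *ᵥ errorTorque p (frameInertia p) x.m (refVel p ref t)
        (attErr p ref t x.R) (velErr p ref t x) := by
  rw [eq_inv_mulVec_iff_of_posDef (frameInertia_posDef hb hJ), frameInertia_mulVec hb,
    frame_transpose_mulVec_torque hRd hb, transpose_mul_hat_mulVec]
  simp only [Matrix.mulVec_sub, Matrix.mulVec_add, Matrix.mulVec_neg, angularAcc,
    mulVec_inv_mulVec_of_posDef hJ]
  abel

end Errors

theorem Reference.IsAdmissible.hasDerivWithinAt_ωd {ref : Reference} (h : ref.IsAdmissible) {t : ℝ}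
    (ht : 0 ≤ t) :
    HasDerivWithinAt ref.ωd (derivWithin ref.ωd (Set.Ici 0) t) (Set.Ici 0) t := by
  have hrow : ∀ i j k, DifferentiableOn ℝ
      (fun s => derivWithin (fun r => ref.Rd r i k) (Set.Ici 0) s * ref.Rd s j k) (Set.Ici 0) :=
    fun i j k => DifferentiableOn.fun_mul
      (((h.smooth i k).derivWithin (uniqueDiffOn_Ici 0) (m := ∞) (by simp)).differentiableOn
        (by simp)) ((h.smooth j k).differentiableOn (by simp))
  have hhat : ∀ i j, DifferentiableOn ℝ (fun s => hat (ref.ωd s) i j) (Set.Ici 0) := by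
    intro i j
    refine (DifferentiableOn.fun_sum (u := Finset.univ) fun k _ => hrow i j k).congr fun s hs => ?_
    have hcancel : hat (ref.ωd s) = (hat (ref.ωd s) * ref.Rd s) * (ref.Rd s)ᵀ := by
      rw [Matrix.mul_assoc, mul_transpose_of_mem (h.mem_SO3 s hs), Matrix.mul_one]
    rw [hcancel, Matrix.mul_apply]
    refine Finset.sum_congr rfl fun k _ => ?_
    rw [(h.kinematics s hs i k).derivWithin (uniqueDiffOn_Ici 0 s hs), Matrix.transpose_apply]
  have hd : DifferentiableOn ℝ ref.ωd (Set.Ici 0) := by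
    rw [differentiableOn_pi]
    intro i
    fin_cases i
    · exact (hhat 2 1).congr fun s _ => by simp [hat]
    · exact (hhat 0 2).congr fun s _ => by simp [hat]
    · exact (hhat 1 0).congr fun s _ => by simp [hat]
  exact (hd t ht).hasDerivWithinAt

theorem Reference.IsAdmissible.continuousOn_refVel {ref : Reference} (h : ref.IsAdmissible)
    (p : Params) : ContinuousOn (refVel p ref) (Set.Ici 0) := fun t ht =>
  have hRd : MatHasDerivWithinAt ref.Rd _ (Set.Ici 0) t := h.kinematics t ht
  (hasDerivWithinAt_const_mulVec _
    (hRd.transpose.mulVec (h.hasDerivWithinAt_ωd ht))).continuousWithinAt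

/-! ### Flows in a fixed mode -/

/-- A flow of the closed loop in the mode `m` on the time set `S`. -/
structure IsFlow (p : Params) (ref : Reference) (m : Mode) (S : Set ℝ) (x : ℝ → State) : Prop where
  mode : ∀ t ∈ S, (x t).m = m
  mem_SO3 : ∀ t ∈ S, (x t).R ∈ SO3
  kinematics : ∀ t ∈ S, MatHasDerivWithinAt (fun s => (x s).R) ((x t).R * hat (x t).Ω) S t
  dynamics : ∀ t ∈ S, HasDerivWithinAt (fun s => (x s).Ω) (angularAcc p ref t (x t)) S t

/-- The state in the mode `m` with attitude error `P` and angular velocity error `e`. -/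
def errState (p : Params) (ref : Reference) (m : Mode) (t : ℝ) (P : Mat3) (e : Vec3) : State where
  R := ref.Rd t * (frame p * P * (frame p)ᵀ)
  Ω := frame p *ᵥ e + (ref.Rd t * (frame p * P * (frame p)ᵀ))ᵀ *ᵥ ref.ωd t
  m := m

section Reduction

variable {p : Params} {ref : Reference}

theorem mul_hat_Ω_eq {x : State} (hR : x.R ∈ SO3) (t : ℝ) :
    x.R * hat x.Ω = x.R * hat (eΩ ref t x) + hat (ref.ωd t) * x.R := by
  rw [← mul_hat_transpose_mulVec_of_mem hR, ← Matrix.mul_add, ← hat_add, eΩ, sub_add_cancel]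

variable (hb : p.Orthonormal)
include hb

theorem frame_mul_hat_velErr (t : ℝ) (x : State) :
    frame p * hat (velErr p ref t x) = hat (eΩ ref t x) * frame p :=
  mul_hat_transpose_mulVec_of_mem (frame_mem_SO3 hb) _

theorem velErr_errState (t : ℝ) (m : Mode) (P : Mat3) (e : Vec3) :
    velErr p ref t (errState p ref m t P e) = e := by
  rw [velErr, eΩ, errState, add_sub_cancel_right, transpose_mulVec_mulVec_of_mem (frame_mem_SO3 hb)]

section

variable {t : ℝ} (hRd : ref.Rd t ∈ SO3)
include hRd

theorem attErr_errState (m : Mode) (P : Mat3) (e : Vec3) :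
    attErr p ref t (errState p ref m t P e).R = P := by
  calc attErr p ref t (errState p ref m t P e).R
      = (frame p)ᵀ * ((ref.Rd t)ᵀ * ref.Rd t) * frame p * P * ((frame p)ᵀ * frame p) := by
        simp only [attErr, errState, Matrix.mul_assoc]
    _ = P := by
        rw [transpose_mul_of_mem hRd, Matrix.mul_one, transpose_mul_of_mem (frame_mem_SO3 hb),
          Matrix.one_mul, Matrix.mul_one]

theorem errState_attErr_velErr (x : State) :
    errState p ref x.m t (attErr p ref t x.R) (velErr p ref t x) = x := by
  have hF := frame_mem_SO3 hb
  have hR : ref.Rd t * (frame p * attErr p ref t x.R * (frame p)ᵀ) = x.R := by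
    calc ref.Rd t * (frame p * attErr p ref t x.R * (frame p)ᵀ)
        = ref.Rd t * (frame p * (frame p)ᵀ) * (ref.Rd t)ᵀ * x.R * (frame p * (frame p)ᵀ) := by
          simp only [attErr, Matrix.mul_assoc]
      _ = x.R := by
          simp only [mul_transpose_of_mem hF, Matrix.mul_one, mul_transpose_of_mem hRd,
            Matrix.one_mul]
  have hΩ : frame p *ᵥ velErr p ref t x + x.Rᵀ *ᵥ ref.ωd t = x.Ω := by
    rw [velErr, mulVec_transpose_mulVec_of_mem hF, eΩ, sub_add_cancel]
  rw [errState, hR, hΩ]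

theorem errState_R_mem_SO3 (m : Mode) {P : Mat3} (hP : P ∈ SO3) (e : Vec3) :
    (errState p ref m t P e).R ∈ SO3 :=
  mul_mem hRd (mul_mem (mul_mem (frame_mem_SO3 hb) hP)
    (transpose_mem_specialOrthogonalGroup (frame_mem_SO3 hb)))

end

variable {S : Set ℝ} {t : ℝ}

theorem matHasDerivWithinAt_attErr {x : ℝ → State} (hR : (x t).R ∈ SO3)
    (hRd : MatHasDerivWithinAt ref.Rd (hat (ref.ωd t) * ref.Rd t) S t)
    (hx : MatHasDerivWithinAt (fun s => (x s).R) ((x t).R * hat (x t).Ω) S t) :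
    MatHasDerivWithinAt (fun s => attErr p ref s (x s).R)
      (attErr p ref t (x t).R * hat (velErr p ref t (x t))) S t := by
  have hd := (((MatHasDerivWithinAt.const (frame p)ᵀ).mul hRd.transpose).mul hx).mul
    (MatHasDerivWithinAt.const (frame p))
  suffices hval : attErr p ref t (x t).R * hat (velErr p ref t (x t)) = _ from hval ▸ hd
  rw [attErr, Matrix.mul_assoc _ (frame p), frame_mul_hat_velErr hb,
    mul_hat_Ω_eq (ref := ref) hR t, Matrix.transpose_mul, hat_transpose]
  noncomm_ring

theorem matHasDerivWithinAt_errState {P : ℝ → Mat3} {e : ℝ → Vec3} (m : Mode)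
    (hR : (errState p ref m t (P t) (e t)).R ∈ SO3)
    (hRd : MatHasDerivWithinAt ref.Rd (hat (ref.ωd t) * ref.Rd t) S t)
    (hP : MatHasDerivWithinAt P (P t * hat (e t)) S t) :
    MatHasDerivWithinAt (fun s => (errState p ref m s (P s) (e s)).R)
      ((errState p ref m t (P t) (e t)).R * hat (errState p ref m t (P t) (e t)).Ω) S t := by
  have hd := hRd.mul (((MatHasDerivWithinAt.const (frame p)).mul hP).mul
    (MatHasDerivWithinAt.const (frame p)ᵀ))
  have hhat : (frame p)ᵀ * hat (frame p *ᵥ e t) = hat (e t) * (frame p)ᵀ := by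
    simpa only [Matrix.transpose_transpose] using mul_hat_transpose_mulVec_of_mem
      (transpose_mem_specialOrthogonalGroup (frame_mem_SO3 hb)) (e t)
  have heΩ : eΩ ref t (errState p ref m t (P t) (e t)) = frame p *ᵥ e t := add_sub_cancel_right _ _
  suffices hval : (errState p ref m t (P t) (e t)).R *
      hat (errState p ref m t (P t) (e t)).Ω = _ from hval ▸ hd
  rw [mul_hat_Ω_eq (ref := ref) hR t, heΩ, errState]
  simp only [Matrix.mul_assoc, hhat, Matrix.zero_mul, Matrix.mul_zero, zero_add, add_zero]
  abel

variable (hJ : p.J.PosDef) (href : ref.IsAdmissible) (hS : S ⊆ Set.Ici 0) {m : Mode}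
include hJ href hS

theorem IsFlow.isErrorFlow {x : ℝ → State} (h : IsFlow p ref m S x) :
    IsErrorFlow p (frameInertia p) (refVel p ref) m S (fun t => attErr p ref t (x t).R)
      (fun t => velErr p ref t (x t)) := by
  have hRd : ∀ t ∈ S, MatHasDerivWithinAt ref.Rd _ S t := fun t ht =>
    MatHasDerivWithinAt.mono (href.kinematics t (hS ht)) hS
  refine ⟨fun t ht => attErr_mem_SO3 (href.mem_SO3 t (hS ht)) hb (h.mem_SO3 t ht), fun t ht =>
    matHasDerivWithinAt_attErr hb (h.mem_SO3 t ht) (hRd t ht) (h.kinematics t ht), fun t ht => ?_⟩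
  have hω := (h.kinematics t ht).transpose.mulVec ((href.hasDerivWithinAt_ωd (hS ht)).mono hS)
  rw [← h.mode t ht, ← frame_transpose_mulVec_angularAcc (href.mem_SO3 t (hS ht)) hb hJ]
  exact hasDerivWithinAt_const_mulVec (frame p)ᵀ ((h.dynamics t ht).sub hω)

theorem IsErrorFlow.isFlow {P : ℝ → Mat3} {e : ℝ → Vec3}
    (h : IsErrorFlow p (frameInertia p) (refVel p ref) m S P e) :
    IsFlow p ref m S (fun t => errState p ref m t (P t) (e t)) := by
  have hR : ∀ t ∈ S, (errState p ref m t (P t) (e t)).R ∈ SO3 := fun t ht =>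
    errState_R_mem_SO3 hb (href.mem_SO3 t (hS ht)) m (h.mem_SO3 t ht) (e t)
  have hkin : ∀ t ∈ S, MatHasDerivWithinAt (fun s => (errState p ref m s (P s) (e s)).R) _ S t :=
    fun t ht => matHasDerivWithinAt_errState hb m (hR t ht)
      (MatHasDerivWithinAt.mono (href.kinematics t (hS ht)) hS) (h.kinematics t ht)
  refine ⟨fun _ _ => rfl, hR, hkin, fun t ht => ?_⟩
  have hRd := href.mem_SO3 t (hS ht)
  have hω := (hkin t ht).transpose.mulVec ((href.hasDerivWithinAt_ωd (hS ht)).mono hS)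
  have hacc := frame_transpose_mulVec_angularAcc hRd hb hJ (errState p ref m t (P t) (e t))
  rw [attErr_errState hb hRd, velErr_errState hb] at hacc
  refine ((hasDerivWithinAt_const_mulVec (frame p) (h.dynamics t ht)).add hω).congr_deriv ?_
  change frame p *ᵥ ((frameInertia p)⁻¹ *ᵥ errorTorque _ _ (errState p ref m t (P t) (e t)).m _ _ _)
    + _ = _
  rw [← hacc, mulVec_transpose_mulVec_of_mem (frame_mem_SO3 hb), sub_add_cancel]

end Reduction

/-! ### Hybrid time domains -/

section Domain

variable {t₀ T : ℝ} {N : ℕ} {E E' : Set (ℝ × ℕ)}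

theorem IsHybridTimeDomain.initial_mem (h : IsHybridTimeDomain t₀ E) : (t₀, 0) ∈ E := by
  obtain ⟨⟨T, N⟩, hTN⟩ := h.nonempty
  obtain ⟨τ, rfl, hτ, hiff⟩ := h.truncation T N hTN
  exact ((hiff (τ 0) 0).2 ⟨N.zero_le, le_rfl, hτ 0 N.zero_le⟩).1

theorem IsHybridTimeDomain.exists_jumpTime (h : IsHybridTimeDomain t₀ E) {t : ℝ} {j : ℕ}
    (ht : (t, j + 1) ∈ E) : ∃ s, (s, j) ∈ E ∧ (s, j + 1) ∈ E := by
  obtain ⟨τ, -, hτ, hiff⟩ := h.truncation t (j + 1) ht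
  exact ⟨τ (j + 1), ((hiff _ _).2 ⟨j.le_succ, Set.right_mem_Icc.2 (hτ j j.le_succ)⟩).1,
    ((hiff _ _).2 ⟨le_rfl, Set.left_mem_Icc.2 (hτ (j + 1) le_rfl)⟩).1⟩

theorem IsHybridTimeDomain.initial_le (h : IsHybridTimeDomain t₀ E) {t : ℝ} {j : ℕ}
    (ht : (t, j) ∈ E) : t₀ ≤ t := by
  rcases j.eq_zero_or_pos with rfl | hj
  · obtain ⟨τ, rfl, -, hiff⟩ := h.truncation t 0 ht
    exact ((hiff t 0).1 ⟨ht, le_rfl, le_rfl⟩).2.1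
  · exact h.ordered _ _ _ _ h.initial_mem ht hj

theorem IsHybridTimeDomain.ordConnected_timeSlice (h : IsHybridTimeDomain t₀ E) (j : ℕ) :
    (timeSlice E j).OrdConnected := by
  refine ⟨fun s hs t ht r hr => ?_⟩
  obtain ⟨τ, -, -, hiff⟩ := h.truncation t j ht
  have hs' := ((hiff s j).1 ⟨hs, hr.1.trans hr.2, le_rfl⟩).2
  have ht' := ((hiff t j).1 ⟨ht, le_rfl, le_rfl⟩).2
  exact ((hiff r j).2 ⟨le_rfl, hs'.1.trans hr.1, hr.2.trans ht'.2⟩).1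

theorem exists_mem_of_exists_jumpTime
    (hjump : ∀ t j, (t, j + 1) ∈ E → ∃ s, (s, j) ∈ E ∧ (s, j + 1) ∈ E) (hTN : (T, N) ∈ E) {j : ℕ}
    (hj : j ≤ N) : ∃ t, (t, j) ∈ E := by
  induction hj using Nat.decreasingInduction with
  | self => exact ⟨T, hTN⟩
  | of_succ k _ ih =>
    obtain ⟨t, ht⟩ := ih
    obtain ⟨s, hs, -⟩ := hjump t k ht
    exact ⟨s, hs⟩

theorem isHybridTimeDomain_of_exists_jumpTime (hinit : (t₀, 0) ∈ E)
    (hle : ∀ t, (t, 0) ∈ E → t₀ ≤ t) (hconn : ∀ j, (timeSlice E j).OrdConnected)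
    (hord : ∀ s i t j, (s, i) ∈ E → (t, j) ∈ E → i < j → s ≤ t)
    (hjump : ∀ t j, (t, j + 1) ∈ E → ∃ s, (s, j) ∈ E ∧ (s, j + 1) ∈ E) :
    IsHybridTimeDomain t₀ E := by
  refine ⟨⟨_, hinit⟩, hord, fun T N hTN => ?_⟩
  have hjump_lt : ∀ j < N, ∃ s, (s, j) ∈ E ∧ (s, j + 1) ∈ E := fun j hj => by
    obtain ⟨t, ht⟩ := exists_mem_of_exists_jumpTime hjump hTN (Nat.succ_le_of_lt hj)
    exact hjump t j ht
  choose! σ hσ using hjump_lt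
  let τ : ℕ → ℝ := fun | 0 => t₀ | j + 1 => if j < N then σ j else T
  have hτ_of_lt : ∀ j, j < N → τ (j + 1) = σ j := fun j hj => if_pos hj
  have hτ_last : τ (N + 1) = T := if_neg (lt_irrefl N)
  have hleft : ∀ j ≤ N, (τ j, j) ∈ E := by
    rintro (_ | j) hj
    · exact hinit
    · exact hτ_of_lt j hj ▸ (hσ j hj).2
  have hright : ∀ j ≤ N, (τ (j + 1), j) ∈ E := fun j hj => by
    rcases hj.lt_or_eq with hlt | rfl
    · exact hτ_of_lt j hlt ▸ (hσ j hlt).1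
    · exact hτ_last.symm ▸ hTN
  have hleft_le : ∀ t j, (t, j) ∈ E → j ≤ N → τ j ≤ t := by
    rintro t (_ | j) ht hj
    · exact hle t ht
    · exact hτ_of_lt j hj ▸ hord _ _ _ _ (hσ j hj).1 ht j.lt_succ_self
  have hle_right : ∀ t j, (t, j) ∈ E → t ≤ T → j ≤ N → t ≤ τ (j + 1) := fun t j ht htT hj => by
    rcases hj.lt_or_eq with hlt | rfl
    · exact hτ_of_lt j hlt ▸ hord _ _ _ _ ht (hσ j hlt).2 j.lt_succ_self
    · exact hτ_last.symm ▸ htT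
  have hright_le : ∀ j ≤ N, τ (j + 1) ≤ T := fun j hj => by
    rcases hj.lt_or_eq with hlt | rfl
    · exact hord _ _ _ _ (hright j hj) hTN hlt
    · exact hτ_last.le
  exact ⟨τ, rfl, fun j hj => hleft_le _ j (hright j hj) hj, fun t j =>
    ⟨fun ⟨ht, htT, hj⟩ => ⟨hj, hleft_le t j ht hj, hle_right t j ht htT hj⟩, fun ⟨hj, ht⟩ =>
      ⟨(hconn j).out (hleft j hj) (hright j hj) ht, ht.2.trans (hright_le j hj), hj⟩⟩⟩

/-- The part of a hybrid time domain up to `(T, N)`. -/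
def truncDomain (E : Set (ℝ × ℕ)) (T : ℝ) (N : ℕ) : Set (ℝ × ℕ) := {q ∈ E | q.1 ≤ T ∧ q.2 ≤ N}

theorem IsHybridTimeDomain.trunc (h : IsHybridTimeDomain t₀ E) (hTN : (T, N) ∈ E) :
    IsHybridTimeDomain t₀ (truncDomain E T N) := by
  refine ⟨⟨(T, N), hTN, le_rfl, le_rfl⟩,
    fun s i t j hs ht hij => h.ordered s i t j hs.1 ht.1 hij, fun T' N' h' => ?_⟩
  obtain ⟨τ, h0, hτ, hiff⟩ := h.truncation T' N' h'.1
  refine ⟨τ, h0, hτ, fun t j => Iff.trans ?_ (hiff t j)⟩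
  exact ⟨fun hq => ⟨hq.1.1, hq.2⟩,
    fun hq => ⟨⟨hq.1, hq.2.1.trans h'.2.1, hq.2.2.trans h'.2.2⟩, hq.2⟩⟩

/-- `(T, N)` is the final point of the hybrid time domain `E`. -/
structure IsFinalPoint (E : Set (ℝ × ℕ)) (T : ℝ) (N : ℕ) : Prop where
  mem : (T, N) ∈ E
  time_le : ∀ {t j}, (t, j) ∈ E → t ≤ T
  jumps_le : ∀ {t j}, (t, j) ∈ E → j ≤ N

theorem isFinalPoint_truncDomain (hTN : (T, N) ∈ E) : IsFinalPoint (truncDomain E T N) T N :=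
  ⟨⟨hTN, le_rfl, le_rfl⟩, fun ht => ht.2.1, fun ht => ht.2.2⟩

/-- Juxtaposition of a hybrid time domain that ends after `N` jumps with another one. -/
def appendDomain (E : Set (ℝ × ℕ)) (N : ℕ) (E' : Set (ℝ × ℕ)) : Set (ℝ × ℕ) :=
  E ∪ {q | ∃ k, q.2 = N + k ∧ (q.1, k) ∈ E'}

theorem mem_appendDomain {t : ℝ} {j : ℕ} :
    (t, j) ∈ appendDomain E N E' ↔ (t, j) ∈ E ∨ ∃ k, j = N + k ∧ (t, k) ∈ E' :=
  Iff.rfl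

theorem timeSlice_append_of_lt {j : ℕ} (hj : j < N) :
    timeSlice (appendDomain E N E') j = timeSlice E j := by
  ext t
  exact or_iff_left fun ⟨k, hk, _⟩ => absurd hk (by omega)

theorem timeSlice_append_self :
    timeSlice (appendDomain E N E') N = timeSlice E N ∪ timeSlice E' 0 := by
  ext t
  simp [timeSlice, mem_appendDomain]

theorem timeSlice_append_add_succ (hfin : IsFinalPoint E T N) (k : ℕ) :
    timeSlice (appendDomain E N E') (N + (k + 1)) = timeSlice E' (k + 1) := by
  ext t
  have hnot : (t, N + (k + 1)) ∉ E := fun ht => absurd (hfin.jumps_le ht) (by omega)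
  simp [timeSlice, mem_appendDomain, hnot]

theorem IsHybridTimeDomain.append (h : IsHybridTimeDomain t₀ E) (hfin : IsFinalPoint E T N)
    (h' : IsHybridTimeDomain T E') : IsHybridTimeDomain t₀ (appendDomain E N E') := by
  refine isHybridTimeDomain_of_exists_jumpTime (Or.inl h.initial_mem) ?_ ?_ ?_ ?_
  · rintro t (ht | ⟨k, -, ht⟩)
    · exact h.initial_le ht
    · exact (h.initial_le hfin.mem).trans (h'.initial_le ht)
  · intro j
    rcases lt_or_ge j N with hlt | hge
    · rw [timeSlice_append_of_lt hlt]
      exact h.ordConnected_timeSlice j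
    obtain ⟨_ | k, rfl⟩ := Nat.exists_eq_add_of_le hge
    · rw [timeSlice_append_self]
      exact ((h.ordConnected_timeSlice j).isPreconnected.union T hfin.mem h'.initial_mem
        (h'.ordConnected_timeSlice 0).isPreconnected).ordConnected
    · rw [timeSlice_append_add_succ hfin]
      exact h'.ordConnected_timeSlice (k + 1)
  · rintro s i t j (hs | ⟨i, rfl, hs⟩) (ht | ⟨j, rfl, ht⟩) hij
    · exact h.ordered s i t j hs ht hij
    · exact (hfin.time_le hs).trans (h'.initial_le ht)
    · exact absurd (hfin.jumps_le ht) (by omega)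
    · exact h'.ordered s i t j hs ht (by omega)
  · rintro t j (ht | ⟨_ | k, hk, ht⟩)
    · obtain ⟨s, hs, hs'⟩ := h.exists_jumpTime ht
      exact ⟨s, Or.inl hs, Or.inl hs'⟩
    · obtain rfl : j + 1 = N := hk
      obtain ⟨s, hs, hs'⟩ := h.exists_jumpTime hfin.mem
      exact ⟨s, Or.inl hs, Or.inl hs'⟩
    · obtain rfl : j = N + k := Nat.succ_injective hk
      obtain ⟨s, hs, hs'⟩ := h'.exists_jumpTime ht
      exact ⟨s, Or.inr ⟨k, rfl, hs⟩, Or.inr ⟨k + 1, rfl, hs'⟩⟩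

theorem timeSlice_prod_zero (S : Set ℝ) : timeSlice (S ×ˢ {0}) 0 = S := by
  ext t
  simp [timeSlice]

theorem timeSlice_prod_zero_succ (S : Set ℝ) (j : ℕ) : timeSlice (S ×ˢ {0}) (j + 1) = ∅ := by
  ext t
  simp [timeSlice]

theorem isHybridTimeDomain_prod_zero {S : Set ℝ} (hS : S.OrdConnected) (ht₀ : IsLeast S t₀) :
    IsHybridTimeDomain t₀ (S ×ˢ {0}) := by
  refine isHybridTimeDomain_of_exists_jumpTime ⟨ht₀.1, rfl⟩ (fun t ht => ht₀.2 ht.1) ?_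
    (fun s i t j _ ht hij => absurd ht.2 (Nat.ne_zero_of_lt hij))
    (fun t j ht => absurd ht.2 j.succ_ne_zero)
  rintro (_ | j)
  · rwa [timeSlice_prod_zero]
  · rw [timeSlice_prod_zero_succ]
    exact Set.ordConnected_empty

/-- The hybrid time domain of a single jump at the time `t`. -/
def jumpDomain (t : ℝ) : Set (ℝ × ℕ) := {t} ×ˢ Set.Iic 1

theorem timeSlice_jumpDomain_subset (t : ℝ) (j : ℕ) : timeSlice (jumpDomain t) j ⊆ {t} :=
  fun _ hs => hs.1

theorem isHybridTimeDomain_jumpDomain (t₀ : ℝ) : IsHybridTimeDomain t₀ (jumpDomain t₀) :=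
  isHybridTimeDomain_of_exists_jumpTime ⟨rfl, Set.mem_Iic.2 zero_le_one⟩ (fun _ ht => ht.1.ge)
    (fun j => (Set.subsingleton_singleton.anti
      (timeSlice_jumpDomain_subset t₀ j)).isPreconnected.ordConnected)
    (fun _ _ _ _ hs ht _ => (hs.1.trans ht.1.symm).le)
    (fun t j ht => ⟨t, ⟨ht.1, (Nat.le_succ j).trans ht.2⟩, ht⟩)

theorem isFinalPoint_jumpDomain (t : ℝ) : IsFinalPoint (jumpDomain t) t 1 :=
  ⟨⟨rfl, Set.self_mem_Iic⟩, fun hs => hs.1.le, fun hs => hs.2⟩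

end Domain

/-! ### Solutions as concatenations of flows -/

variable {p : Params} {ref : Reference}

section FlowSet

variable {t : ℝ} (hRd : ref.Rd t ∈ SO3)
include hRd

theorem mem_flowSet_iff {x : State} :
    x ∈ flowSet p ref t ↔
      modePotential p x.m (attErr p ref t x.R) - minPotential p (attErr p ref t x.R) ≤ p.δ := by
  rw [← Ψ_eq_modePotential hRd, ← ρ_eq_minPotential hRd, flowSet, Set.mem_ofPred_eq]

theorem mem_jumpSet_iff {x : State} :
    x ∈ jumpSet p ref t ↔
      p.δ ≤ modePotential p x.m (attErr p ref t x.R) - minPotential p (attErr p ref t x.R) := by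
  rw [← Ψ_eq_modePotential hRd, ← ρ_eq_minPotential hRd, jumpSet, Set.mem_ofPred_eq]

theorem mem_jumpMap_iff {R : Mat3} {m : Mode} :
    m ∈ jumpMap p ref t R ↔
      modePotential p m (attErr p ref t R) = minPotential p (attErr p ref t R) := by
  rw [← Ψ_eq_modePotential hRd, ← ρ_eq_minPotential hRd, jumpMap, Set.mem_ofPred_eq]

end FlowSet

theorem IsErrorFlow.continuousOn_potentialGap {K : Mat3} {c : ℝ → Vec3} {m : Mode} {S : Set ℝ}
    {P : ℝ → Mat3} {e : ℝ → Vec3} (h : IsErrorFlow p K c m S P e) :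
    ContinuousOn (fun t => modePotential p m (P t) - minPotential p (P t)) S := by
  have hc : ∀ m, ContinuousOn (fun t => modePotential p m (P t)) S := fun m t ht =>
    (hasDerivWithinAt_modePotential p m (h.kinematics t ht)).continuousWithinAt
  exact (hc m).sub (ContinuousOn.inf (hc .I) (ContinuousOn.inf (hc .II) (hc .III)))

section FlowOperations

variable {m : Mode} {S S' : Set ℝ} {y z : ℝ → State}

theorem IsFlow.mono (h : IsFlow p ref m S y) (hS : S' ⊆ S) : IsFlow p ref m S' y :=
  ⟨fun t ht => h.mode t (hS ht), fun t ht => h.mem_SO3 t (hS ht),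
    fun t ht => (h.kinematics t (hS ht)).mono hS, fun t ht => (h.dynamics t (hS ht)).mono hS⟩

theorem IsFlow.congr (h : IsFlow p ref m S y) (hyz : Set.EqOn z y S) : IsFlow p ref m S z := by
  refine ⟨fun t ht => hyz ht ▸ h.mode t ht, fun t ht => hyz ht ▸ h.mem_SO3 t ht,
    fun t ht i j => ?_, fun t ht => ?_⟩
  · rw [hyz ht]
    exact (h.kinematics t ht i j).congr (fun s hs => congrArg (fun y : State => y.R i j) (hyz hs))
      (congrArg (fun y : State => y.R i j) (hyz ht))
  · rw [hyz ht]
    exact (h.dynamics t ht).congr (fun s hs => congrArg State.Ω (hyz hs))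
      (congrArg State.Ω (hyz ht))

variable {T : ℝ} (hS : IsGreatest S T) (hS' : IsLeast S' T)
include hS hS'

theorem hasDerivWithinAt_union_of_isGreatest {F : Type*} [NormedAddCommGroup F] [NormedSpace ℝ F]
    {f : ℝ → F} {f' : F} {t : ℝ} (h : t ∈ S → HasDerivWithinAt f f' S t)
    (h' : t ∈ S' → HasDerivWithinAt f f' S' t) (ht : t ∈ S ∪ S') :
    HasDerivWithinAt f f' (S ∪ S') t := by
  have hclosure : closure S ⊆ Set.Iic T := closure_minimal hS.2 isClosed_Iic
  have hclosure' : closure S' ⊆ Set.Ici T := closure_minimal hS'.2 isClosed_Ici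
  refine HasDerivWithinAt.union ?_ ?_
  · by_cases hmem : t ∈ S
    · exact h hmem
    · refine HasFDerivWithinAt.of_notMem_closure fun hc => hmem ?_
      exact le_antisymm (hclosure hc) (hS'.2 (ht.resolve_left hmem)) ▸ hS.1
  · by_cases hmem : t ∈ S'
    · exact h' hmem
    · refine HasFDerivWithinAt.of_notMem_closure fun hc => hmem ?_
      exact le_antisymm (hclosure' hc) (hS.2 (ht.resolve_right hmem)) ▸ hS'.1

theorem IsFlow.union (h : IsFlow p ref m S y) (h' : IsFlow p ref m S' y) :
    IsFlow p ref m (S ∪ S') y where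
  mode t ht := ht.elim (h.mode t) (h'.mode t)
  mem_SO3 t ht := ht.elim (h.mem_SO3 t) (h'.mem_SO3 t)
  kinematics t ht i j := hasDerivWithinAt_union_of_isGreatest hS hS'
    (fun ht => h.kinematics t ht i j) (fun ht => h'.kinematics t ht i j) ht
  dynamics t ht := hasDerivWithinAt_union_of_isGreatest hS hS' (h.dynamics t) (h'.dynamics t) ht

end FlowOperations

/-- A flow of the closed loop that respects the flow set. As in the definition of solutions, only
interior times are constrained. -/
structure IsAdmissibleFlow (p : Params) (ref : Reference) (m : Mode) (S : Set ℝ) (y : ℝ → State) :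
    Prop extends IsFlow p ref m S y where
  mem_flowSet : ∀ t ∈ interior S, y t ∈ flowSet p ref t

section AdmissibleFlow

variable {m : Mode} {S S' : Set ℝ} {y z : ℝ → State}

theorem IsAdmissibleFlow.mono (h : IsAdmissibleFlow p ref m S y) (hS : S' ⊆ S) :
    IsAdmissibleFlow p ref m S' y :=
  ⟨h.toIsFlow.mono hS, fun t ht => h.mem_flowSet t (interior_mono hS ht)⟩

theorem IsAdmissibleFlow.congr (h : IsAdmissibleFlow p ref m S y) (hyz : Set.EqOn z y S) :
    IsAdmissibleFlow p ref m S z :=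
  ⟨h.toIsFlow.congr hyz, fun t ht => hyz (interior_subset ht) ▸ h.mem_flowSet t ht⟩

theorem isAdmissibleFlow_of_subset_singleton {t : ℝ} (hS : S ⊆ {t}) (hm : ∀ s ∈ S, (y s).m = m)
    (hR : ∀ s ∈ S, (y s).R ∈ SO3) : IsAdmissibleFlow p ref m S y := by
  have hsub : S.Subsingleton := Set.subsingleton_singleton.anti hS
  refine ⟨⟨hm, hR, fun _ _ _ _ => HasFDerivWithinAt.of_subsingleton hsub,
    fun _ _ => HasFDerivWithinAt.of_subsingleton hsub⟩, fun s hs => ?_⟩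
  exact absurd (interior_mono hS hs) (by simp)

variable (hb : p.Orthonormal) (hJ : p.J.PosDef) (href : ref.IsAdmissible)
include hb hJ href

theorem IsFlow.mem_flowSet_of_mem_closure (hS : S ⊆ Set.Ici 0) (h : IsFlow p ref m S y)
    {D : Set ℝ} (hDS : D ⊆ S) (hD : ∀ s ∈ D, y s ∈ flowSet p ref s) {t : ℝ} (htS : t ∈ S)
    (htD : t ∈ closure D) : y t ∈ flowSet p ref t := by
  have hgap := (h.isErrorFlow hb hJ href hS).continuousOn_potentialGap
  rw [mem_flowSet_iff (href.mem_SO3 t (hS htS)), h.mode t htS]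
  refine ContinuousWithinAt.closure_le htD ((hgap t htS).mono hDS) continuousWithinAt_const
    fun s hs => ?_
  simpa only [mem_flowSet_iff (href.mem_SO3 s (hS (hDS hs))), h.mode s (hDS hs)] using hD s hs

theorem IsAdmissibleFlow.union (h : IsAdmissibleFlow p ref m S y)
    (h' : IsAdmissibleFlow p ref m S' y) {T : ℝ} (hS : IsGreatest S T) (hS' : IsLeast S' T)
    (hnonneg : S ∪ S' ⊆ Set.Ici 0) : IsAdmissibleFlow p ref m (S ∪ S') y := by
  have hflow := h.toIsFlow.union hS hS' h'.toIsFlow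
  have hleft : interior (S ∪ S') ∩ Set.Iio T ⊆ interior S :=
    interior_maximal (fun s hs => (interior_subset hs.1).resolve_right fun hs' =>
      absurd (hS'.2 hs') (not_le.2 hs.2)) (isOpen_interior.inter isOpen_Iio)
  have hright : interior (S ∪ S') ∩ Set.Ioi T ⊆ interior S' :=
    interior_maximal (fun s hs => (interior_subset hs.1).resolve_left fun hs' =>
      absurd (hS.2 hs') (not_le.2 hs.2)) (isOpen_interior.inter isOpen_Ioi)
  refine ⟨hflow, fun t ht => ?_⟩
  -- At `T` itself, membership in the flow set follows by continuity.
  refine hflow.mem_flowSet_of_mem_closure hb hJ href hnonneg (D := interior (S ∪ S') ∩ {T}ᶜ)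
    (Set.inter_subset_left.trans interior_subset) (fun s hs => ?_) (interior_subset ht)
    ((dense_compl_singleton T).open_subset_closure_inter isOpen_interior ht)
  rcases lt_or_gt_of_ne hs.2 with hlt | hgt
  · exact h.mem_flowSet s (hleft ⟨hs.1, hlt⟩)
  · exact h'.mem_flowSet s (hright ⟨hs.1, hgt⟩)

end AdmissibleFlow

/-- A jump of the closed loop at the time `t`, from `y` to `y'`. -/
def IsJump (p : Params) (ref : Reference) (t : ℝ) (y y' : State) : Prop :=
  y ∈ jumpSet p ref t ∧ y'.R = y.R ∧ y'.Ω = y.Ω ∧ y'.m ∈ jumpMap p ref t y.R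

section Solution

variable {t₀ T : ℝ} {N : ℕ} {E E' : Set (ℝ × ℕ)} {x x' : ℝ → ℕ → State}

theorem IsSolution.trunc (h : IsSolution p ref t₀ E x) (hTN : (T, N) ∈ E) :
    IsSolution p ref t₀ (truncDomain E T N) x where
  domain := h.domain.trunc hTN
  mem_SO3 t j ht := h.mem_SO3 t j ht.1
  mode_const s t j hs ht := h.mode_const s t j hs.1 ht.1
  mem_flowSet t j ht := h.mem_flowSet t j (interior_mono (fun _ hs => hs.1) ht)
  kinematics t j ht a b := (h.kinematics t j ht.1 a b).mono fun _ hs => hs.1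
  dynamics t j ht :=
    (h.dynamics t j ht.1).imp fun _ hΩ => ⟨hΩ.1.mono fun _ hs => hs.1, hΩ.2⟩
  jump t j ht ht' := h.jump t j ht.1 ht'.1

theorem IsSolution.isJump (h : IsSolution p ref t₀ E x) {t : ℝ} {j : ℕ} (ht : (t, j) ∈ E)
    (ht' : (t, j + 1) ∈ E) : IsJump p ref t (x t j) (x t (j + 1)) :=
  h.jump t j ht ht'

variable (hJ : p.J.PosDef)
include hJ

theorem hasDerivWithinAt_angularAcc_iff {S : Set ℝ} {Ω : ℝ → Vec3} {t : ℝ} {y : State} :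
    HasDerivWithinAt Ω (angularAcc p ref t y) S t ↔ ∃ Ω', HasDerivWithinAt Ω Ω' S t ∧
      p.J *ᵥ Ω' + y.Ω ⨯₃ (p.J *ᵥ y.Ω) = control p ref t y := by
  simp only [← eq_sub_iff_add_eq, ← eq_inv_mulVec_iff_of_posDef hJ]
  exact ⟨fun h => ⟨_, h, rfl⟩, fun ⟨_, h, heq⟩ => h.congr_deriv heq⟩

theorem IsSolution.isAdmissibleFlow (h : IsSolution p ref t₀ E x) {s : ℝ} {j : ℕ}
    (hs : (s, j) ∈ E) : IsAdmissibleFlow p ref (x s j).m (timeSlice E j) (fun t => x t j) :=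
  ⟨⟨fun t ht => h.mode_const t s j ht hs, fun t ht => h.mem_SO3 t j ht,
    fun t ht => h.kinematics t j ht, fun t ht =>
      (hasDerivWithinAt_angularAcc_iff hJ).2 (h.dynamics t j ht)⟩, fun t ht => h.mem_flowSet t j ht⟩

theorem isSolution_of_isAdmissibleFlow (hE : IsHybridTimeDomain t₀ E)
    (hflow : ∀ j, ∃ m, IsAdmissibleFlow p ref m (timeSlice E j) (fun t => x t j))
    (hjump : ∀ t j, (t, j) ∈ E → (t, j + 1) ∈ E → IsJump p ref t (x t j) (x t (j + 1))) :
    IsSolution p ref t₀ E x := by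
  choose m hm using hflow
  exact ⟨hE, fun t j ht => (hm j).mem_SO3 t ht,
    fun s t j hs ht => ((hm j).mode s hs).trans ((hm j).mode t ht).symm,
    fun t j ht => (hm j).mem_flowSet t ht, fun t j ht => (hm j).kinematics t ht,
    fun t j ht => (hasDerivWithinAt_angularAcc_iff hJ).1 ((hm j).dynamics t ht), hjump⟩

theorem IsSolution.exists_isAdmissibleFlow (h : IsSolution p ref t₀ E x) (j : ℕ) :
    ∃ m, IsAdmissibleFlow p ref m (timeSlice E j) (fun t => x t j) := by
  rcases (timeSlice E j).eq_empty_or_nonempty with hempty | ⟨s, hs⟩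
  · exact ⟨.I, isAdmissibleFlow_of_subset_singleton (t := t₀) (by simp [hempty])
      (by simp [hempty]) (by simp [hempty])⟩
  · exact ⟨_, h.isAdmissibleFlow hJ hs⟩

theorem IsAdmissibleFlow.isSolution {m : Mode} {S : Set ℝ} {y : ℝ → State}
    (h : IsAdmissibleFlow p ref m S y) (hS : S.OrdConnected) (ht₀ : IsLeast S t₀) :
    IsSolution p ref t₀ (S ×ˢ {0}) (fun t _ => y t) := by
  refine isSolution_of_isAdmissibleFlow hJ (isHybridTimeDomain_prod_zero hS ht₀) (fun j => ⟨m, ?_⟩)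
    (fun t j _ ht => absurd ht.2 j.succ_ne_zero)
  exact h.mono fun t ht => ht.1

/-- The arc that jumps from `y` to `y'`. -/
def jumpArc (y y' : State) (_ : ℝ) (j : ℕ) : State := if j = 0 then y else y'

theorem IsJump.isSolution {y y' : State} (h : IsJump p ref t₀ y y') (hy : y.R ∈ SO3) :
    IsSolution p ref t₀ (jumpDomain t₀) (jumpArc y y') := by
  refine isSolution_of_isAdmissibleFlow hJ (isHybridTimeDomain_jumpDomain t₀)
    (fun j => ⟨(jumpArc y y' t₀ j).m, isAdmissibleFlow_of_subset_singleton
      (timeSlice_jumpDomain_subset t₀ j) (fun _ _ => rfl) fun _ _ => ?_⟩) fun t j ht ht' => ?_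
  · rcases j with _ | j
    · exact hy
    · exact h.2.1 ▸ hy
  · obtain rfl : t = t₀ := ht.1
    obtain rfl : j = 0 := Nat.le_zero.1 (Nat.le_of_succ_le_succ ht'.2)
    exact h

end Solution

section Append

variable {t₀ T : ℝ} {N : ℕ} {E E' : Set (ℝ × ℕ)} {x x' : ℝ → ℕ → State}

/-- Juxtaposition of an arc `x` on a domain `E` that ends after `N` jumps with an arc `x'`. -/
def appendArc (x : ℝ → ℕ → State) (E : Set (ℝ × ℕ)) (N : ℕ) (x' : ℝ → ℕ → State) (t : ℝ) (j : ℕ) :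
    State :=
  open Classical in if (t, j) ∈ E then x t j else x' t (j - N)

theorem appendArc_of_mem {t : ℝ} {j : ℕ} (h : (t, j) ∈ E) : appendArc x E N x' t j = x t j :=
  if_pos h

variable (hfin : IsFinalPoint E T N)
include hfin

theorem appendArc_add_of_mem (hE' : IsHybridTimeDomain T E') (hx : x' T 0 = x T N) {t : ℝ} {k : ℕ}
    (h : (t, k) ∈ E') : appendArc x E N x' t (N + k) = x' t k := by
  by_cases hmem : (t, N + k) ∈ E
  · obtain rfl : t = T := le_antisymm (hfin.time_le hmem) (hE'.initial_le h)
    obtain rfl : k = 0 := by simpa using hfin.jumps_le hmem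
    rw [appendArc_of_mem hmem, hx, add_zero]
  · rw [appendArc, if_neg hmem, Nat.add_sub_cancel_left]

theorem IsSolution.isJump_appendArc (h : IsSolution p ref t₀ E x) (h' : IsSolution p ref T E' x')
    (hx : x' T 0 = x T N) {t : ℝ} {j : ℕ} (ht : (t, j) ∈ appendDomain E N E')
    (ht' : (t, j + 1) ∈ appendDomain E N E') :
    IsJump p ref t (appendArc x E N x' t j) (appendArc x E N x' t (j + 1)) := by
  have hright := fun k (hk : (t, k) ∈ E') => appendArc_add_of_mem (x := x) hfin h'.domain hx hk
  rcases ht' with ht' | ⟨k, hk, ht'⟩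
  · rcases ht with ht | ⟨k, rfl, -⟩
    · rw [appendArc_of_mem ht, appendArc_of_mem ht']
      exact h.isJump ht ht'
    · exact absurd (hfin.jumps_le ht') (by omega)
  have htT : (t, j) ∈ E → t = T := fun ht =>
    le_antisymm (hfin.time_le ht) (h'.domain.initial_le ht')
  have hjump : ∀ k, j = N + k → (t, k) ∈ E' → (t, k + 1) ∈ E' →
      IsJump p ref t (appendArc x E N x' t j) (appendArc x E N x' t (j + 1)) := by
    rintro k rfl hk hk'
    rw [hright k hk, add_assoc, hright (k + 1) hk']
    exact h'.isJump hk hk'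
  rcases k with _ | k
  · obtain rfl : j + 1 = N := hk
    have ht : (t, j) ∈ E := ht.resolve_right fun ⟨k, hk, _⟩ => absurd hk (by omega)
    obtain rfl := htT ht
    rw [appendArc_of_mem ht, appendArc_of_mem hfin.mem]
    exact h.isJump ht hfin.mem
  · obtain rfl : j = N + k := Nat.succ_injective hk
    refine hjump k rfl ?_ ht'
    rcases ht with ht | ⟨i, hi, ht⟩
    · obtain rfl := htT ht
      obtain rfl : k = 0 := by simpa using hfin.jumps_le ht
      exact h'.domain.initial_mem
    · exact Nat.add_left_cancel hi ▸ ht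

theorem IsSolution.append (hb : p.Orthonormal) (hJ : p.J.PosDef) (href : ref.IsAdmissible)
    (ht₀ : 0 ≤ t₀) (h : IsSolution p ref t₀ E x) (h' : IsSolution p ref T E' x')
    (hx : x' T 0 = x T N) :
    IsSolution p ref t₀ (appendDomain E N E') (appendArc x E N x') := by
  have hright := fun t k (hk : (t, k) ∈ E') => appendArc_add_of_mem (x := x) hfin h'.domain hx hk
  refine isSolution_of_isAdmissibleFlow hJ (h.domain.append hfin h'.domain) (fun j => ?_)
    fun t j ht ht' => h.isJump_appendArc hfin h' hx ht ht'
  rcases lt_or_ge j N with hlt | hge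
  · rw [timeSlice_append_of_lt hlt]
    exact (h.exists_isAdmissibleFlow hJ j).imp fun m hm => hm.congr fun t ht => appendArc_of_mem ht
  obtain ⟨_ | k, rfl⟩ := Nat.exists_eq_add_of_le hge
  · rw [timeSlice_append_self]
    have hgreatest : IsGreatest (timeSlice E j) T := ⟨hfin.mem, fun _ => hfin.time_le⟩
    have hleast : IsLeast (timeSlice E' 0) T :=
      ⟨h'.domain.initial_mem, fun _ => h'.domain.initial_le⟩
    refine ⟨_, ((h.isAdmissibleFlow hJ hfin.mem).congr fun t ht => appendArc_of_mem ht).union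
      hb hJ href (hx ▸ (h'.isAdmissibleFlow hJ h'.domain.initial_mem).congr fun t ht =>
        hright t 0 ht) hgreatest hleast ?_⟩
    rintro t (ht | ht)
    · exact ht₀.trans (h.domain.initial_le ht)
    · exact ht₀.trans ((h.domain.initial_le hfin.mem).trans (h'.domain.initial_le ht))
  · rw [timeSlice_append_add_succ hfin]
    exact (h'.exists_isAdmissibleFlow hJ (k + 1)).imp fun m hm => hm.congr fun t ht =>
      hright t (k + 1) ht

end Append

/-! ### Dissipation along solutions -/

theorem IsSolution.dissipation {t₀ : ℝ} {E : Set (ℝ × ℕ)} {x : ℝ → ℕ → State}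
    (h : IsSolution p ref t₀ E x) {F : ℝ → State → ℝ} {d : ℝ}
    (hflow : ∀ j a b, a ≤ b → Set.Icc a b ⊆ timeSlice E j → F b (x b j) ≤ F a (x a j))
    (hjump : ∀ t j, (t, j) ∈ E → (t, j + 1) ∈ E → F t (x t (j + 1)) ≤ F t (x t j) - d)
    {s T : ℝ} {i N : ℕ} (hs : (s, i) ∈ E) (hT : (T, N) ∈ E) (hsT : s ≤ T) (hiN : i ≤ N) :
    F T (x T N) + ((N : ℝ) - i) * d ≤ F s (x s i) := by
  induction N, hiN using Nat.le_induction generalizing T with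
  | base => simpa using hflow i s T hsT ((h.domain.ordConnected_timeSlice i).out hs hT)
  | succ k hik ih =>
    obtain ⟨r, hr, hr'⟩ := h.domain.exists_jumpTime hT
    have hsr : s ≤ r := h.domain.ordered s i r (k + 1) hs hr' (Nat.lt_succ_of_le hik)
    have hrT : r ≤ T := h.domain.ordered r k T (k + 1) hr hT k.lt_succ_self
    have hlast := hflow (k + 1) r T hrT ((h.domain.ordConnected_timeSlice (k + 1)).out hr' hT)
    push_cast
    linarith [ih hr hsr, hjump r k hr hr']

/-- The error energy of a state. -/
def stateEnergy (p : Params) (ref : Reference) (t : ℝ) (x : State) : ℝ :=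
  energy p (frameInertia p) x.m (attErr p ref t x.R) (velErr p ref t x)

theorem velErr_congr {t : ℝ} {x y : State} (hR : y.R = x.R) (hΩ : y.Ω = x.Ω) :
    velErr p ref t y = velErr p ref t x := by
  simp only [velErr, eΩ, hR, hΩ]

section Jump

variable {t : ℝ} {y y' : State}

theorem IsJump.trackingError_eq (h : IsJump p ref t y y') :
    trackingError ref t y' = trackingError ref t y := by
  simp only [trackingError, h.2.1, h.2.2.1]

variable (hRd : ref.Rd t ∈ SO3)
include hRd

theorem exists_isJump (hy : y ∈ jumpSet p ref t) : ∃ y', IsJump p ref t y y' :=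
  have ⟨m, hm⟩ := exists_modePotential_eq_minPotential p (attErr p ref t y.R)
  ⟨⟨y.R, y.Ω, m⟩, hy, rfl, rfl, (mem_jumpMap_iff hRd).2 hm⟩

theorem IsJump.modePotential_le (h : IsJump p ref t y y') :
    modePotential p y'.m (attErr p ref t y.R) ≤
      modePotential p y.m (attErr p ref t y.R) - p.δ := by
  linarith [(mem_jumpSet_iff hRd).1 h.1, (mem_jumpMap_iff hRd).1 h.2.2.2]

theorem IsJump.stateEnergy_le (h : IsJump p ref t y y') :
    stateEnergy p ref t y' ≤ stateEnergy p ref t y - p.δ := by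
  simp only [stateEnergy, energy, velErr_congr h.2.1 h.2.2.1, h.2.1]
  linarith [h.modePotential_le hRd]

theorem IsJump.mem_flowSet (hδ : 0 ≤ p.δ) (h : IsJump p ref t y y') : y' ∈ flowSet p ref t := by
  rwa [mem_flowSet_iff hRd, h.2.1, (mem_jumpMap_iff hRd).1 h.2.2.2, sub_self]

end Jump

section Energy

variable (hp : p.Tuned) (hb : p.Orthonormal) (hJ : p.J.PosDef)
include hp hb hJ

theorem stateEnergy_nonneg {t : ℝ} (hRd : ref.Rd t ∈ SO3) {x : State} (hR : x.R ∈ SO3) :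
    0 ≤ stateEnergy p ref t x :=
  energy_nonneg hp (frameInertia_posDef hb hJ) x.m (attErr_mem_SO3 hRd hb hR) _

variable (href : ref.IsAdmissible)
include href

theorem IsFlow.stateEnergy_le {m : Mode} {S : Set ℝ} (hS : S ⊆ Set.Ici 0) (hconv : Convex ℝ S)
    {y : ℝ → State} (h : IsFlow p ref m S y) {a b : ℝ} (ha : a ∈ S) (hbS : b ∈ S) (hab : a ≤ b) :
    stateEnergy p ref b (y b) ≤ stateEnergy p ref a (y a) := by
  have henergy := (h.isErrorFlow hb hJ href hS).energy_antitoneOn hp.kΩ_pos.le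
    (frameInertia_posDef hb hJ) hconv ha hbS hab
  simpa only [stateEnergy, h.mode a ha, h.mode b hbS] using henergy

theorem IsSolution.jumps_mul_le {t₀ : ℝ} (ht₀ : 0 ≤ t₀) {E : Set (ℝ × ℕ)} {x : ℝ → ℕ → State}
    (h : IsSolution p ref t₀ E x) {T : ℝ} {N : ℕ} (hT : (T, N) ∈ E) :
    N * p.δ ≤ stateEnergy p ref t₀ (x t₀ 0) := by
  have hpos : ∀ {t j}, (t, j) ∈ E → 0 ≤ t := fun ht => ht₀.trans (h.domain.initial_le ht)
  have hdissipation := h.dissipation (F := stateEnergy p ref) (d := p.δ)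
    (fun j a b hab hsub => ((h.isAdmissibleFlow hJ (hsub (Set.left_mem_Icc.2 hab))).toIsFlow.mono
      hsub).stateEnergy_le hp hb hJ href (fun t ht => hpos (hsub ht)) (convex_Icc a b)
        (Set.left_mem_Icc.2 hab) (Set.right_mem_Icc.2 hab) hab)
    (fun t j ht ht' => (h.isJump ht ht').stateEnergy_le (href.mem_SO3 t (hpos ht)))
    h.domain.initial_mem hT (h.domain.initial_le hT) N.zero_le
  rw [Nat.cast_zero, sub_zero] at hdissipation
  linarith [stateEnergy_nonneg hp hb hJ (href.mem_SO3 T (hpos hT)) (h.mem_SO3 T N hT)]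

end Energy

/-! ### Existence of complete solutions -/

section Flow

variable (hb : p.Orthonormal) (href : ref.IsAdmissible)
include hb href

theorem Reference.IsAdmissible.exists_refVel_bound :
    ∃ B, 0 ≤ B ∧ ∀ t, 0 ≤ t → eucNorm (refVel p ref t) ≤ B := by
  obtain ⟨B, hB⟩ := href.bounded
  refine ⟨B, (eucNorm_nonneg _).trans (hB 0 le_rfl), fun t ht => ?_⟩
  rw [eucNorm_refVel (href.mem_SO3 t ht) hb]
  exact hB t ht

variable (hp : p.Tuned) (hJ : p.J.PosDef)
include hp hJ

theorem exists_isFlow {t₁ : ℝ} (ht₁ : 0 ≤ t₁) {x₁ : State} (hx₁ : x₁.R ∈ SO3) :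
    ∃ y, y t₁ = x₁ ∧ IsFlow p ref x₁.m (Set.Ici t₁) y := by
  have hsub : Set.Ici t₁ ⊆ Set.Ici 0 := Set.Ici_subset_Ici.2 ht₁
  obtain ⟨B, -, hB⟩ := href.exists_refVel_bound hb
  have hRd := href.mem_SO3 t₁ ht₁
  obtain ⟨P, e, hP, he, hflow⟩ := exists_isErrorFlow hp (frameInertia_posDef hb hJ)
    ((href.continuousOn_refVel p).mono hsub) (fun t ht => hB t (hsub ht)) x₁.m
    (attErr_mem_SO3 hRd hb hx₁) (velErr p ref t₁ x₁)
  refine ⟨_, ?_, hflow.isFlow hb hJ href hsub⟩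
  rw [hP, he, errState_attErr_velErr hb hRd]

theorem IsFlow.eq_right {m : Mode} {a b : ℝ} (ha : 0 ≤ a) (hab : a ≤ b) {y z : ℝ → State}
    (hy : IsFlow p ref m (Set.Icc a b) y) (hz : IsFlow p ref m (Set.Icc a b) z)
    (hyz : y a = z a) : y b = z b := by
  obtain ⟨B, -, hB⟩ := href.exists_refVel_bound hb
  have hS : Set.Icc a b ⊆ Set.Ici 0 := fun t ht => ha.trans ht.1
  have hbS : b ∈ Set.Icc a b := Set.right_mem_Icc.2 hab
  obtain ⟨hP, he⟩ := (hy.isErrorFlow hb hJ href hS).eq_right hp (frameInertia_posDef hb hJ) hab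
    (fun t ht => hB t (hS ht)) (hz.isErrorFlow hb hJ href hS)
    (by rw [hyz]) (by rw [hyz])
  have hRd := href.mem_SO3 b (hS hbS)
  rw [← errState_attErr_velErr hb hRd (y b), ← errState_attErr_velErr hb hRd (z b), hP, he,
    hy.mode b hbS, hz.mode b hbS]

end Flow

theorem forall_le_or_exists_first_ge {g : ℝ → ℝ} {a d : ℝ} (hg : ContinuousOn g (Set.Ici a)) :
    (∀ t ∈ Set.Ici a, g t ≤ d) ∨ ∃ T ≥ a, d ≤ g T ∧ ∀ t ∈ Set.Ico a T, g t ≤ d := by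
  rcases (Set.Ici a ∩ g ⁻¹' Set.Ici d).eq_empty_or_nonempty with hempty | hne
  · exact .inl fun t ht => (not_le.1 fun hgt => hempty.subset ⟨ht, hgt⟩).le
  · have hbdd : BddBelow (Set.Ici a ∩ g ⁻¹' Set.Ici d) := ⟨a, fun _ ht => ht.1⟩
    obtain ⟨hT, hgT⟩ := (hg.preimage_isClosed_of_isClosed isClosed_Ici isClosed_Ici).csInf_mem
      hne hbdd
    exact .inr ⟨_, hT, hgT, fun t ht =>
      (not_le.1 fun hgt => notMem_of_lt_csInf ht.2 hbdd ⟨ht.1, hgt⟩).le⟩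

theorem TimeUnbounded.append {E' : Set (ℝ × ℕ)} (h : TimeUnbounded E') (E : Set (ℝ × ℕ)) (N : ℕ) :
    TimeUnbounded (appendDomain E N E') := fun T =>
  have ⟨t, j, hmem, hle⟩ := h T
  ⟨t, N + j, .inr ⟨j, rfl, hmem⟩, hle⟩

theorem timeUnbounded_Ici_prod_zero (a : ℝ) : TimeUnbounded (Set.Ici a ×ˢ {0}) := fun T =>
  ⟨max a T, 0, ⟨le_max_left a T, rfl⟩, le_max_right a T⟩

/-- From the state `x₁` at the time `t₁` there is a solution for all future times. -/
def HasCompleteSolution (p : Params) (ref : Reference) (t₁ : ℝ) (x₁ : State) : Prop :=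
  ∃ E x, IsSolution p ref t₁ E x ∧ x t₁ 0 = x₁ ∧ TimeUnbounded E

section Complete

variable (hb : p.Orthonormal) (hJ : p.J.PosDef) (href : ref.IsAdmissible)
include hb hJ href

theorem IsFlow.forall_mem_flowSet_or_exists_mem_jumpSet {m : Mode} {t₁ : ℝ} (ht₁ : 0 ≤ t₁)
    {y : ℝ → State} (h : IsFlow p ref m (Set.Ici t₁) y) :
    (∀ t ∈ Set.Ici t₁, y t ∈ flowSet p ref t) ∨
      ∃ T ≥ t₁, y T ∈ jumpSet p ref T ∧ ∀ t ∈ Set.Ico t₁ T, y t ∈ flowSet p ref t := by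
  have hRd : ∀ t ∈ Set.Ici t₁, ref.Rd t ∈ SO3 := fun t ht => href.mem_SO3 t (ht₁.trans ht)
  have hflowSet : ∀ t ∈ Set.Ici t₁, modePotential p m (attErr p ref t (y t).R) -
      minPotential p (attErr p ref t (y t).R) ≤ p.δ → y t ∈ flowSet p ref t := fun t ht hgap => by
    rwa [mem_flowSet_iff (hRd t ht), h.mode t ht]
  rcases forall_le_or_exists_first_ge (d := p.δ) (h.isErrorFlow hb hJ href
    (Set.Ici_subset_Ici.2 ht₁)).continuousOn_potentialGap with hall | ⟨T, hT, hgap, hbefore⟩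
  · exact .inl fun t ht => hflowSet t ht (hall t ht)
  · refine .inr ⟨T, hT, ?_, fun t ht => hflowSet t ht.1 (hbefore t ht)⟩
    rwa [mem_jumpSet_iff (hRd T hT), h.mode T hT]

section Prepend

variable {t₀ : ℝ} (ht₀ : 0 ≤ t₀)
include ht₀

theorem IsSolution.exists_timeUnbounded_extension {E : Set (ℝ × ℕ)} {x : ℝ → ℕ → State}
    (h : IsSolution p ref t₀ E x) {T : ℝ} {N : ℕ} (hfin : IsFinalPoint E T N)
    (hT : HasCompleteSolution p ref T (x T N)) : ∃ E' x', IsSolution p ref t₀ E' x' ∧ E ⊆ E' ∧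
      (∀ t j, (t, j) ∈ E → x' t j = x t j) ∧ TimeUnbounded E' := by
  obtain ⟨E', x', h', hx, hunbounded⟩ := hT
  exact ⟨_, _, h.append hfin hb hJ href ht₀ h' hx, Set.subset_union_left,
    fun t j ht => appendArc_of_mem ht, hunbounded.append E N⟩

theorem IsSolution.hasCompleteSolution {E : Set (ℝ × ℕ)} {x : ℝ → ℕ → State}
    (h : IsSolution p ref t₀ E x) {T : ℝ} {N : ℕ} (hfin : IsFinalPoint E T N)
    (hT : HasCompleteSolution p ref T (x T N)) : HasCompleteSolution p ref t₀ (x t₀ 0) := by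
  obtain ⟨E', x', h', -, hx, hunbounded⟩ :=
    h.exists_timeUnbounded_extension hb hJ href ht₀ hfin hT
  exact ⟨E', x', h', hx t₀ 0 h.domain.initial_mem, hunbounded⟩

theorem IsJump.hasCompleteSolution {y y' : State} (h : IsJump p ref t₀ y y') (hy : y.R ∈ SO3)
    (hy' : HasCompleteSolution p ref t₀ y') : HasCompleteSolution p ref t₀ y :=
  (h.isSolution hJ hy).hasCompleteSolution hb hJ href ht₀ (isFinalPoint_jumpDomain t₀) hy'

theorem IsAdmissibleFlow.hasCompleteSolution {m : Mode} {T : ℝ} (hT : t₀ ≤ T) {y : ℝ → State}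
    (h : IsAdmissibleFlow p ref m (Set.Icc t₀ T) y) (hyT : HasCompleteSolution p ref T (y T)) :
    HasCompleteSolution p ref t₀ (y t₀) :=
  (h.isSolution hJ Set.ordConnected_Icc (isLeast_Icc hT)).hasCompleteSolution hb hJ href ht₀
    ⟨⟨Set.right_mem_Icc.2 hT, rfl⟩, fun ht => ht.1.2, fun ht => (Set.mem_singleton_iff.1 ht.2).le⟩
    hyT

end Prepend

variable (hp : p.Tuned)
include hp

/-- Flow until the jump set is reached, then jump: this costs the energy `δ`, and the energy is
nonnegative. -/
theorem hasCompleteSolution_of_stateEnergy_lt (n : ℕ) {t₁ : ℝ} (ht₁ : 0 ≤ t₁) {x₁ : State}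
    (hx₁ : x₁.R ∈ SO3) (hn : stateEnergy p ref t₁ x₁ < n * p.δ) :
    HasCompleteSolution p ref t₁ x₁ := by
  induction n generalizing t₁ x₁ with
  | zero =>
    rw [Nat.cast_zero, zero_mul] at hn
    exact absurd (stateEnergy_nonneg hp hb hJ (href.mem_SO3 t₁ ht₁) hx₁) hn.not_ge
  | succ n ih =>
    obtain ⟨y, rfl, hy⟩ := exists_isFlow hb href hp hJ ht₁ hx₁
    rcases hy.forall_mem_flowSet_or_exists_mem_jumpSet hb hJ href ht₁ with
      hall | ⟨T, hT, hjumpSet, hbefore⟩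
    · have hflow : IsAdmissibleFlow p ref (y t₁).m (Set.Ici t₁) y :=
        ⟨hy, fun t ht => hall t (interior_subset ht)⟩
      exact ⟨_, _, hflow.isSolution hJ Set.ordConnected_Ici isLeast_Ici, rfl,
        timeUnbounded_Ici_prod_zero t₁⟩
    · have hT₀ : 0 ≤ T := ht₁.trans hT
      obtain ⟨y', hjump⟩ := exists_isJump (href.mem_SO3 T hT₀) hjumpSet
      have hflow : IsAdmissibleFlow p ref (y t₁).m (Set.Icc t₁ T) y :=
        ⟨hy.mono Set.Icc_subset_Ici_self, fun t ht =>
          hbefore t (Set.Ioo_subset_Ico_self (interior_Icc.subset ht))⟩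
      refine hflow.hasCompleteSolution hb hJ href ht₁ hT
        (hjump.hasCompleteSolution hb hJ href hT₀ (hy.mem_SO3 T hT)
          (ih hT₀ (hjump.2.1 ▸ hy.mem_SO3 T hT) ?_))
      push_cast at hn
      linarith [hjump.stateEnergy_le (href.mem_SO3 T hT₀), hy.stateEnergy_le hp hb hJ href
        (Set.Ici_subset_Ici.2 ht₁) (convex_Ici t₁) Set.self_mem_Ici hT hT]

theorem hasCompleteSolution {t₁ : ℝ} (ht₁ : 0 ≤ t₁) {x₁ : State} (hx₁ : x₁.R ∈ SO3) :
    HasCompleteSolution p ref t₁ x₁ := by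
  obtain ⟨n, hn⟩ := exists_nat_gt (stateEnergy p ref t₁ x₁ / p.δ)
  exact hasCompleteSolution_of_stateEnergy_lt hb hJ href hp n ht₁ hx₁
    ((div_lt_iff₀ hp.δ_pos).1 hn)

end Complete

/-! ### Maximal solutions -/

section LastInterval

variable {t₀ r T : ℝ} {N : ℕ} {E : Set (ℝ × ℕ)}

theorem IsHybridTimeDomain.isFinalPoint (h : IsHybridTimeDomain t₀ E) (hTN : (T, N) ∈ E)
    (hN : ∀ {t j}, (t, j) ∈ E → j ≤ N) (hT : T ∈ upperBounds (timeSlice E N)) :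
    IsFinalPoint E T N := by
  refine ⟨hTN, fun {t j} ht => ?_, hN⟩
  rcases (hN ht).lt_or_eq with hlt | rfl
  · exact h.ordered t j T N ht hTN hlt
  · exact hT ht

theorem IsHybridTimeDomain.mem_truncDomain_or (h : IsHybridTimeDomain t₀ E) (hr : (r, N) ∈ E)
    (hN : ∀ {t j}, (t, j) ∈ E → j ≤ N) {t : ℝ} {j : ℕ} (ht : (t, j) ∈ E) :
    (t, j) ∈ truncDomain E r N ∨ j = N ∧ r ≤ t := by
  rcases (hN ht).lt_or_eq with hlt | rfl
  · exact .inl ⟨ht, h.ordered t j r N ht hr hlt, hlt.le⟩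
  · exact (le_total t r).imp (fun hle => ⟨ht, hle, le_rfl⟩) fun hle => ⟨rfl, hle⟩

end LastInterval

section Maximal

variable {t₀ : ℝ} {E : Set (ℝ × ℕ)} {x : ℝ → ℕ → State} (hp : p.Tuned) (hb : p.Orthonormal)
  (hJ : p.J.PosDef) (href : ref.IsAdmissible) (ht₀ : 0 ≤ t₀)
include hp hb hJ href ht₀

theorem IsSolution.exists_last_interval (h : IsSolution p ref t₀ E x) :
    ∃ N, (timeSlice E N).Nonempty ∧ ∀ {t j}, (t, j) ∈ E → j ≤ N := by
  obtain ⟨n, hn⟩ := exists_nat_ge (stateEnergy p ref t₀ (x t₀ 0) / p.δ)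
  rw [div_le_iff₀ hp.δ_pos] at hn
  have hbdd : BddAbove {j | (timeSlice E j).Nonempty} := by
    refine ⟨n, ?_⟩
    rintro j ⟨t, ht⟩
    exact_mod_cast le_of_mul_le_mul_right
      ((h.jumps_mul_le hp hb hJ href ht₀ ht).trans hn) hp.δ_pos
  have hne : {j | (timeSlice E j).Nonempty}.Nonempty := ⟨0, t₀, h.domain.initial_mem⟩
  exact ⟨_, Nat.sSup_mem hne hbdd, fun ht => le_csSup hbdd ⟨_, ht⟩⟩

theorem IsMaximalSolution.timeUnbounded_of_isFinalPoint (h : IsMaximalSolution p ref t₀ E x)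
    {T : ℝ} {N : ℕ} (hfin : IsFinalPoint E T N) : TimeUnbounded E := by
  obtain ⟨E', x', h', hsub, hagree, hunbounded⟩ :=
    h.1.exists_timeUnbounded_extension hb hJ href ht₀ hfin (hasCompleteSolution hb hJ href hp
      (ht₀.trans (h.1.domain.initial_le hfin.mem)) (h.1.mem_SO3 T N hfin.mem))
  exact h.2 E' x' h' hsub hagree ▸ hunbounded

theorem IsSolution.exists_isAdmissibleFlow_Icc (h : IsSolution p ref t₀ E x) {r T : ℝ} {N : ℕ}
    (hr : (r, N) ∈ E) (hT : IsLUB (timeSlice E N) T) :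
    ∃ y, IsAdmissibleFlow p ref (x r N).m (Set.Icc r T) y ∧
      ∀ t ∈ timeSlice E N, r ≤ t → y t = x t N := by
  have hr₀ : 0 ≤ r := ht₀.trans (h.domain.initial_le hr)
  have hconn := (h.domain.ordConnected_timeSlice N).out hr
  obtain ⟨y, hyr, hy⟩ := exists_isFlow hb href hp hJ hr₀ (h.mem_SO3 r N hr)
  have hagree : ∀ t ∈ timeSlice E N, r ≤ t → y t = x t N := fun t ht hrt =>
    (hy.mono Set.Icc_subset_Ici_self).eq_right hb href hp hJ hr₀ hrt
      ((h.isAdmissibleFlow hJ hr).toIsFlow.mono (hconn ht)) hyr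
  have hsub : Set.Ioo r T ⊆ timeSlice E N := fun t ht => by
    obtain ⟨s, hs, hts⟩ := (lt_isLUB_iff hT).1 ht.2
    exact hconn hs ⟨ht.1.le, hts.le⟩
  refine ⟨y, ⟨hy.mono Set.Icc_subset_Ici_self, fun t ht => ?_⟩, hagree⟩
  rw [interior_Icc] at ht
  rw [hagree t (hsub ht) ht.1.le]
  exact h.mem_flowSet t N (interior_maximal hsub isOpen_Ioo ht)

theorem IsMaximalSolution.mem_of_isLUB (h : IsMaximalSolution p ref t₀ E x) {T : ℝ} {N : ℕ}
    (hN : ∀ {t j}, (t, j) ∈ E → j ≤ N) (hne : (timeSlice E N).Nonempty)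
    (hT : IsLUB (timeSlice E N) T) : (T, N) ∈ E := by
  obtain ⟨r, hr⟩ := hne
  have hrT : r ≤ T := hT.1 hr
  obtain ⟨y, hy, hagree⟩ := h.1.exists_isAdmissibleFlow_Icc hp hb hJ href ht₀ hr hT
  have hflow := hy.isSolution hJ Set.ordConnected_Icc (isLeast_Icc hrT)
  have hfin := isFinalPoint_truncDomain hr
  have hext := (h.1.trunc hr).append hfin hb hJ href ht₀ hflow (hagree r hr le_rfl)
  have htail : ∀ {t}, (t, N) ∈ E → r ≤ t → (t, 0) ∈ Set.Icc r T ×ˢ ({0} : Set ℕ) :=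
    fun ht hrt => ⟨⟨hrt, hT.1 ht⟩, rfl⟩
  have hE := h.2 _ _ hext
    (fun ⟨t, j⟩ ht => (h.1.domain.mem_truncDomain_or hr hN ht).imp_right fun ⟨hj, hrt⟩ =>
      ⟨0, hj, htail (hj ▸ ht) hrt⟩)
    (fun t j ht => by
      rcases h.1.domain.mem_truncDomain_or hr hN ht with htrunc | ⟨rfl, hrt⟩
      · exact appendArc_of_mem htrunc
      · exact (appendArc_add_of_mem hfin hflow.domain (hagree r hr le_rfl) (htail ht hrt)).trans
          (hagree t ht hrt))
  exact hE.subset (.inr ⟨0, rfl, ⟨⟨hrT, le_rfl⟩, rfl⟩⟩)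

theorem IsMaximalSolution.timeUnbounded (h : IsMaximalSolution p ref t₀ E x) :
    TimeUnbounded E := by
  obtain ⟨N, hne, hN⟩ := h.1.exists_last_interval hp hb hJ href ht₀
  by_contra hbounded
  obtain ⟨b, hb'⟩ : ∃ b, ∀ t j, (t, j) ∈ E → t < b := by
    simpa only [TimeUnbounded, not_forall, not_exists, not_and, not_le] using hbounded
  have hT := isLUB_csSup hne ⟨b, fun t ht => (hb' t N ht).le⟩
  have hTN := h.mem_of_isLUB hp hb hJ href ht₀ hN hne hT
  exact hbounded (h.timeUnbounded_of_isFinalPoint hp hb hJ href ht₀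
    (h.1.domain.isFinalPoint hTN hN hT.1))

end Maximal

/-! ### Exponential decay -/

theorem antitoneOn_exp_mul_of_hasDerivWithinAt_le {f f' : ℝ → ℝ} {r : ℝ} {S : Set ℝ}
    (hS : Convex ℝ S) (hf : ∀ t ∈ S, HasDerivWithinAt f (f' t) S t)
    (hle : ∀ t ∈ interior S, f' t ≤ -(r * f t)) :
    AntitoneOn (fun t => Real.exp (r * t) * f t) S := by
  have hderiv : ∀ t ∈ S, HasDerivWithinAt (fun t => Real.exp (r * t) * f t)
      (Real.exp (r * t) * (r * f t + f' t)) S t := fun t ht => by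
    have hexp := ((hasDerivAt_id t).const_mul r).exp.hasDerivWithinAt (s := S)
    exact (hexp.mul (hf t ht)).congr_deriv (by simp only [id_eq]; ring)
  exact antitoneOn_of_hasDerivWithinAt_nonpos hS (fun t ht => (hderiv t ht).continuousWithinAt)
    (fun t ht => (hderiv t (interior_subset ht)).mono interior_subset) fun t ht =>
      mul_nonpos_of_nonneg_of_nonpos (Real.exp_pos _).le (by linarith [hle t ht])

/-- The Lyapunov function of the closed loop, as a function of the state. -/
def stateLyapunov (p : Params) (ref : Reference) (κ t : ℝ) (x : State) : ℝ :=
  lyapunov p (frameInertia p) κ x.m (attErr p ref t x.R) (velErr p ref t x)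

section Decay

variable (hb : p.Orthonormal) (hJ : p.J.PosDef) (href : ref.IsAdmissible) {B κ r : ℝ}
  (hw : IsLyapunovWeight p (frameInertia p) B κ r)

include hw hb in
theorem IsJump.stateLyapunov_le {t : ℝ} (hRd : ref.Rd t ∈ SO3) {y y' : State}
    (h : IsJump p ref t y y') (hy : y.R ∈ SO3) :
    stateLyapunov p ref κ t y' ≤ stateLyapunov p ref κ t y := by
  simpa only [stateLyapunov, velErr_congr h.2.1 h.2.2.1, h.2.1] using
    hw.jump y.m y'.m _ (attErr_mem_SO3 hRd hb hy) (velErr p ref t y) (h.modePotential_le hRd)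

variable (hB : ∀ t, 0 ≤ t → eucNorm (refVel p ref t) ≤ B)
include hb hJ href hw hB

theorem IsAdmissibleFlow.exp_mul_stateLyapunov_le {m : Mode} {S : Set ℝ} (hS : S ⊆ Set.Ici 0)
    (hconv : Convex ℝ S) {y : ℝ → State} (h : IsAdmissibleFlow p ref m S y) {a b : ℝ}
    (ha : a ∈ S) (hbS : b ∈ S) (hab : a ≤ b) :
    Real.exp (r * b) * stateLyapunov p ref κ b (y b) ≤
      Real.exp (r * a) * stateLyapunov p ref κ a (y a) := by
  have herr := h.toIsFlow.isErrorFlow hb hJ href hS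
  have hanti := antitoneOn_exp_mul_of_hasDerivWithinAt_le (r := r) hconv
    (fun t ht => hasDerivWithinAt_lyapunov p (frameInertia_posDef hb hJ) κ m
      (herr.kinematics t ht) (herr.dynamics t ht)) (fun t ht => by
        have htS := interior_subset ht
        have hflow := h.mem_flowSet t ht
        rw [mem_flowSet_iff (href.mem_SO3 t (hS htS)), h.mode t htS] at hflow
        exact hw.decay m _ (herr.mem_SO3 t htS) _ _ (hB t (hS htS)) hflow)
  simpa only [stateLyapunov, h.mode a ha, h.mode b hbS] using hanti ha hbS hab

theorem IsSolution.exp_mul_stateLyapunov_le {t₀ : ℝ} (ht₀ : 0 ≤ t₀) {E : Set (ℝ × ℕ)}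
    {x : ℝ → ℕ → State} (h : IsSolution p ref t₀ E x) {s T : ℝ} {i N : ℕ} (hs : (s, i) ∈ E)
    (hT : (T, N) ∈ E) (hsT : s ≤ T) (hiN : i ≤ N) :
    Real.exp (r * T) * stateLyapunov p ref κ T (x T N) ≤
      Real.exp (r * s) * stateLyapunov p ref κ s (x s i) := by
  have hpos : ∀ {t j}, (t, j) ∈ E → 0 ≤ t := fun ht => ht₀.trans (h.domain.initial_le ht)
  have hdissipation := h.dissipation (d := 0)
    (F := fun t y => Real.exp (r * t) * stateLyapunov p ref κ t y)
    (fun j a b hab hsub => ((h.isAdmissibleFlow hJ (hsub (Set.left_mem_Icc.2 hab))).mono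
      hsub).exp_mul_stateLyapunov_le hb hJ href hw hB (fun t ht => hpos (hsub ht))
        (convex_Icc a b) (Set.left_mem_Icc.2 hab) (Set.right_mem_Icc.2 hab) hab)
    (fun t j ht ht' => by
      rw [sub_zero]
      exact mul_le_mul_of_nonneg_left ((h.isJump ht ht').stateLyapunov_le hb hw
        (href.mem_SO3 t (hpos ht)) (h.mem_SO3 t j ht)) (Real.exp_pos _).le)
    hs hT hsT hiN
  rwa [mul_zero, add_zero] at hdissipation

end Decay

section TrackingError

theorem frobNorm_nonneg (A : Mat3) : 0 ≤ frobNorm A :=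
  Real.sqrt_nonneg _

theorem trackingError_nonneg (ref : Reference) (t : ℝ) (x : State) : 0 ≤ trackingError ref t x :=
  add_nonneg (frobNorm_nonneg _) (eucNorm_nonneg _)

variable (hp : p.Tuned) (hb : p.Orthonormal)
include hp hb

theorem exists_trackingError_sq_le (hJ : p.J.PosDef) :
    ∃ A > 0, ∀ t, ref.Rd t ∈ SO3 → ∀ x : State, x.R ∈ SO3 →
      trackingError ref t x ^ 2 ≤ A * stateEnergy p ref t x := by
  have hK := frameInertia_posDef hb hJ
  obtain ⟨l, hl, hlK⟩ := exists_mul_dotProduct_self_le_of_posDef hK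
  have hk : 0 < min p.k₁ p.k₂ := lt_min hp.k₁_pos hp.k₂_pos
  refine ⟨24 / min p.k₁ p.k₂ + 4 / l, by positivity, fun t hRd x hR => ?_⟩
  have hP := attErr_mem_SO3 hRd hb hR
  have hatt : frobNorm (x.R - ref.Rd t) ^ 2 ≤
      12 / min p.k₁ p.k₂ * modePotential p x.m (attErr p ref t x.R) := by
    rw [div_mul_eq_mul_div, le_div_iff₀' hk, frobNorm_sq hRd hb hR]
    linarith [min_mul_le_modePotential hp hP x.m]
  have hvel := eucNorm_sq_le_kinetic hl hlK (velErr p ref t x)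
  rw [eucNorm_velErr hb hR] at hvel
  have hkin := kinetic_nonneg hK (velErr p ref t x)
  have hpot := modePotential_nonneg hp hP x.m
  rw [trackingError, stateEnergy, energy]
  set U := modePotential p x.m (attErr p ref t x.R)
  set V := kinetic (frameInertia p) (velErr p ref t x)
  calc _ ≤ 2 * (frobNorm (x.R - ref.Rd t) ^ 2 + eucNorm (x.R *ᵥ x.Ω - ref.ωd t) ^ 2) := add_sq_le
    _ ≤ 2 * (12 / min p.k₁ p.k₂ * U + 2 / l * V) := by gcongr
    _ = 24 / min p.k₁ p.k₂ * U + 4 / l * V := by ring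
    _ ≤ (24 / min p.k₁ p.k₂ + 4 / l) * U + (24 / min p.k₁ p.k₂ + 4 / l) * V := by
      gcongr
      · exact le_add_of_nonneg_right (by positivity)
      · exact le_add_of_nonneg_left (by positivity)
    _ = (24 / min p.k₁ p.k₂ + 4 / l) * (V + U) := by ring

theorem exists_stateEnergy_le :
    ∃ A > 0, ∀ t, ref.Rd t ∈ SO3 → ∀ x : State, x.R ∈ SO3 → x ∈ flowSet p ref t →
      stateEnergy p ref t x ≤ A * trackingError ref t x ^ 2 := by
  obtain ⟨L, hL, hLK⟩ := exists_eucNorm_mulVec_le (frameInertia p)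
  have hk₁ := hp.k₁_pos
  have hk₂ := hp.k₂_pos
  refine ⟨L / 2 + 3 / 2 * (p.k₁ + p.k₂), by positivity, fun t hRd x hR hflow => ?_⟩
  have hpot := modePotential_le_trace hp (attErr_mem_SO3 hRd hb hR) ((mem_flowSet_iff hRd).1 hflow)
  have hkin := kinetic_le_eucNorm_sq hLK (velErr p ref t x)
  rw [eucNorm_velErr hb hR] at hkin
  have hatt : frobNorm (x.R - ref.Rd t) ^ 2 ≤ trackingError ref t x ^ 2 :=
    pow_le_pow_left₀ (frobNorm_nonneg _) (le_add_of_nonneg_right (eucNorm_nonneg _)) 2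
  have hvel : eucNorm (x.R *ᵥ x.Ω - ref.ωd t) ^ 2 ≤ trackingError ref t x ^ 2 :=
    pow_le_pow_left₀ (eucNorm_nonneg _) (le_add_of_nonneg_left (frobNorm_nonneg _)) 2
  calc stateEnergy p ref t x ≤ L / 2 * eucNorm (x.R *ᵥ x.Ω - ref.ωd t) ^ 2 +
        3 / 2 * (p.k₁ + p.k₂) * frobNorm (x.R - ref.Rd t) ^ 2 := by
        rw [frobNorm_sq hRd hb hR, stateEnergy, energy]
        linarith
    _ ≤ L / 2 * trackingError ref t x ^ 2 +
        3 / 2 * (p.k₁ + p.k₂) * trackingError ref t x ^ 2 := by gcongr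
    _ = _ := by ring

end TrackingError

section Exponential

variable (hb : p.Orthonormal) (hJ : p.J.PosDef) (href : ref.IsAdmissible)
include hb hJ href

theorem IsSolution.initial_mem_flowSet_or {t₀ : ℝ} (ht₀ : 0 ≤ t₀) {E : Set (ℝ × ℕ)}
    {x : ℝ → ℕ → State} (h : IsSolution p ref t₀ E x) {T : ℝ} {N : ℕ} (hT : (T, N) ∈ E) :
    x t₀ 0 ∈ flowSet p ref t₀ ∨ (T = t₀ ∧ N = 0) ∨ ((t₀, 1) ∈ E ∧ 1 ≤ N) := by
  have hinit := h.domain.initial_mem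
  by_cases hflow : ∃ s, t₀ < s ∧ (s, 0) ∈ E
  · obtain ⟨s, hs, hsE⟩ := hflow
    have hsub : Set.Ioo t₀ s ⊆ timeSlice E 0 :=
      Set.Ioo_subset_Icc_self.trans ((h.domain.ordConnected_timeSlice 0).out hinit hsE)
    refine .inl ((h.isAdmissibleFlow hJ hinit).toIsFlow.mem_flowSet_of_mem_closure hb hJ href
      (fun t ht => ht₀.trans (h.domain.initial_le ht)) hsub
      (fun t ht => h.mem_flowSet t 0 (interior_maximal hsub isOpen_Ioo ht)) hinit ?_)
    rw [closure_Ioo hs.ne]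
    exact Set.left_mem_Icc.2 hs.le
  · have heq : ∀ {s}, (s, 0) ∈ E → s = t₀ := fun hs =>
      (h.domain.initial_le hs).eq_of_not_lt' fun hlt => hflow ⟨_, hlt, hs⟩
    rcases N.eq_zero_or_pos with rfl | hN
    · exact .inr (.inl ⟨heq hT, rfl⟩)
    · obtain ⟨t, ht⟩ := exists_mem_of_exists_jumpTime
        (fun _ _ => h.domain.exists_jumpTime) hT hN
      obtain ⟨s, hs, hs'⟩ := h.domain.exists_jumpTime ht
      exact .inr (.inr ⟨heq hs ▸ hs', hN⟩)

variable (hp : p.Tuned)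
include hp

theorem exists_trackingError_sq_le_of_mem_flowSet :
    ∃ C > 0, ∃ r > 0, ∀ t₀, 0 ≤ t₀ → ∀ E x, IsSolution p ref t₀ E x → ∀ {s T : ℝ} {i N : ℕ},
      (s, i) ∈ E → (T, N) ∈ E → s ≤ T → i ≤ N → x s i ∈ flowSet p ref s →
        trackingError ref T (x T N) ^ 2 ≤
          C * Real.exp (-(r * (T - s))) * trackingError ref s (x s i) ^ 2 := by
  obtain ⟨B, hB₀, hB⟩ := href.exists_refVel_bound hb
  obtain ⟨κ, -, r, hr, hw⟩ := exists_isLyapunovWeight hp (frameInertia_posDef hb hJ) hB₀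
  obtain ⟨A₁, hA₁, hlower⟩ := exists_trackingError_sq_le (ref := ref) hp hb hJ
  obtain ⟨A₂, hA₂, hupper⟩ := exists_stateEnergy_le (ref := ref) hp hb
  refine ⟨4 * A₁ * A₂, by positivity, r, hr,
    fun t₀ ht₀ E x h s T i N hs hT hsT hiN hflow => ?_⟩
  have hRd : ∀ {t j}, (t, j) ∈ E → ref.Rd t ∈ SO3 := fun ht =>
    href.mem_SO3 _ (ht₀.trans (h.domain.initial_le ht))
  have hP : ∀ {t j}, (t, j) ∈ E → attErr p ref t (x t j).R ∈ SO3 := fun ht =>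
    attErr_mem_SO3 (hRd ht) hb (h.mem_SO3 _ _ ht)
  have hdecay : stateLyapunov p ref κ T (x T N) ≤
      Real.exp (-(r * (T - s))) * stateLyapunov p ref κ s (x s i) := by
    refine le_of_mul_le_mul_left ?_ (Real.exp_pos (r * T))
    rw [← mul_assoc, ← Real.exp_add, show r * T + -(r * (T - s)) = r * s by ring]
    exact h.exp_mul_stateLyapunov_le hb hJ href hw hB ht₀ hs hT hsT hiN
  calc trackingError ref T (x T N) ^ 2 ≤ A₁ * stateEnergy p ref T (x T N) :=
        hlower T (hRd hT) _ (h.mem_SO3 T N hT)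
    _ ≤ A₁ * (2 * stateLyapunov p ref κ T (x T N)) := by
        gcongr; exact hw.lower _ _ (hP hT) _
    _ ≤ A₁ * (2 * (Real.exp (-(r * (T - s))) * stateLyapunov p ref κ s (x s i))) := by gcongr
    _ ≤ A₁ * (2 * (Real.exp (-(r * (T - s))) * (2 * stateEnergy p ref s (x s i)))) := by
        gcongr; exact hw.upper _ _ (hP hs) _
    _ ≤ A₁ * (2 * (Real.exp (-(r * (T - s))) *
          (2 * (A₂ * trackingError ref s (x s i) ^ 2)))) := by
        gcongr; exact hupper s (hRd hs) _ (h.mem_SO3 s i hs) hflow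
    _ = 4 * A₁ * A₂ * Real.exp (-(r * (T - s))) * trackingError ref s (x s i) ^ 2 := by ring

theorem exists_trackingError_sq_le_exp :
    ∃ C > 0, ∃ r > 0, ∀ t₀, 0 ≤ t₀ → ∀ E x, IsSolution p ref t₀ E x → ∀ T N, (T, N) ∈ E →
      trackingError ref T (x T N) ^ 2 ≤
        C * Real.exp (-(r * (T - t₀))) * trackingError ref t₀ (x t₀ 0) ^ 2 := by
  obtain ⟨C, hC, r, hr, hdecay⟩ := exists_trackingError_sq_le_of_mem_flowSet hb hJ href hp
  refine ⟨max C 1, lt_max_of_lt_left hC, r, hr, fun t₀ ht₀ E x h T N hT => ?_⟩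
  have hinit := h.domain.initial_mem
  have hT₀ := h.domain.initial_le hT
  have hmono : ∀ {c}, c ≤ max C 1 →
      c * Real.exp (-(r * (T - t₀))) * trackingError ref t₀ (x t₀ 0) ^ 2 ≤
        max C 1 * Real.exp (-(r * (T - t₀))) * trackingError ref t₀ (x t₀ 0) ^ 2 := fun hc => by
    gcongr
  rcases h.initial_mem_flowSet_or hb hJ href ht₀ hT with hflow | ⟨rfl, rfl⟩ | ⟨hjump, hN⟩
  · exact (hdecay t₀ ht₀ E x h hinit hT hT₀ N.zero_le hflow).trans (hmono (le_max_left C 1))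
  · simpa using hmono (le_max_right C 1)
  · have hJump := h.isJump hinit hjump
    have hflow := hJump.mem_flowSet (href.mem_SO3 t₀ ht₀) hp.δ_pos.le
    refine le_trans ?_ (hmono (le_max_left C 1))
    simpa only [zero_add, hJump.trackingError_eq] using
      hdecay t₀ ht₀ E x h hjump hT hT₀ hN hflow

theorem exists_exponential_bound :
    ∃ M > 0, ∃ lam > 0, ∀ t₀, 0 ≤ t₀ → ∀ E x, IsSolution p ref t₀ E x → ∀ t j, (t, j) ∈ E →
      trackingError ref t (x t j) ≤
        M * Real.exp (-lam * (t - t₀)) * trackingError ref t₀ (x t₀ 0) := by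
  obtain ⟨C, hC, r, hr, hdecay⟩ := exists_trackingError_sq_le_exp hb hJ href hp
  refine ⟨√C, by positivity, r / 2, by positivity, fun t₀ ht₀ E x h t j ht => ?_⟩
  have herr := trackingError_nonneg ref t₀ (x t₀ 0)
  refine le_of_sq_le_sq ?_ (by positivity)
  have hexp : Real.exp (-(r / 2) * (t - t₀)) ^ 2 = Real.exp (-(r * (t - t₀))) := by
    rw [← Real.exp_nat_mul]
    congr 1
    push_cast
    ring
  rw [mul_pow, mul_pow, Real.sq_sqrt hC.le, hexp]
  exact hdecay t₀ ht₀ E x h t j ht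

end Exponential

end AttitudeTracking

end

theorem proposition3 (p : AttitudeTracking.Params) (ref : AttitudeTracking.Reference)
    (href : ref.IsAdmissible)
    (hJ : p.J.PosDef)
    (hb₁ : p.b₁ ⬝ᵥ p.b₁ = 1) (hb₂ : p.b₂ ⬝ᵥ p.b₂ = 1) (hb : p.b₁ ⬝ᵥ p.b₂ = 0)
    (hk₁ : 0 < p.k₁) (hk₂ : 0 < p.k₂) (hk : p.k₁ ≠ p.k₂) (hkΩ : 0 < p.kΩ)
    (hα₁ : 1 < p.α) (hα₂ : p.α < 2)
    (hβ₀ : p.β ≠ 0) (hβ : |p.β| < p.α - 1)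
    (hδ₀ : 0 < p.δ) (hδ : p.δ < min p.k₁ p.k₂ * min (2 - p.α) (p.α - |p.β| - 1)) :
    AttitudeTracking.GloballyExponentiallyStable p ref := by
  have hp : p.Tuned := ⟨hk₁, hk₂, hk, hkΩ, hα₂, hβ₀, hβ, hδ₀, hδ⟩
  have ho : p.Orthonormal := ⟨hb₁, hb₂, hb⟩
  exact ⟨fun t₀ ht₀ x₀ hx₀ => AttitudeTracking.hasCompleteSolution ho hJ href hp ht₀ hx₀,
    fun t₀ ht₀ E x h => h.timeUnbounded hp ho hJ href ht₀,
    AttitudeTracking.exists_exponential_bound ho hJ href hp⟩
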